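/- Consider the Vlasov equation $\partial_t f+\{\mathcal H[f],f\}=0$ of the Hamiltonian mean-field (HMF) model on $S^1\times\mathbb R\ni(q,p)$, where $\{a,b\}=\partial_pa\,\partial_qb-\partial_qa\,\partial_pb$, $\mathcal H[f]=\frac{p^2}{2}+\mathcal V[f](q)$ and $\mathcal V[f](q)=-\iint\cos(q-q')f(q',p')\,dq'dp'$. Let $f_0$ be an integrable, differentiable stationary solution that is spatially inhomogeneous; by rotation let its order parameter be $\left(\iint\cos q\,f_0,\iint\sin q\,f_0\right)=(M_0,0)$ with $M_0>0$. Put $\mathcal E(q,p)=\frac{p^2}{2}-M_0\cos q$ and assume $f_0(q,p)=\hat f_0(\mathcal E(q,p))$, where $\hat f_0$ is strictly decreasing and continuously differentiable on $[-M_0,\infty)$. Divide phase space (up to a null set) into three regions, with the following ranges of the action $J$: $\{\mathcal E>M_0,\,p>0\}$ and $\{\mathcal E>M_0,\,p<0\}$, each with $J\in(4\sqrt{M_0}/\pi,\infty)$, and $\{|\mathcal E|<M_0\}$ with $J\in(0,8\sqrt{M_0}/\pi)$; $\int_L\,\cdot\,dJ$ denotes the sum of the integrals over the three action ranges. Let $(\theta,J)$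 be the angle-action coordinates of $\mathcal E$ in each region, with $\theta=0$ at $q=0$ (and $p>0$ for the orbits in $\{|\mathcal E|<M_0\}$); write $\mathcal E(J)$ for the energy as a function of $J$, $\Omega(J)=d\mathcal E(J)/dJ$, $\tilde f_0(J)=\hat f_0(\mathcal E(J))$ (which is strictly decreasing in $J$ in each region), and for $n\in\mathbb Z$ $$C^n(J)=\frac1{2\pi}\int_{-\pi}^{\pi}\cos q(\theta,J)\,e^{-in\theta}\,d\theta,\qquad S^n(J)=\frac1{2\pi}\int_{-\pi}^{\pi}\sin q(\theta,J)\,e^{-in\theta}\,d\theta .$$ For $\operatorname{Im}\omega>0$ define the dispersion functions $$D_x(\omega)=1+2\pi\sum_{m\in\mathbb Z}\int_L\frac{m\tilde f_0'(J)}{m\Omega(J)-\omega}|C^m(J)|^2dJ,\qquad D_y(\omega)=1+2\pi\sum_{m\in\mathbb Z}\int_L\frac{m\tilde f_0'(J)}{m\Omega(J)-\omega}|S^m(J)|^2dJ,$$ and put $$\mathcal I[f_0]=1+\int_{-\pi}^{\pi}dq\,\cos^2q\int_{-\infty}^{\infty}\frac1p\frac{\partial f_0}{\partial p}(q,p)\,dp-2\pi\int_L\frac{\tilde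 f_0'(J)}{\Omega(J)}|C^0(J)|^2dJ .$$ Call $f_0$ spectrally stable if the linearized Vlasov operator $\hat{\mathcal L}f_1=-\{\mathcal H[f_0],f_1\}-\{\mathcal V[f_1],f_0\}$, acting on $L^1(S^1\times\mathbb R;\mathbb C)$ with its maximal domain (transport term in the sense of distributions), has no spectrum with positive real part. Then all the integrals and sums above converge absolutely, $f_0$ is spectrally stable if and only if $\mathcal I[f_0]\ge0$, and $$D_x(0):=\lim_{\varepsilon\to0+}D_x(i\varepsilon)=\mathcal I[f_0],\qquad D_y(0):=\lim_{\varepsilon\to0+}D_y(i\varepsilon)=0 .$$ -/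

import Mathlib

open MeasureTheory Set Filter Topology

noncomputable section

namespace HMF

/-! ### The Vlasov equation of the Hamiltonian mean-field model

The one-particle phase space is the cylinder `S¹ × ℝ`. Functions on it are functions of
`z = (q, p) : ℝ × ℝ` that are `2π`-periodic in `q`, integrated over one period. -/

/-- The measure `dq dp` on the fundamental domain `(-π, π] × ℝ` of the cylinder. -/
def phaseMeasure : Measure (ℝ × ℝ) :=
  (volume.restrict (Ioc (-Real.pi) Real.pi)).prod volume

/-- The order parameter `M_x[f] = ∬ cos q f dq dp`. -/
def orderX (f : ℝ × ℝ → ℝ) : ℝ := ∫ z, Real.cos z.1 * f z ∂phaseMeasure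

/-- The order parameter `M_y[f] = ∬ sin q f dq dp`. -/
def orderY (f : ℝ × ℝ → ℝ) : ℝ := ∫ z, Real.sin z.1 * f z ∂phaseMeasure

/-- The mean-field potential `V[f](q) = - ∬ cos (q - q') f(q', p') dq' dp'`
of a real or complex phase-space function. -/
def meanField {E : Type*} [NormedAddCommGroup E] [NormedSpace ℝ E]
    (f : ℝ × ℝ → E) (q : ℝ) : E :=
  -∫ z, Real.cos (q - z.1) • f z ∂phaseMeasure

/-- The effective one-particle Hamiltonian `H[f](q, p) = p² / 2 + V[f](q)`. -/
def effHamiltonian (f : ℝ × ℝ → ℝ) (z : ℝ × ℝ) : ℝ := z.2 ^ 2 / 2 + meanField f z.1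

/-- The Poisson bracket `{a, b} = ∂ₚa ∂_q b - ∂_q a ∂ₚb`. -/
def poisson {𝕜 : Type*} [RCLike 𝕜] (a b : ℝ × ℝ → 𝕜) (z : ℝ × ℝ) : 𝕜 :=
  deriv (fun p : ℝ => a (z.1, p)) z.2 * deriv (fun q : ℝ => b (q, z.2)) z.1
    - deriv (fun q : ℝ => a (q, z.2)) z.1 * deriv (fun p : ℝ => b (z.1, p)) z.2

/-- `f` is an (integrable, classical) stationary solution of the Vlasov equation
`∂ₜf + {H[f], f} = 0` on the cylinder. -/
structure IsStationarySolution (f : ℝ × ℝ → ℝ) : Prop where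
  periodic : ∀ q p : ℝ, f (q + 2 * Real.pi, p) = f (q, p)
  integrable : Integrable f phaseMeasure
  differentiable : Differentiable ℝ f
  stationary : ∀ z, poisson (effHamiltonian f) f z = 0

/-! ### The linearized Vlasov operator and spectral stability -/

/-- Complex perturbations: the Banach space `L¹(S¹ × ℝ, dq dp; ℂ)`. -/
abbrev Perturbation : Type := Lp ℂ 1 phaseMeasure

/-- Test functions on the cylinder: `C¹`, `2π`-periodic in `q`, vanishing for large `|p|`. -/
structure IsTestFunction (φ : ℝ × ℝ → ℂ) : Prop where
  contDiff : ContDiff ℝ 1 φ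
  periodic : ∀ q p : ℝ, φ (q + 2 * Real.pi, p) = φ (q, p)
  support : ∃ r : ℝ, ∀ q p : ℝ, r ≤ |p| → φ (q, p) = 0

/-- `f` is in the domain of the linearized Vlasov operator
`L f = - {H[f₀], f} - {V[f], f₀}` and `L f = h`. The transport term is taken in the sense of
distributions: `- ∬ {H[f₀], f} φ = ∬ f {H[f₀], φ}` for every test function `φ`. -/
def LinearizedVlasov (f₀ : ℝ × ℝ → ℝ) (f h : Perturbation) : Prop :=
  ∀ φ : ℝ × ℝ → ℂ, IsTestFunction φ →
    ∫ z, h z * φ z ∂phaseMeasure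
      = ∫ z, f z * poisson (fun w => (effHamiltonian f₀ w : ℂ)) φ z ∂phaseMeasure
        - ∫ z, poisson (fun w => meanField f w.1) (fun w => (f₀ w : ℂ)) z * φ z ∂phaseMeasure

/-- The resolvent set of the (unbounded) linearized Vlasov operator `L`: the `s` for which
`s - L` is a bijection of the domain of `L` onto the whole space with bounded inverse `R`. -/
def vlasovResolventSet (f₀ : ℝ × ℝ → ℝ) : Set ℂ :=
  {s | ∃ R : Perturbation →L[ℂ] Perturbation, ∀ f g : Perturbation,
    LinearizedVlasov f₀ f (s • f - g) ↔ f = R g}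

/-- The spectrum of the linearized Vlasov operator. -/
def vlasovSpectrum (f₀ : ℝ × ℝ → ℝ) : Set ℂ := (vlasovResolventSet f₀)ᶜ

/-- Spectral stability: no spectrum with positive real part. -/
def SpectrallyStable (f₀ : ℝ × ℝ → ℝ) : Prop :=
  ∀ s ∈ vlasovSpectrum f₀, ¬ 0 < s.re

/-! ### Angle-action coordinates of the one-particle Hamiltonian -/

/-- The one-particle energy `p² / 2 - M₀ cos q`. -/
def energy (M₀ : ℝ) (z : ℝ × ℝ) : ℝ := z.2 ^ 2 / 2 - M₀ * Real.cos z.1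

/-- The three parts of phase space cut out by the separatrix: rotation with `p > 0`,
libration (inside the separatrix), rotation with `p < 0`. -/
inductive Region : Type
  | rotPos
  | trapped
  | rotNeg

/-- The energies occurring in each region. -/
def energyRange (M₀ : ℝ) : Region → Set ℝ
  | .rotPos => Ioi M₀
  | .trapped => Ioo (-M₀) M₀
  | .rotNeg => Ioi M₀

/-- The actions occurring in each region. -/
def actionRange (M₀ : ℝ) : Region → Set ℝ
  | .rotPos => Ioi (4 * Real.sqrt M₀ / Real.pi)
  | .trapped => Ioo 0 (8 * Real.sqrt M₀ / Real.pi)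
  | .rotNeg => Ioi (4 * Real.sqrt M₀ / Real.pi)

/-- The action `(2π)⁻¹ ∮ |p| |dq|` along the orbit of energy `E`, where
`|p| = √(2 (E + M₀ cos q))`. A librating orbit runs through its `q`-interval twice; outside
that interval the square root is that of a negative number, hence `0`. -/
def action (M₀ : ℝ) : Region → ℝ → ℝ
  | .rotPos, E => (1 / (2 * Real.pi)) *
      ∫ q in (-Real.pi)..Real.pi, Real.sqrt (2 * (E + M₀ * Real.cos q))
  | .trapped, E => (1 / Real.pi) *
      ∫ q in (-Real.pi)..Real.pi, Real.sqrt (2 * (E + M₀ * Real.cos q))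
  | .rotNeg, E => (1 / (2 * Real.pi)) *
      ∫ q in (-Real.pi)..Real.pi, Real.sqrt (2 * (E + M₀ * Real.cos q))

/-- The energy as a function of the action, in each region. -/
def energyOfAction (M₀ : ℝ) (i : Region) (J : ℝ) : ℝ :=
  Function.invFunOn (action M₀ i) (energyRange M₀ i) J

/-- The frequency `Ω(J) = dE / dJ`. -/
def frequency (M₀ : ℝ) (i : Region) (J : ℝ) : ℝ := deriv (energyOfAction M₀ i) J

/-- The Hamiltonian vector field of `energy M₀`. -/
def hamiltonField (M₀ : ℝ) (z : ℝ × ℝ) : ℝ × ℝ := (z.2, -(M₀ * Real.sin z.1))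

theorem hamiltonField_lipschitz (M₀ : ℝ) :
    LipschitzWith (Real.toNNReal (1 + |M₀|)) (hamiltonField M₀) := by
  refine LipschitzWith.of_dist_le_mul fun x y => ?_
  have h0 : 0 ≤ |M₀| := abs_nonneg _
  rw [Real.coe_toNNReal _ (by positivity)]
  have h1 : |x.1 - y.1| ≤ dist x y := by rw [Prod.dist_eq]; exact le_max_left _ _
  have h2 : |x.2 - y.2| ≤ dist x y := by rw [Prod.dist_eq]; exact le_max_right _ _
  have h3 : |Real.sin x.1 - Real.sin y.1| ≤ |x.1 - y.1| := by
    simpa [Real.dist_eq] using Real.lipschitzWith_sin.dist_le_mul x.1 y.1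
  have h4 := dist_nonneg (x := x) (y := y)
  rw [Prod.dist_eq]
  refine max_le ?_ ?_
  · simp only [hamiltonField, Real.dist_eq]; nlinarith
  · simp only [hamiltonField, Real.dist_eq]
    have : -(M₀ * Real.sin x.1) - -(M₀ * Real.sin y.1) = -(M₀ * (Real.sin x.1 - Real.sin y.1)) := by ring
    rw [this, abs_neg, abs_mul]
    nlinarith [mul_le_mul_of_nonneg_left (h3.trans h1) h0]

theorem exists_orbit (M₀ : ℝ) (z₀ : ℝ × ℝ) :
    ∃ γ : ℝ → ℝ × ℝ, γ 0 = z₀ ∧ ∀ t, HasDerivAt γ (hamiltonField M₀ (γ t)) t := by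
  have hcd : ContDiff ℝ 1 (hamiltonField M₀) := by unfold hamiltonField; fun_prop
  have hC : 0 < 1 + |M₀| := by positivity
  have hloc : ∀ x : ℝ × ℝ, ∃ γ : ℝ → ℝ × ℝ, γ 0 = x ∧
      IsMIntegralCurveOn (I := modelWithCornersSelf ℝ (ℝ × ℝ)) γ (hamiltonField M₀)
        (Ioo (-(1 / (2 * (1 + |M₀|)))) (1 / (2 * (1 + |M₀|)))) := by
    intro x
    set ε : ℝ := 1 / (2 * (1 + |M₀|)) with hε
    have hεpos : 0 < ε := by positivity
    have hpl : IsPicardLindelof (fun _ => hamiltonField M₀) (tmin := -ε) (tmax := ε)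
        ⟨0, by constructor <;> linarith⟩ x ‖x‖₊ 0
        (Real.toNNReal (1 + |M₀|) * (2 * ‖x‖₊)) (Real.toNNReal (1 + |M₀|)) := by
      refine ⟨fun _ _ => (hamiltonField_lipschitz M₀).lipschitzOnWith,
        fun _ _ => continuousOn_const, fun _ _ y hy => ?_, ?_⟩
      · have h := (hamiltonField_lipschitz M₀).dist_le_mul y 0
        have h0 : hamiltonField M₀ 0 = 0 := by simp [hamiltonField]
        rw [h0, dist_zero_right, dist_zero_right] at h
        refine h.trans ?_
        have hy' : ‖y‖ ≤ 2 * ‖x‖ := by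
          have h1 := norm_sub_norm_le y x
          have h2 := mem_closedBall_iff_norm.1 hy
          simp only [coe_nnnorm] at h2
          linarith
        push_cast
        gcongr
      · push_cast
        rw [Real.coe_toNNReal _ hC.le]
        simp only [sub_zero, zero_sub, neg_neg, max_self]
        rw [hε]
        apply le_of_eq
        field_simp
    obtain ⟨α, h0, hα⟩ := hpl.exists_eq_forall_mem_Icc_hasDerivWithinAt₀
    refine ⟨α, h0, fun t ht => ?_⟩
    have h := hα t (Ioo_subset_Icc_self ht)
    exact (h.mono Ioo_subset_Icc_self).hasFDerivWithinAt.hasMFDerivWithinAt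
  obtain ⟨γ, h0, hγ⟩ := exists_isMIntegralCurve_of_isMIntegralCurveOn
    (I := modelWithCornersSelf ℝ (ℝ × ℝ)) (v := hamiltonField M₀)
    (contMDiff_vectorSpace_iff_contDiff.2 hcd) (by positivity) hloc z₀
  refine ⟨γ, h0, fun t => ?_⟩
  have h : HasFDerivAt γ (ContinuousLinearMap.toSpanSingleton ℝ (hamiltonField M₀ (γ t))) t :=
    (hγ t).hasFDerivAt
  exact hasDerivAt_iff_hasFDerivAt.2 h

/-- The orbit `t ↦ (q(t), p(t))` of `energy M₀` with `(q(0), p(0)) = z₀`, that is,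
`q' = p`, `p' = - M₀ sin q`. -/
def orbit (M₀ : ℝ) (z₀ : ℝ × ℝ) : ℝ → ℝ × ℝ := Classical.choose (exists_orbit M₀ z₀)

/-- The point `q = 0` on the orbit of energy `E` in the given region (with `p > 0` for a
librating orbit). The angle is counted from there. -/
def basePoint (M₀ : ℝ) : Region → ℝ → ℝ × ℝ
  | .rotPos, E => (0, Real.sqrt (2 * (E + M₀)))
  | .trapped, E => (0, Real.sqrt (2 * (E + M₀)))
  | .rotNeg, E => (0, -Real.sqrt (2 * (E + M₀)))

/-- The map `(θ, J) ↦ (q, p)`: on the orbit of action `J` the angle advances in time at the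
constant rate `Ω(J)`, so the point with angle `θ` is reached at the time `θ / Ω(J)`. -/
def angleAction (M₀ : ℝ) (i : Region) (θ J : ℝ) : ℝ × ℝ :=
  orbit M₀ (basePoint M₀ i (energyOfAction M₀ i J)) (θ / frequency M₀ i J)

/-- `C^n(J) = (2π)⁻¹ ∫_{-π}^{π} cos q(θ, J) e^{-inθ} dθ`. -/
def cosCoeff (M₀ : ℝ) (n : ℤ) (i : Region) (J : ℝ) : ℂ :=
  (1 / (2 * Real.pi) : ℂ) * ∫ θ in (-Real.pi)..Real.pi,
    (Real.cos (angleAction M₀ i θ J).1 : ℂ) * Complex.exp (-Complex.I * n * θ)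

/-- `S^n(J) = (2π)⁻¹ ∫_{-π}^{π} sin q(θ, J) e^{-inθ} dθ`. -/
def sinCoeff (M₀ : ℝ) (n : ℤ) (i : Region) (J : ℝ) : ℂ :=
  (1 / (2 * Real.pi) : ℂ) * ∫ θ in (-Real.pi)..Real.pi,
    (Real.sin (angleAction M₀ i θ J).1 : ℂ) * Complex.exp (-Complex.I * n * θ)

/-- `∫_L F(J) dJ`: the sum of the integrals over the actions of the three regions. -/
def actionIntegral {E : Type*} [NormedAddCommGroup E] [NormedSpace ℝ E]
    (M₀ : ℝ) (F : Region → ℝ → E) : E :=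
  (∫ J in actionRange M₀ .rotPos, F .rotPos J)
    + (∫ J in actionRange M₀ .trapped, F .trapped J)
    + ∫ J in actionRange M₀ .rotNeg, F .rotNeg J

/-- Absolute convergence of `∫_L F(J) dJ`. -/
def ActionIntegrable {E : Type*} [NormedAddCommGroup E]
    (M₀ : ℝ) (F : Region → ℝ → E) : Prop :=
  ∀ i, IntegrableOn (F i) (actionRange M₀ i)

/-! ### The dispersion functions and the stability functional -/

/-- The profile `J ↦ fhat(E(J))`, i.e. the distribution as a function of the action. -/
def actionProfile (M₀ : ℝ) (fhat : ℝ → ℝ) (i : Region) (J : ℝ) : ℝ :=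
  fhat (energyOfAction M₀ i J)

/-- The integrand `m f'(J) / (m Ω(J) - ω) |A^m(J)|²` of the dispersion functions. -/
def dispersionIntegrand (M₀ : ℝ) (fhat : ℝ → ℝ) (A : ℤ → Region → ℝ → ℂ) (ω : ℂ)
    (m : ℤ) (i : Region) (J : ℝ) : ℂ :=
  (m : ℂ) * ((deriv (actionProfile M₀ fhat i) J : ℝ) : ℂ) / ((m : ℂ) * ((frequency M₀ i J : ℝ) : ℂ) - ω)
    * ((‖A m i J‖ ^ 2 : ℝ) : ℂ)

/-- `1 + 2π ∑_{m ∈ ℤ} ∫_L m f'(J) / (m Ω(J) - ω) |A^m(J)|² dJ`, for `Im ω > 0`. -/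
def dispersion (M₀ : ℝ) (fhat : ℝ → ℝ) (A : ℤ → Region → ℝ → ℂ) (ω : ℂ) : ℂ :=
  1 + 2 * Real.pi * ∑' m : ℤ, actionIntegral M₀ (dispersionIntegrand M₀ fhat A ω m)

/-- All the integrals in the dispersion function at `ω` converge absolutely, and so does
their sum. -/
def DispersionConverges (M₀ : ℝ) (fhat : ℝ → ℝ) (A : ℤ → Region → ℝ → ℂ) (ω : ℂ) : Prop :=
  (∀ m : ℤ, ActionIntegrable M₀ (dispersionIntegrand M₀ fhat A ω m)) ∧
    Summable fun m : ℤ => actionIntegral M₀ (dispersionIntegrand M₀ fhat A ω m)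

/-- `D_x(ω)`, for perturbations parallel to the order parameter. -/
def dispersionX (M₀ : ℝ) (fhat : ℝ → ℝ) (ω : ℂ) : ℂ := dispersion M₀ fhat (cosCoeff M₀) ω

/-- `D_y(ω)`, for perturbations perpendicular to the order parameter. -/
def dispersionY (M₀ : ℝ) (fhat : ℝ → ℝ) (ω : ℂ) : ℂ := dispersion M₀ fhat (sinCoeff M₀) ω

/-- The integrand `f'(J) / Ω(J) |C⁰(J)|²`. -/
def criterionIntegrand (M₀ : ℝ) (fhat : ℝ → ℝ) (i : Region) (J : ℝ) : ℝ :=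
  deriv (actionProfile M₀ fhat i) J / frequency M₀ i J * ‖cosCoeff M₀ 0 i J‖ ^ 2

/-- `I[f₀] = 1 + ∫ cos² q ∫ (1/p) ∂ₚf₀ dp dq - 2π ∫_L f'(J) / Ω(J) |C⁰(J)|² dJ`. -/
def criterion (M₀ : ℝ) (fhat : ℝ → ℝ) (f₀ : ℝ × ℝ → ℝ) : ℝ :=
  1 + (∫ q in (-Real.pi)..Real.pi, Real.cos q ^ 2 *
        ∫ p : ℝ, 1 / p * deriv (fun p' : ℝ => f₀ (q, p')) p)
    - 2 * Real.pi * actionIntegral M₀ (criterionIntegrand M₀ fhat)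

/-- Both integrals in `I[f₀]` converge absolutely. -/
def CriterionConverges (M₀ : ℝ) (fhat : ℝ → ℝ) (f₀ : ℝ × ℝ → ℝ) : Prop :=
  Integrable (fun z : ℝ × ℝ =>
      Real.cos z.1 ^ 2 * (1 / z.2 * deriv (fun p' : ℝ => f₀ (z.1, p')) z.2)) phaseMeasure ∧
    ActionIntegrable M₀ (criterionIntegrand M₀ fhat)

end HMF

end

noncomputable section

namespace HMF

section

/-! ### Orbits of the one-particle Hamiltonian -/

/-! Everything is read off from one positive measure. For an observable A(q), here cos q or sin q,
let A^m(J) be its Fourier coefficients in the angle, and let ν_A (`spectralMeasure`) be the image of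
the weights -2π f̂₀'(E) |A^m(J)|² dJ under J ↦ mΩ(J), summed over m and over the three regions. The
weights are nonnegative because f̂₀ decreases. By Parseval and dq dp = dθ dJ the total mass is -∬ A²
f̂₀'(ℰ) dq dp, which is finite. Since f̃₀' = Ω f̂₀', the dispersion function is D_A(ω) = 1 - ∫ y/(y
- ω) dν_A(y) (`dispersion_eq`).

Limits at 0. The integrand y/(y - iε) is bounded by 1 and tends to the indicator of y ≠ 0, so D_A(0)
= 1 - ν_A(ℝ∖{0}). As Ω > 0, the atom of ν_A at 0 is exactly the m = 0 mode. For A = cos this turns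
the limit into I[f₀] (`criterion_eq`). For A = sin the mode m = 0 vanishes by reflection symmetry,
and integrating the self-consistency relation M₀ = ∬ cos q f₀ by parts in q gives ∬ sin² q f̂₀'(ℰ) =
-1 (`integral_sin_sq`). Hence ν_sin(ℝ∖{0}) = 1 and the limit is 0.

Spectrum. The linearized operator is the transport operator T along the orbits of ℰ plus an operator
of rank two, because the mean field sees a perturbation only through its cos and sin means. For Re s
> 0, s - T is invertible on L¹: the inverse is the Laplace transform of the measure-preserving flow,
and uniqueness in the sense of distributions comes from pairing with test functions carried by the
flow (`transportEquation_iff`). Solving s f - L f = g then amounts to two scalar equations for the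
means. They decouple under (q, p) ↦ (-q, -p), and their coefficients are 1 - r_A(s), where r_A(s) =
∫ y/(y - is) dν_A = 1 - D_A(is). The Laplace transform of the autocorrelation of A along the flow
provides this formula (`integral_observable_mul_response_self`).

Zeros. Since ν_A is symmetric, r_A(s) = ∫ y²/(y² + s²) dν_A. For non-real s its imaginary part can
vanish only if ν_A sits at 0, and then r_A = 0; on the positive half-line r_A is continuous, stays
below ν_A(ℝ∖{0}) unless that mass is 0, tends to that mass at 0 and tends to 0 at infinity. So r_A
takes the value 1 in Re s > 0 if and only if ν_A(ℝ∖{0}) > 1. For sin the mass is exactly 1, so this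
never happens; for cos it happens exactly when I[f₀] < 0. -/

theorem orbit_zero (M₀ : ℝ) (z : ℝ × ℝ) : orbit M₀ z 0 = z :=
  (Classical.choose_spec (exists_orbit M₀ z)).1

theorem hasDerivAt_orbit (M₀ : ℝ) (z : ℝ × ℝ) (t : ℝ) :
    HasDerivAt (orbit M₀ z) (hamiltonField M₀ (orbit M₀ z t)) t :=
  (Classical.choose_spec (exists_orbit M₀ z)).2 t

theorem hasDerivAt_orbit_fst (M₀ : ℝ) (z : ℝ × ℝ) (t : ℝ) :
    HasDerivAt (fun t => (orbit M₀ z t).1) (orbit M₀ z t).2 t :=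
  ((hasFDerivAt_fst (𝕜 := ℝ) (p := orbit M₀ z t)).comp_hasDerivAt t (hasDerivAt_orbit M₀ z t))

theorem hasDerivAt_orbit_snd (M₀ : ℝ) (z : ℝ × ℝ) (t : ℝ) :
    HasDerivAt (fun t => (orbit M₀ z t).2) (-(M₀ * Real.sin (orbit M₀ z t).1)) t :=
  ((hasFDerivAt_snd (𝕜 := ℝ) (p := orbit M₀ z t)).comp_hasDerivAt t (hasDerivAt_orbit M₀ z t))

/-- Uniqueness for a globally Lipschitz field. The group law and the translation, inversion and
time-reversal symmetries of the flow below all come from checking that the transformed curve solves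
the same equation. -/
theorem eq_orbit {M₀ : ℝ} {γ : ℝ → ℝ × ℝ}
    (h : ∀ t, HasDerivAt γ (hamiltonField M₀ (γ t)) t) (t : ℝ) :
    γ t = orbit M₀ (γ 0) t := by
  have := ODE_solution_unique_univ (v := fun _ => hamiltonField M₀) (s := fun _ => univ)
    (K := Real.toNNReal (1 + |M₀|)) (f := γ) (g := orbit M₀ (γ 0)) (t₀ := 0)
    (fun _ => (hamiltonField_lipschitz M₀).lipschitzOnWith)
    (fun t => ⟨h t, mem_univ _⟩) (fun t => ⟨hasDerivAt_orbit _ _ t, mem_univ _⟩)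
    (orbit_zero _ _).symm
  exact congrFun this t

theorem orbit_orbit (M₀ : ℝ) (z : ℝ × ℝ) (s t : ℝ) :
    orbit M₀ (orbit M₀ z s) t = orbit M₀ z (s + t) := by
  have h : ∀ t, HasDerivAt (fun t => orbit M₀ z (s + t))
      (hamiltonField M₀ (orbit M₀ z (s + t))) t := fun t =>
    HasDerivAt.comp_const_add s t (hasDerivAt_orbit M₀ z (s + t))
  have := eq_orbit h t
  simpa using this.symm

theorem orbit_add_int_mul (M₀ : ℝ) (z : ℝ × ℝ) (n : ℤ) (t : ℝ) :
    orbit M₀ (z + (n * (2 * Real.pi), 0)) t = orbit M₀ z t + (n * (2 * Real.pi), 0) := by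
  have h : ∀ t, HasDerivAt (fun t => orbit M₀ z t + ((n : ℝ) * (2 * Real.pi), (0 : ℝ)))
      (hamiltonField M₀ (orbit M₀ z t + ((n : ℝ) * (2 * Real.pi), (0 : ℝ)))) t := fun t => by
    have := (hasDerivAt_orbit M₀ z t).add_const ((n : ℝ) * (2 * Real.pi), (0 : ℝ))
    exact this.congr_deriv (by simp [hamiltonField, Real.sin_add_int_mul_two_pi])
  have := eq_orbit h t
  simpa [orbit_zero] using this.symm

theorem orbit_neg (M₀ : ℝ) (z : ℝ × ℝ) (t : ℝ) : orbit M₀ (-z) t = -orbit M₀ z t := by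
  have h : ∀ t, HasDerivAt (fun t => -orbit M₀ z t)
      (hamiltonField M₀ (-orbit M₀ z t)) t := fun t => by
    exact (hasDerivAt_orbit M₀ z t).neg.congr_deriv (by simp [hamiltonField])
  have := eq_orbit h t
  simpa [orbit_zero] using this.symm

theorem orbit_reverse (M₀ q p t : ℝ) :
    orbit M₀ (-q, p) t = (-(orbit M₀ (q, p) (-t)).1, (orbit M₀ (q, p) (-t)).2) := by
  have h : ∀ t, HasDerivAt (fun t => (-(orbit M₀ (q, p) (-t)).1, (orbit M₀ (q, p) (-t)).2))
      (hamiltonField M₀ (-(orbit M₀ (q, p) (-t)).1, (orbit M₀ (q, p) (-t)).2)) t := fun t => by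
    have h1 := ((hasDerivAt_orbit_fst M₀ (q, p) (-t)).scomp t (hasDerivAt_neg t)).neg
    have h2 := ((hasDerivAt_orbit_snd M₀ (q, p) (-t)).scomp t (hasDerivAt_neg t))
    exact (h1.prodMk h2).congr_deriv (by simp [hamiltonField])
  have := eq_orbit h t
  simpa [orbit_zero] using this.symm

theorem energy_orbit (M₀ : ℝ) (z : ℝ × ℝ) (t : ℝ) : energy M₀ (orbit M₀ z t) = energy M₀ z := by
  have h : ∀ t, HasDerivAt (fun t => energy M₀ (orbit M₀ z t)) 0 t := fun t => by
    have h1 := hasDerivAt_orbit_fst M₀ z t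
    have h2 := hasDerivAt_orbit_snd M₀ z t
    exact (((h2.pow 2).div_const 2).sub (h1.cos.const_mul M₀)).congr_deriv (by simp; ring)
  have := is_const_of_deriv_eq_zero (fun t => (h t).differentiableAt) (fun t => (h t).deriv) t 0
  simpa [orbit_zero] using this

theorem continuous_energy (M₀ : ℝ) : Continuous (energy M₀) := by
  unfold energy; fun_prop

/-- Energy conservation lets p² change by at most 4M₀ along an orbit. It keeps momentum supports
bounded under the flow and bounds the momentum inside Laplace integrals. -/
theorem abs_snd_orbit_le {M₀ : ℝ} (hM₀ : 0 < M₀) (z : ℝ × ℝ) (t : ℝ) :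
    |z.2| ≤ |(orbit M₀ z t).2| + 2 * Real.sqrt M₀ := by
  have h := energy_orbit M₀ z t
  unfold energy at h
  have h1 : z.2 ^ 2 ≤ (orbit M₀ z t).2 ^ 2 + 4 * M₀ := by
    nlinarith [Real.cos_le_one z.1, Real.neg_one_le_cos (orbit M₀ z t).1,
      mul_le_mul_of_nonneg_left (Real.cos_le_one z.1) hM₀.le,
      mul_le_mul_of_nonneg_left (Real.neg_one_le_cos (orbit M₀ z t).1) hM₀.le]
  refine abs_le.2 (abs_le_of_sq_le_sq' ?_ (by positivity))
  have h2 := Real.sq_sqrt hM₀.le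
  nlinarith [sq_abs (orbit M₀ z t).2, mul_nonneg (abs_nonneg (orbit M₀ z t).2) (Real.sqrt_nonneg M₀)]

theorem dist_orbit_le_of_nonneg (M₀ : ℝ) (z z' : ℝ × ℝ) {t : ℝ} (ht : 0 ≤ t) :
    dist (orbit M₀ z t) (orbit M₀ z' t) ≤ dist z z' * Real.exp ((1 + |M₀|) * t) := by
  have := dist_le_of_trajectories_ODE (v := fun _ => hamiltonField M₀)
    (K := Real.toNNReal (1 + |M₀|)) (f := orbit M₀ z) (g := orbit M₀ z') (a := 0) (b := t)
    (δ := dist z z') (fun _ => (hamiltonField_lipschitz M₀))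
    (fun t _ => (hasDerivAt_orbit M₀ z t).continuousAt.continuousWithinAt)
    (fun t _ => (hasDerivAt_orbit M₀ z t).hasDerivWithinAt)
    (fun t _ => (hasDerivAt_orbit M₀ z' t).continuousAt.continuousWithinAt)
    (fun t _ => (hasDerivAt_orbit M₀ z' t).hasDerivWithinAt)
    (by simp [orbit_zero]) t ⟨ht, le_rfl⟩
  rwa [Real.coe_toNNReal _ (by positivity), sub_zero] at this

theorem dist_orbit_le (M₀ : ℝ) (z z' : ℝ × ℝ) (t : ℝ) :
    dist (orbit M₀ z t) (orbit M₀ z' t) ≤ dist z z' * Real.exp ((1 + |M₀|) * |t|) := by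
  rcases le_total 0 t with ht | ht
  · rw [abs_of_nonneg ht]; exact dist_orbit_le_of_nonneg M₀ z z' ht
  · rw [abs_of_nonpos ht]
    -- Backward time is forward time after the reflection q ↦ -q, which preserves distances.
    have h := dist_orbit_le_of_nonneg M₀ (-z.1, z.2) (-z'.1, z'.2) (neg_nonneg.2 ht)
    rw [orbit_reverse, orbit_reverse, neg_neg] at h
    simpa [Prod.dist_eq, dist_neg_neg] using h

theorem continuous_orbit (M₀ : ℝ) : Continuous fun x : ℝ × (ℝ × ℝ) => orbit M₀ x.2 x.1 := by
  rw [continuous_iff_continuousAt]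
  rintro ⟨t, z⟩
  have h1 : Tendsto (fun x : ℝ × (ℝ × ℝ) => orbit M₀ z x.1) (𝓝 (t, z)) (𝓝 (orbit M₀ z t)) :=
    ((hasDerivAt_orbit M₀ z t).continuousAt.tendsto).comp continuous_fst.continuousAt
  refine tendsto_iff_dist_tendsto_zero.2 ?_
  have h2 : Tendsto (fun x : ℝ × (ℝ × ℝ) => dist x.2 z * Real.exp ((1 + |M₀|) * |x.1|)
      + dist (orbit M₀ z x.1) (orbit M₀ z t)) (𝓝 (t, z)) (𝓝 (0 + 0)) := by
    refine Tendsto.add ?_ (tendsto_iff_dist_tendsto_zero.1 h1)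
    have : Continuous fun x : ℝ × (ℝ × ℝ) => dist x.2 z * Real.exp ((1 + |M₀|) * |x.1|) := by
      fun_prop
    simpa using this.tendsto (t, z)
  rw [add_zero] at h2
  refine squeeze_zero (fun _ => dist_nonneg) (fun x => ?_) h2
  exact (dist_triangle _ (orbit M₀ z x.1) _).trans
    (add_le_add_left (dist_orbit_le M₀ x.2 z x.1) _)

theorem continuous_orbit_comp {X : Type*} [TopologicalSpace X] {M₀ : ℝ} {f : X → ℝ × ℝ} {g : X → ℝ}
    (hf : Continuous f) (hg : Continuous g) : Continuous fun x => orbit M₀ (f x) (g x) :=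
  (continuous_orbit M₀).comp (hg.prodMk hf)

theorem measurable_orbit_comp {X : Type*} [MeasurableSpace X] {M₀ : ℝ} {f : X → ℝ × ℝ} {g : X → ℝ}
    (hf : Measurable f) (hg : Measurable g) : Measurable fun x => orbit M₀ (f x) (g x) :=
  (continuous_orbit M₀).measurable.comp (hg.prodMk hf)

end

section

/-! ### The flow is continuously differentiable in the initial point -/

/-- Linear growth suffices for global existence: on the ball of radius ‖x‖ about x the field is at
most 2C‖x‖, so a solution stays there for the time 1/(2C), whatever x is, and local solutions of
uniform length glue together. The tangent field below is not globally Lipschitz, because of the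
product cos(q) ξ, but it has linear growth. -/
theorem exists_integralCurve_of_norm_le {E : Type*} [NormedAddCommGroup E] [NormedSpace ℝ E]
    [ProperSpace E] {v : E → E} (hv : ContDiff ℝ 1 v) {C : ℝ} (hC : 0 < C)
    (hb : ∀ x, ‖v x‖ ≤ C * ‖x‖) (x₀ : E) :
    ∃ γ : ℝ → E, γ 0 = x₀ ∧ ∀ t, HasDerivAt γ (v (γ t)) t := by
  have hloc : ∀ x : E, ∃ γ : ℝ → E, γ 0 = x ∧
      IsMIntegralCurveOn (I := modelWithCornersSelf ℝ E) γ v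
        (Ioo (-(1 / (2 * C))) (1 / (2 * C))) := by
    intro x
    set ε : ℝ := 1 / (2 * C) with hε
    have hεpos : 0 < ε := by positivity
    obtain ⟨K, hK⟩ := LocallyLipschitzOn.exists_lipschitzOnWith_of_compact
      (isCompact_closedBall x ‖x‖) (hv.locallyLipschitz.locallyLipschitzOn (s := Metric.closedBall x ‖x‖))
    have hpl : IsPicardLindelof (fun _ => v) (tmin := -ε) (tmax := ε)
        ⟨0, by constructor <;> linarith⟩ x ‖x‖₊ 0
        (Real.toNNReal C * (2 * ‖x‖₊)) K := by
      refine ⟨fun _ _ => hK, fun _ _ => continuousOn_const, fun _ _ y hy => ?_, ?_⟩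
      · refine (hb y).trans ?_
        have hy' : ‖y‖ ≤ 2 * ‖x‖ := by
          have h1 := norm_sub_norm_le y x
          have h2 := mem_closedBall_iff_norm.1 hy
          simp only [coe_nnnorm] at h2
          linarith
        push_cast
        rw [Real.coe_toNNReal _ hC.le]
        gcongr
      · push_cast
        rw [Real.coe_toNNReal _ hC.le]
        simp only [sub_zero, zero_sub, neg_neg, max_self]
        rw [hε]
        apply le_of_eq
        field_simp
    obtain ⟨α, h0, hα⟩ := hpl.exists_eq_forall_mem_Icc_hasDerivWithinAt₀
    refine ⟨α, h0, fun t ht => ?_⟩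
    have h := hα t (Ioo_subset_Icc_self ht)
    exact (h.mono Ioo_subset_Icc_self).hasFDerivWithinAt.hasMFDerivWithinAt
  obtain ⟨γ, h0, hγ⟩ := exists_isMIntegralCurve_of_isMIntegralCurveOn
    (I := modelWithCornersSelf ℝ E) (v := v)
    (contMDiff_vectorSpace_iff_contDiff.2 hv) (by positivity) hloc x₀
  refine ⟨γ, h0, fun t => ?_⟩
  have h : HasFDerivAt γ (ContinuousLinearMap.toSpanSingleton ℝ (v (γ t))) t :=
    (hγ t).hasFDerivAt
  exact hasDerivAt_iff_hasFDerivAt.2 h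

/-- The Hamiltonian vector field together with its linearization. -/
def tangentField (M₀ : ℝ) (x : (ℝ × ℝ) × (ℝ × ℝ)) : (ℝ × ℝ) × (ℝ × ℝ) :=
  (hamiltonField M₀ x.1, (x.2.2, -(M₀ * (Real.cos x.1.1 * x.2.1))))

theorem norm_linearization_le (M₀ a : ℝ) (ζ : ℝ × ℝ) :
    ‖(ζ.2, -(M₀ * (Real.cos a * ζ.1)))‖ ≤ (1 + |M₀|) * ‖ζ‖ := by
  have h1 : |ζ.1| ≤ ‖ζ‖ := norm_fst_le ζ
  have h2 : |ζ.2| ≤ ‖ζ‖ := norm_snd_le ζ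
  have h3 := abs_nonneg M₀
  have h4 := norm_nonneg ζ
  rw [Prod.norm_def]
  refine max_le ?_ ?_
  · simp only [Real.norm_eq_abs]; nlinarith
  · simp only [Real.norm_eq_abs, abs_neg, abs_mul]
    have h5 : |Real.cos a| * |ζ.1| ≤ 1 * ‖ζ‖ := by
      gcongr; exact Real.abs_cos_le_one a
    nlinarith [mul_le_mul_of_nonneg_left h5 h3]

theorem exists_tangentOrbit (M₀ : ℝ) (x : (ℝ × ℝ) × (ℝ × ℝ)) :
    ∃ γ : ℝ → (ℝ × ℝ) × (ℝ × ℝ), γ 0 = x ∧ ∀ t, HasDerivAt γ (tangentField M₀ (γ t)) t := by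
  refine exists_integralCurve_of_norm_le (C := 1 + |M₀|) ?_ (by positivity) (fun y => ?_) x
  · unfold tangentField hamiltonField; fun_prop
  · rw [Prod.norm_def (x := tangentField M₀ y)]
    have h0 : ‖hamiltonField M₀ y.1‖ ≤ (1 + |M₀|) * ‖y.1‖ := by
      have h := (hamiltonField_lipschitz M₀).dist_le_mul y.1 0
      have h0 : hamiltonField M₀ 0 = 0 := by simp [hamiltonField]
      rwa [h0, dist_zero_right, dist_zero_right, Real.coe_toNNReal _ (by positivity)] at h
    have hp : 0 ≤ 1 + |M₀| := by positivity
    refine max_le (h0.trans ?_) ((norm_linearization_le M₀ _ _).trans ?_)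
    · exact mul_le_mul_of_nonneg_left (norm_fst_le y) hp
    · exact mul_le_mul_of_nonneg_left (norm_snd_le y) hp

/-- The solution of the linearized equation along the orbit of `z`, starting at `ζ`. -/
def variation (M₀ : ℝ) (z ζ : ℝ × ℝ) (t : ℝ) : ℝ × ℝ :=
  (Classical.choose (exists_tangentOrbit M₀ (z, ζ)) t).2

theorem variation_zero (M₀ : ℝ) (z ζ : ℝ × ℝ) : variation M₀ z ζ 0 = ζ := by
  rw [variation, (Classical.choose_spec (exists_tangentOrbit M₀ (z, ζ))).1]

theorem hasDerivAt_variation (M₀ : ℝ) (z ζ : ℝ × ℝ) (t : ℝ) :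
    HasDerivAt (variation M₀ z ζ) ((variation M₀ z ζ t).2,
      -(M₀ * (Real.cos (orbit M₀ z t).1 * (variation M₀ z ζ t).1))) t := by
  obtain ⟨h0, h⟩ := Classical.choose_spec (exists_tangentOrbit M₀ (z, ζ))
  set γ := Classical.choose (exists_tangentOrbit M₀ (z, ζ)) with hγ
  have h1 : ∀ t, (γ t).1 = orbit M₀ z t := by
    intro t
    have := eq_orbit (M₀ := M₀) (γ := fun t => (γ t).1)
      (fun t => (hasFDerivAt_fst (𝕜 := ℝ) (p := γ t)).comp_hasDerivAt t (h t)) t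
    simpa [h0] using this
  have h2 := (hasFDerivAt_snd (𝕜 := ℝ) (p := γ t)).comp_hasDerivAt t (h t)
  refine h2.congr_deriv ?_
  simp only [tangentField, ContinuousLinearMap.coe_snd', h1]
  rfl

/-- Gronwall gives (ε/K)(e^{Kt} - 1); the assumption K ≥ 1 removes the denominator. -/
theorem gronwall_zero {E : Type*} [NormedAddCommGroup E] [NormedSpace ℝ E] {f f' : ℝ → E}
    {K ε t : ℝ} (hK : 1 ≤ K) (hε : 0 ≤ ε) (ht : 0 ≤ t) (hf : ∀ x, HasDerivAt f (f' x) x)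
    (h0 : f 0 = 0) (hb : ∀ x ∈ Ico 0 t, ‖f' x‖ ≤ K * ‖f x‖ + ε) :
    ‖f t‖ ≤ ε * Real.exp (K * t) := by
  have := norm_le_gronwallBound_of_norm_deriv_right_le (δ := 0) (a := 0) (b := t)
    (fun x _ => (hf x).continuousAt.continuousWithinAt) (fun x _ => (hf x).hasDerivWithinAt)
    (by simp [h0]) hb t ⟨ht, le_rfl⟩
  rw [gronwallBound_of_K_ne_0 (by positivity), sub_zero] at this
  refine this.trans ?_
  have h1 : ε / K ≤ ε := div_le_self hε hK
  have h2 : 0 ≤ Real.exp (K * t) - 1 := by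
    have := Real.add_one_le_exp (K * t)
    have : 0 ≤ K * t := by positivity
    linarith
  have h3 : 0 ≤ ε / K := by positivity
  nlinarith [Real.exp_pos (K * t)]

theorem norm_variation_le (M₀ : ℝ) (z ζ : ℝ × ℝ) {t : ℝ} (ht : 0 ≤ t) :
    ‖variation M₀ z ζ t‖ ≤ ‖ζ‖ * Real.exp ((1 + |M₀|) * t) := by
  have := norm_le_gronwallBound_of_norm_deriv_right_le (δ := ‖ζ‖) (ε := 0)
    (K := 1 + |M₀|) (a := 0) (b := t)
    (fun x _ => (hasDerivAt_variation M₀ z ζ x).continuousAt.continuousWithinAt)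
    (fun x _ => (hasDerivAt_variation M₀ z ζ x).hasDerivWithinAt)
    (by simp [variation_zero])
    (fun x _ => (norm_linearization_le M₀ _ _).trans (by simp)) t ⟨ht, le_rfl⟩
  rwa [gronwallBound_ε0, sub_zero] at this

/-- The difference of two linearized solutions solves the linearized equation along the first orbit
with the extra force (cos a - cos b) ξ', which is of the size of the distance of the orbits. This
yields continuity of the derivative of the flow. -/
theorem norm_variation_sub_le (M₀ : ℝ) (z z' ζ : ℝ × ℝ) {t : ℝ} (ht : 0 ≤ t) :
    ‖variation M₀ z ζ t - variation M₀ z' ζ t‖ ≤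
      |M₀| * ((dist z z' * Real.exp ((1 + |M₀|) * t)) * (‖ζ‖ * Real.exp ((1 + |M₀|) * t))) *
        Real.exp ((1 + |M₀|) * t) := by
  have hp : 0 ≤ |M₀| := abs_nonneg _
  refine gronwall_zero (f := fun t => variation M₀ z ζ t - variation M₀ z' ζ t)
    (by linarith) (by positivity) ht
    (fun x => (hasDerivAt_variation M₀ z ζ x).sub (hasDerivAt_variation M₀ z' ζ x))
    (by simp [variation_zero]) (fun x hx => ?_)
  set a := (orbit M₀ z x).1
  set b := (orbit M₀ z' x).1
  set ξ := variation M₀ z ζ x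
  set ξ' := variation M₀ z' ζ x with hξ'
  have hab : |a - b| ≤ dist z z' * Real.exp ((1 + |M₀|) * t) := by
    refine (norm_fst_le (orbit M₀ z x - orbit M₀ z' x)).trans ?_
    rw [← dist_eq_norm]
    refine (dist_orbit_le_of_nonneg M₀ z z' hx.1).trans ?_
    have := hx.2.le
    gcongr
  have hξ : |ξ'.1| ≤ ‖ζ‖ * Real.exp ((1 + |M₀|) * t) := by
    refine (norm_fst_le ξ').trans ((norm_variation_le M₀ z' ζ hx.1).trans ?_)
    have := hx.2.le
    gcongr
  have hcos : |Real.cos a - Real.cos b| ≤ |a - b| := by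
    simpa [Real.dist_eq] using Real.lipschitzWith_cos.dist_le_mul a b
  have heq : ((ξ.2, -(M₀ * (Real.cos a * ξ.1))) : ℝ × ℝ) - (ξ'.2, -(M₀ * (Real.cos b * ξ'.1)))
      = ((ξ - ξ').2, -(M₀ * (Real.cos a * (ξ - ξ').1)))
        + (0, -(M₀ * ((Real.cos a - Real.cos b) * ξ'.1))) := by
    ext <;> simp; ring
  rw [heq]
  refine (norm_add_le _ _).trans (add_le_add (norm_linearization_le M₀ _ _) ?_)
  rw [Prod.norm_def]
  simp only [norm_zero, norm_neg, norm_mul, Real.norm_eq_abs]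
  refine max_le (by positivity) ?_
  have := hcos.trans hab
  gcongr

theorem abs_sin_sub_sub_le (a b : ℝ) :
    |Real.sin b - Real.sin a - Real.cos a * (b - a)| ≤ (b - a) ^ 2 := by
  have h := (convex_uIcc a b).norm_image_sub_le_of_norm_hasDerivWithin_le
    (f := fun x => Real.sin x - Real.cos a * x) (f' := fun x => Real.cos x - Real.cos a)
    (C := |b - a|)
    (fun x _ => by
      have := (Real.hasDerivAt_sin x).sub ((hasDerivAt_id x).const_mul (Real.cos a))
      exact (this.congr_deriv (by simp)).hasDerivWithinAt)
    (fun x hx => by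
      have h1 : |Real.cos x - Real.cos a| ≤ |x - a| := by
        simpa [Real.dist_eq] using Real.lipschitzWith_cos.dist_le_mul x a
      exact h1.trans (abs_sub_left_of_mem_uIcc hx)) left_mem_uIcc right_mem_uIcc
  rw [Real.norm_eq_abs, Real.norm_eq_abs, ← sq, sq_abs] at h
  convert h using 2
  ring

/-- The remainder obeys the linearized equation, forced by the Taylor remainder of sin at first
order. That force is quadratic in the distance of the orbits, hence in h, and Gronwall preserves
this. -/
theorem norm_orbit_sub_variation_le (M₀ : ℝ) (z h : ℝ × ℝ) {t : ℝ} (ht : 0 ≤ t) :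
    ‖orbit M₀ (z + h) t - orbit M₀ z t
        - (h.1 • variation M₀ z (1, 0) t + h.2 • variation M₀ z (0, 1) t)‖ ≤
      |M₀| * (‖h‖ * Real.exp ((1 + |M₀|) * t)) ^ 2 * Real.exp ((1 + |M₀|) * t) := by
  have hp : 0 ≤ |M₀| := abs_nonneg _
  refine gronwall_zero (f := fun t => orbit M₀ (z + h) t - orbit M₀ z t
        - (h.1 • variation M₀ z (1, 0) t + h.2 • variation M₀ z (0, 1) t))
    (by linarith) (by positivity) ht
    (fun x => ((hasDerivAt_orbit M₀ (z + h) x).sub (hasDerivAt_orbit M₀ z x)).sub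
      (((hasDerivAt_variation M₀ z (1, 0) x).const_smul h.1).add
        ((hasDerivAt_variation M₀ z (0, 1) x).const_smul h.2)))
    (by simp [variation_zero, orbit_zero]) (fun x hx => ?_)
  set u := orbit M₀ (z + h) x
  set v := orbit M₀ z x
  set ξ := variation M₀ z (1, 0) x
  set η := variation M₀ z (0, 1) x
  have huv : |u.1 - v.1| ≤ ‖h‖ * Real.exp ((1 + |M₀|) * t) := by
    refine (norm_fst_le (u - v)).trans ?_
    rw [← dist_eq_norm]
    refine (dist_orbit_le_of_nonneg M₀ _ _ hx.1).trans ?_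
    have := hx.2.le
    rw [dist_eq_norm, add_sub_cancel_left]
    gcongr
  set w := u - v - (h.1 • ξ + h.2 • η) with hw
  have heq : hamiltonField M₀ u - hamiltonField M₀ v -
      (h.1 • ((ξ.2, -(M₀ * (Real.cos v.1 * ξ.1))) : ℝ × ℝ)
        + h.2 • ((η.2, -(M₀ * (Real.cos v.1 * η.1))) : ℝ × ℝ))
      = (w.2, -(M₀ * (Real.cos v.1 * w.1)))
        + (0, -(M₀ * (Real.sin u.1 - Real.sin v.1 - Real.cos v.1 * (u.1 - v.1)))) := by
    ext <;> simp [hamiltonField, hw]; ring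
  rw [heq]
  refine (norm_add_le _ _).trans (add_le_add (norm_linearization_le M₀ _ _) ?_)
  rw [Prod.norm_def]
  simp only [norm_zero, norm_neg, norm_mul, Real.norm_eq_abs]
  refine max_le (by positivity) ?_
  have h1 := abs_sin_sub_sub_le v.1 u.1
  have h2 : (u.1 - v.1) ^ 2 ≤ (‖h‖ * Real.exp ((1 + |M₀|) * t)) ^ 2 := by
    rw [← sq_abs]; gcongr
  exact mul_le_mul_of_nonneg_left (h1.trans h2) hp

/-- Needed so that a C¹ test function composed with the flow is again a test function. Forward times
suffice, which is where the Gronwall bounds apply. -/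
theorem contDiff_orbit (M₀ : ℝ) {t : ℝ} (ht : 0 ≤ t) : ContDiff ℝ 1 fun z => orbit M₀ z t := by
  have hcont : ∀ ζ : ℝ × ℝ, Continuous fun z => variation M₀ z ζ t := by
    intro ζ
    rw [continuous_iff_continuousAt]
    intro z
    refine tendsto_iff_norm_sub_tendsto_zero.2 ?_
    refine squeeze_zero (fun _ => norm_nonneg _)
      (fun z' => norm_variation_sub_le M₀ z' z ζ ht) ?_
    have : Continuous fun z' => |M₀| * ((dist z' z * Real.exp ((1 + |M₀|) * t)) *
        (‖ζ‖ * Real.exp ((1 + |M₀|) * t))) * Real.exp ((1 + |M₀|) * t) := by fun_prop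
    simpa using this.tendsto z
  refine contDiff_one_iff_hasFDerivAt.2 ⟨fun z =>
    (ContinuousLinearMap.fst ℝ ℝ ℝ).smulRight (variation M₀ z (1, 0) t)
      + (ContinuousLinearMap.snd ℝ ℝ ℝ).smulRight (variation M₀ z (0, 1) t), ?_, fun z => ?_⟩
  · have h1 := ((ContinuousLinearMap.smulRightL ℝ (ℝ × ℝ) (ℝ × ℝ)
      (ContinuousLinearMap.fst ℝ ℝ ℝ)).continuous).comp (hcont (1, 0))
    have h2 := ((ContinuousLinearMap.smulRightL ℝ (ℝ × ℝ) (ℝ × ℝ)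
      (ContinuousLinearMap.snd ℝ ℝ ℝ)).continuous).comp (hcont (0, 1))
    exact h1.add h2
  · rw [hasFDerivAt_iff_isLittleO_nhds_zero]
    refine Asymptotics.IsBigO.trans_isLittleO (g := fun h : ℝ × ℝ => ‖h‖ ^ 2) ?_ ?_
    · refine Asymptotics.IsBigO.of_bound
        (|M₀| * Real.exp ((1 + |M₀|) * t) ^ 2 * Real.exp ((1 + |M₀|) * t))
        (Eventually.of_forall fun h => ?_)
      refine le_trans (le_of_eq ?_) ((norm_orbit_sub_variation_le M₀ z h ht).trans (le_of_eq ?_))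
      · simp
      · simp only [norm_pow, norm_norm]; ring
    · exact Asymptotics.isLittleO_norm_pow_id one_lt_two

end

section

/-! ### Explicit parametrization of the orbits -/

/-- The orbit of energy `E`, parametrized by the position (rotation) or by the phase `φ` with
`sin (q / 2) = k sin φ` (libration). -/
def orbitCurve (M₀ : ℝ) : Region → ℝ → ℝ → ℝ × ℝ
  | .rotPos, E, φ => (φ, Real.sqrt (2 * (E + M₀ * Real.cos φ)))
  | .trapped, E, φ =>
      (2 * Real.arcsin (Real.sqrt ((E + M₀) / (2 * M₀)) * Real.sin φ),
        2 * Real.sqrt M₀ * (Real.sqrt ((E + M₀) / (2 * M₀)) * Real.cos φ))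
  | .rotNeg, E, φ => (-φ, -Real.sqrt (2 * (E + M₀ * Real.cos φ)))

/-- The rate `dφ / dt` of the parameter of `orbitCurve` along the orbit. -/
def phaseSpeed (M₀ : ℝ) : Region → ℝ → ℝ → ℝ
  | .rotPos, E, φ => Real.sqrt (2 * (E + M₀ * Real.cos φ))
  | .trapped, E, φ => Real.sqrt M₀ * Real.sqrt (1 - (E + M₀) / (2 * M₀) * Real.sin φ ^ 2)
  | .rotNeg, E, φ => Real.sqrt (2 * (E + M₀ * Real.cos φ))

/-- The number of turns around the cylinder in one period. -/
def winding : Region → ℤ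
  | .rotPos => 1
  | .trapped => 0
  | .rotNeg => -1

theorem isOpen_energyRange (M₀ : ℝ) (i : Region) : IsOpen (energyRange M₀ i) := by
  cases i
  exacts [isOpen_Ioi, isOpen_Ioo, isOpen_Ioi]

theorem measurableSet_energyRange (M₀ : ℝ) (i : Region) : MeasurableSet (energyRange M₀ i) :=
  (isOpen_energyRange M₀ i).measurableSet

theorem neg_lt_of_mem_energyRange {M₀ : ℝ} (hM₀ : 0 < M₀) {i : Region} {E : ℝ}
    (hE : E ∈ energyRange M₀ i) : -M₀ < E := by
  cases i
  · have : M₀ < E := hE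
    linarith
  · exact hE.1
  · have : M₀ < E := hE
    linarith

theorem continuous_phaseSpeed (M₀ : ℝ) (i : Region) :
    Continuous fun x : ℝ × ℝ => phaseSpeed M₀ i x.1 x.2 := by
  cases i <;> simp only [phaseSpeed] <;> fun_prop

theorem continuous_orbitCurve (M₀ : ℝ) (i : Region) :
    Continuous fun x : ℝ × ℝ => orbitCurve M₀ i x.1 x.2 := by
  cases i <;> simp only [orbitCurve] <;> fun_prop

theorem continuous_basePoint (M₀ : ℝ) (i : Region) : Continuous (basePoint M₀ i) := by
  cases i <;> unfold basePoint <;> fun_prop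

/-- Uniformity in φ makes the reparametrized equation Lipschitz; uniformity for nearby energies
dominates the integrand of the period. -/
theorem exists_le_phaseSpeed {M₀ : ℝ} (hM₀ : 0 < M₀) {i : Region} {E : ℝ}
    (hE : E ∈ energyRange M₀ i) : ∃ c > 0, ∀ᶠ E' in 𝓝 E, ∀ φ, c ≤ phaseSpeed M₀ i E' φ := by
  have hrot : M₀ < E → ∃ c > 0, ∀ᶠ E' in 𝓝 E, ∀ φ,
      c ≤ Real.sqrt (2 * (E' + M₀ * Real.cos φ)) := by
    intro h
    -- For E' beyond the midpoint of M₀ and E one has 2(E' - M₀) > E - M₀, and cos φ ≥ -1.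
    refine ⟨Real.sqrt (E - M₀), Real.sqrt_pos.2 (by linarith), ?_⟩
    filter_upwards [lt_mem_nhds (show (E + M₀) / 2 < E by linarith)] with E' hE' φ
    refine Real.sqrt_le_sqrt ?_
    nlinarith [Real.neg_one_le_cos φ]
  cases i with
  | rotPos => exact hrot hE
  | rotNeg => exact hrot hE
  | trapped =>
    obtain ⟨h1, h2⟩ := hE
    obtain ⟨E₁, h3, h4⟩ := exists_between h2
    have h5 : (E₁ + M₀) / (2 * M₀) < 1 := by rw [div_lt_one (by positivity)]; linarith
    refine ⟨Real.sqrt M₀ * Real.sqrt (1 - (E₁ + M₀) / (2 * M₀)),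
      mul_pos (Real.sqrt_pos.2 hM₀) (Real.sqrt_pos.2 (by linarith)), ?_⟩
    filter_upwards [gt_mem_nhds h3, lt_mem_nhds h1] with E' hE' hE'' φ
    refine mul_le_mul_of_nonneg_left (Real.sqrt_le_sqrt ?_) (Real.sqrt_nonneg _)
    have h6 : (E' + M₀) / (2 * M₀) ≤ (E₁ + M₀) / (2 * M₀) := by gcongr
    have h7 : 0 ≤ (E' + M₀) / (2 * M₀) := div_nonneg (by linarith) (by linarith)
    nlinarith [Real.sin_sq_le_one φ, sq_nonneg (Real.sin φ)]

theorem phaseSpeed_pos {M₀ : ℝ} (hM₀ : 0 < M₀) {i : Region} {E : ℝ}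
    (hE : E ∈ energyRange M₀ i) (φ : ℝ) : 0 < phaseSpeed M₀ i E φ := by
  obtain ⟨c, hc, h⟩ := exists_le_phaseSpeed hM₀ hE
  exact hc.trans_le (h.self_of_nhds φ)

theorem phaseSpeed_neg (M₀ : ℝ) (i : Region) (E φ : ℝ) :
    phaseSpeed M₀ i E (-φ) = phaseSpeed M₀ i E φ := by
  cases i <;> simp [phaseSpeed]

theorem continuous_phaseSpeed_inv {M₀ : ℝ} (hM₀ : 0 < M₀) {i : Region} {E : ℝ}
    (hE : E ∈ energyRange M₀ i) : Continuous fun φ => (phaseSpeed M₀ i E φ)⁻¹ :=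
  ((continuous_phaseSpeed M₀ i).comp (Continuous.prodMk_right E)).inv₀
    fun φ => (phaseSpeed_pos hM₀ hE φ).ne'

theorem orbitCurve_zero {M₀ : ℝ} (hM₀ : 0 < M₀) {i : Region} {E : ℝ}
    (hE : E ∈ energyRange M₀ i) : orbitCurve M₀ i E 0 = basePoint M₀ i E := by
  have h0 := neg_lt_of_mem_energyRange hM₀ hE
  cases i
  · simp [orbitCurve, basePoint]
  · simp only [orbitCurve, basePoint, Real.sin_zero, mul_zero, Real.arcsin_zero, Real.cos_zero,
      mul_one, Prod.mk.injEq, true_and]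
    have h1 := Real.mul_self_sqrt hM₀.le
    have h2 := Real.mul_self_sqrt (show 0 ≤ (E + M₀) / (2 * M₀) from
      div_nonneg (by linarith) (by linarith))
    have h3 : (2 * Real.sqrt M₀ * Real.sqrt ((E + M₀) / (2 * M₀))) *
        (2 * Real.sqrt M₀ * Real.sqrt ((E + M₀) / (2 * M₀))) = 2 * (E + M₀) := by
      calc _ = 4 * (Real.sqrt M₀ * Real.sqrt M₀) *
          (Real.sqrt ((E + M₀) / (2 * M₀)) * Real.sqrt ((E + M₀) / (2 * M₀))) := by ring
        _ = _ := by rw [h1, h2]; field_simp; ring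
    rw [← h3, Real.sqrt_mul_self (by positivity)]
  · simp [orbitCurve, basePoint]

theorem orbitCurve_two_pi (M₀ : ℝ) (i : Region) (E : ℝ) :
    orbitCurve M₀ i E (2 * Real.pi)
      = orbitCurve M₀ i E 0 + (winding i * (2 * Real.pi), 0) := by
  cases i <;> simp [orbitCurve, winding]

/-- In the phase φ the librating orbit passes its turning points smoothly: dφ/dt stays away from 0
there, although p vanishes. The computation is the double-angle formula for sin(2 arcsin(k sin φ)).
-/
theorem hasDerivAt_orbitCurve {M₀ : ℝ} (hM₀ : 0 < M₀) {i : Region} {E : ℝ}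
    (hE : E ∈ energyRange M₀ i) (φ : ℝ) :
    HasDerivAt (orbitCurve M₀ i E)
      ((phaseSpeed M₀ i E φ)⁻¹ • hamiltonField M₀ (orbitCurve M₀ i E φ)) φ := by
  have hpos := phaseSpeed_pos hM₀ hE φ
  have hrot : 0 < Real.sqrt (2 * (E + M₀ * Real.cos φ)) →
      HasDerivAt (fun φ => Real.sqrt (2 * (E + M₀ * Real.cos φ)))
        (-(M₀ * Real.sin φ) / Real.sqrt (2 * (E + M₀ * Real.cos φ))) φ := by
    intro h
    have h1 : HasDerivAt (fun φ => 2 * (E + M₀ * Real.cos φ)) (2 * (M₀ * -Real.sin φ)) φ :=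
      (((Real.hasDerivAt_cos φ).const_mul M₀).const_add E).const_mul 2
    refine (h1.sqrt (Real.sqrt_pos.1 h).ne').congr_deriv ?_
    field_simp
  cases i with
  | rotPos =>
    refine ((hasDerivAt_id φ).prodMk (hrot hpos)).congr_deriv ?_
    simp only [phaseSpeed, hamiltonField, orbitCurve] at hpos ⊢
    ext
    · exact (inv_mul_cancel₀ hpos.ne').symm
    · simp only [Prod.smul_snd, smul_eq_mul]; field_simp
  | rotNeg =>
    refine ((hasDerivAt_id φ).neg.prodMk (hrot hpos).neg).congr_deriv ?_
    simp only [phaseSpeed, hamiltonField, orbitCurve] at hpos ⊢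
    ext
    · simp only [Prod.smul_fst, smul_eq_mul]; field_simp
    · simp only [Prod.smul_snd, smul_eq_mul, Real.sin_neg]; field_simp
  | trapped =>
    have h0 := neg_lt_of_mem_energyRange hM₀ hE
    have hk : Real.sqrt ((E + M₀) / (2 * M₀)) ^ 2 = (E + M₀) / (2 * M₀) :=
      Real.sq_sqrt (div_nonneg (by linarith) (by linarith))
    simp only [phaseSpeed] at hpos ⊢
    rw [← hk] at hpos ⊢
    simp only [orbitCurve]
    set k := Real.sqrt ((E + M₀) / (2 * M₀))
    have hs := Real.sqrt_pos.2 hM₀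
    have hr : 0 < Real.sqrt (1 - k ^ 2 * Real.sin φ ^ 2) := pos_of_mul_pos_right hpos hs.le
    have hr' := Real.sqrt_pos.1 hr
    have hlt : (k * Real.sin φ) ^ 2 < 1 := by rw [mul_pow]; linarith
    have hlt' := (sq_lt_one_iff_abs_lt_one _).1 hlt
    have h1 : HasDerivAt (fun φ => 2 * Real.arcsin (k * Real.sin φ))
        (2 * (1 / Real.sqrt (1 - (k * Real.sin φ) ^ 2) * (k * Real.cos φ))) φ :=
      (HasDerivAt.comp φ (h₂ := Real.arcsin) (h := fun φ => k * Real.sin φ)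
        (Real.hasDerivAt_arcsin (abs_lt.1 hlt').1.ne' (abs_lt.1 hlt').2.ne)
        ((Real.hasDerivAt_sin φ).const_mul k)).const_mul 2
    have h2 : HasDerivAt (fun φ => 2 * Real.sqrt M₀ * (k * Real.cos φ))
        (2 * Real.sqrt M₀ * (k * -Real.sin φ)) φ :=
      ((Real.hasDerivAt_cos φ).const_mul k).const_mul _
    refine (h1.prodMk h2).congr_deriv ?_
    have h3 : Real.sin (2 * Real.arcsin (k * Real.sin φ))
        = 2 * (k * Real.sin φ) * Real.sqrt (1 - k ^ 2 * Real.sin φ ^ 2) := by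
      rw [Real.sin_two_mul, Real.sin_arcsin (abs_lt.1 hlt').1.le (abs_lt.1 hlt').2.le,
        Real.cos_arcsin, mul_pow]
    have h4 := Real.mul_self_sqrt hM₀.le
    simp only [hamiltonField, h3, mul_pow]
    ext
    · simp; field_simp
    · simp; field_simp; rw [sq, h4]; ring

/-- The time needed to reach the parameter `φ` on `orbitCurve`. -/
def phaseTime (M₀ : ℝ) (i : Region) (E φ : ℝ) : ℝ := ∫ x in (0 : ℝ)..φ, (phaseSpeed M₀ i E x)⁻¹

/-- The period of the orbits of energy `E`. -/
def period (M₀ : ℝ) (i : Region) (E : ℝ) : ℝ :=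
  ∫ x in (-Real.pi)..Real.pi, (phaseSpeed M₀ i E x)⁻¹

theorem hasDerivAt_phaseTime {M₀ : ℝ} (hM₀ : 0 < M₀) {i : Region} {E : ℝ}
    (hE : E ∈ energyRange M₀ i) (φ : ℝ) :
    HasDerivAt (phaseTime M₀ i E) (phaseSpeed M₀ i E φ)⁻¹ φ :=
  (continuous_phaseSpeed_inv hM₀ hE).integral_hasStrictDerivAt 0 φ |>.hasDerivAt

theorem strictMono_phaseTime {M₀ : ℝ} (hM₀ : 0 < M₀) {i : Region} {E : ℝ}
    (hE : E ∈ energyRange M₀ i) : StrictMono (phaseTime M₀ i E) :=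
  strictMono_of_deriv_pos fun φ => by
    rw [(hasDerivAt_phaseTime hM₀ hE φ).deriv]; exact inv_pos.2 (phaseSpeed_pos hM₀ hE φ)

theorem phaseTime_neg (M₀ : ℝ) (i : Region) (E φ : ℝ) :
    phaseTime M₀ i E (-φ) = -phaseTime M₀ i E φ := by
  have := intervalIntegral.integral_comp_neg (fun x => (phaseSpeed M₀ i E x)⁻¹) (a := 0) (b := φ)
  simp only [phaseSpeed_neg, neg_zero] at this
  rw [phaseTime, phaseTime, this, intervalIntegral.integral_symm]

theorem phaseTime_pi {M₀ : ℝ} (hM₀ : 0 < M₀) {i : Region} {E : ℝ}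
    (hE : E ∈ energyRange M₀ i) : phaseTime M₀ i E Real.pi = period M₀ i E / 2 := by
  have hint : ∀ a b, IntervalIntegrable (fun x => (phaseSpeed M₀ i E x)⁻¹) volume a b :=
    fun a b => (continuous_phaseSpeed_inv hM₀ hE).intervalIntegrable a b
  have h1 := intervalIntegral.integral_add_adjacent_intervals (hint (-Real.pi) 0) (hint 0 Real.pi)
  have h2 := phaseTime_neg M₀ i E Real.pi
  rw [phaseTime, intervalIntegral.integral_symm] at h2
  rw [period, ← h1, ← phaseTime]
  linarith

theorem phaseTime_two_pi (M₀ : ℝ) (i : Region) (E : ℝ) : phaseTime M₀ i E (2 * Real.pi) = period M₀ i E := by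
  have h : Function.Periodic (fun x => (phaseSpeed M₀ i E x)⁻¹) (2 * Real.pi) := by
    intro x
    cases i <;> simp [phaseSpeed]
  have := h.intervalIntegral_add_eq 0 (-Real.pi)
  rw [zero_add] at this
  rw [phaseTime, this, period]
  congr 1
  ring

theorem period_pos {M₀ : ℝ} (hM₀ : 0 < M₀) {i : Region} {E : ℝ}
    (hE : E ∈ energyRange M₀ i) : 0 < period M₀ i E := by
  have h := strictMono_phaseTime hM₀ hE Real.pi_pos
  rw [phaseTime_pi hM₀ hE, phaseTime, intervalIntegral.integral_same] at h
  linarith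

/-- Both sides, as functions of φ, solve dz/dφ = (field)/(phase speed) and start at the base point.
This ties the abstractly chosen orbit to explicit formulas. -/
theorem orbit_phaseTime {M₀ : ℝ} (hM₀ : 0 < M₀) {i : Region} {E : ℝ}
    (hE : E ∈ energyRange M₀ i) (φ : ℝ) :
    orbit M₀ (basePoint M₀ i E) (phaseTime M₀ i E φ) = orbitCurve M₀ i E φ := by
  obtain ⟨c, hc, hcs⟩ := exists_le_phaseSpeed hM₀ hE
  have hcs := hcs.self_of_nhds
  have := ODE_solution_unique_univ
    (v := fun φ z => (phaseSpeed M₀ i E φ)⁻¹ • hamiltonField M₀ z) (s := fun _ => univ)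
    (K := Real.toNNReal c⁻¹ * Real.toNNReal (1 + |M₀|))
    (f := fun φ => orbit M₀ (basePoint M₀ i E) (phaseTime M₀ i E φ)) (g := orbitCurve M₀ i E)
    (t₀ := 0) (fun φ => ?_) (fun φ => ⟨?_, mem_univ _⟩)
    (fun φ => ⟨hasDerivAt_orbitCurve hM₀ hE φ, mem_univ _⟩) ?_
  · exact congrFun this φ
  · refine (LipschitzWith.of_dist_le_mul fun x y => ?_).lipschitzOnWith
    rw [dist_smul₀]
    push_cast
    rw [Real.coe_toNNReal _ (inv_pos.2 hc).le, mul_assoc]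
    have h1 : ‖(phaseSpeed M₀ i E φ)⁻¹‖ ≤ c⁻¹ := by
      rw [Real.norm_eq_abs, abs_of_pos (inv_pos.2 (phaseSpeed_pos hM₀ hE φ))]
      exact inv_anti₀ hc (hcs φ)
    have h2 := (hamiltonField_lipschitz M₀).dist_le_mul x y
    gcongr
  · exact HasDerivAt.scomp φ (hasDerivAt_orbit M₀ _ _) (hasDerivAt_phaseTime hM₀ hE φ)
  · simp [phaseTime, orbit_zero, orbitCurve_zero hM₀ hE]

theorem orbit_add_period {M₀ : ℝ} (hM₀ : 0 < M₀) {i : Region} {E : ℝ}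
    (hE : E ∈ energyRange M₀ i) (t : ℝ) :
    orbit M₀ (basePoint M₀ i E) (t + period M₀ i E)
      = orbit M₀ (basePoint M₀ i E) t + (winding i * (2 * Real.pi), 0) := by
  rw [add_comm t, ← orbit_orbit, ← phaseTime_two_pi M₀ i E, orbit_phaseTime hM₀ hE,
    orbitCurve_two_pi, orbitCurve_zero hM₀ hE, orbit_add_int_mul]

theorem energy_basePoint {M₀ : ℝ} (hM₀ : 0 < M₀) {i : Region} {E : ℝ}
    (hE : E ∈ energyRange M₀ i) : energy M₀ (basePoint M₀ i E) = E := by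
  have h0 := neg_lt_of_mem_energyRange hM₀ hE
  have h1 := Real.sq_sqrt (show 0 ≤ 2 * (E + M₀) by linarith)
  cases i <;> simp only [energy, basePoint, neg_sq, h1, Real.cos_zero] <;> ring

theorem continuousAt_period {M₀ : ℝ} (hM₀ : 0 < M₀) {i : Region} {E : ℝ}
    (hE : E ∈ energyRange M₀ i) : ContinuousAt (period M₀ i) E := by
  obtain ⟨c, hc, hcs⟩ := exists_le_phaseSpeed hM₀ hE
  refine intervalIntegral.continuousAt_of_dominated_interval (bound := fun _ => c⁻¹) ?_ ?_ ?_ ?_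
  · refine Eventually.of_forall fun E' => Measurable.aestronglyMeasurable ?_
    exact ((continuous_phaseSpeed M₀ i).comp (Continuous.prodMk_right E')).measurable.inv
  · filter_upwards [hcs] with E' h
    refine Eventually.of_forall fun φ _ => ?_
    have h1 := hc.trans_le (h φ)
    rw [Real.norm_eq_abs, abs_of_pos (inv_pos.2 h1)]
    exact inv_anti₀ hc (h φ)
  · exact intervalIntegrable_const
  · refine Eventually.of_forall fun φ _ => ?_
    exact ((continuous_phaseSpeed M₀ i).comp (Continuous.prodMk_left φ)).continuousAt.inv₀
      (phaseSpeed_pos hM₀ hE φ).ne'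

theorem measurable_period (M₀ : ℝ) (i : Region) : Measurable (period M₀ i) := by
  have h : Measurable fun x : ℝ × ℝ => (phaseSpeed M₀ i x.1 x.2)⁻¹ :=
    (continuous_phaseSpeed M₀ i).measurable.inv
  have h2 := (h.stronglyMeasurable.integral_prod_right'
    (ν := volume.restrict (Ioc (-Real.pi) Real.pi))).measurable
  have h3 : period M₀ i = fun E => ∫ x in Ioc (-Real.pi) Real.pi, (phaseSpeed M₀ i E x)⁻¹ := by
    funext E
    rw [period, intervalIntegral.integral_of_le (by linarith [Real.pi_pos])]
  rw [h3]
  exact h2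

end

section

/-! ### Angle-action coordinates preserve the phase-space measure -/

instance instFintypeRegion : Fintype Region :=
  ⟨⟨Multiset.cons .rotPos (Multiset.cons .trapped {Region.rotNeg}), by simp⟩,
    fun i => by cases i <;> simp⟩

theorem sum_region {N : Type*} [AddCommMonoid N] (f : Region → N) :
    ∑ i, f i = f .rotPos + f .trapped + f .rotNeg := by
  have : ∑ i, f i = (Multiset.map f
    (Multiset.cons .rotPos (Multiset.cons .trapped {Region.rotNeg}))).sum := rfl
  rw [this]
  simp [add_assoc]

instance instSFinitePhaseMeasure : SFinite phaseMeasure := by unfold phaseMeasure; infer_instance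

theorem lintegral_phaseMeasure {G : ℝ × ℝ → ENNReal} (hG : Measurable G) :
    ∫⁻ z, G z ∂phaseMeasure = ∫⁻ q in Ioc (-Real.pi) Real.pi, ∫⁻ p, G (q, p) := by
  rw [phaseMeasure, lintegral_prod _ hG.aemeasurable]

theorem measurePreserving_neg_phaseMeasure :
    MeasurePreserving (fun z : ℝ × ℝ => -z) phaseMeasure phaseMeasure := by
  have h1 : MeasurePreserving (fun x : ℝ => -x) volume volume :=
    Measure.measurePreserving_neg volume
  have h2 := h1.restrict_preimage (measurableSet_Ioc (a := -Real.pi) (b := Real.pi))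
  have h3 : (fun x : ℝ => -x) ⁻¹' Ioc (-Real.pi) Real.pi = Ico (-Real.pi) Real.pi := by
    ext x; simp only [mem_preimage, mem_Ioc, mem_Ico]; constructor <;> rintro ⟨h, h'⟩ <;>
      constructor <;> linarith
  rw [h3, Measure.restrict_congr_set (Ico_ae_eq_Ioc (μ := volume))] at h2
  exact h2.prod h1

/-- At fixed q = φ substitute p = √(2(E + M₀ cos q)); then dp = dE/p, and p is the phase speed. The
region p < 0 follows by z ↦ -z. -/
theorem lintegral_rotPos {M₀ : ℝ} (hM₀ : 0 < M₀) {G : ℝ × ℝ → ENNReal} (hG : Measurable G) :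
    ∫⁻ z in {z | M₀ < energy M₀ z ∧ 0 < z.2}, G z ∂phaseMeasure
      = ∫⁻ E in Ioi M₀, ∫⁻ φ in Ioc (-Real.pi) Real.pi,
          G (orbitCurve M₀ .rotPos E φ) * ENNReal.ofReal (phaseSpeed M₀ .rotPos E φ)⁻¹ := by
  have hA : MeasurableSet {z : ℝ × ℝ | M₀ < energy M₀ z ∧ 0 < z.2} :=
    (measurableSet_lt measurable_const (continuous_energy M₀).measurable).inter
      (measurableSet_lt measurable_const measurable_snd)
  rw [← lintegral_indicator hA, lintegral_phaseMeasure (hG.indicator hA)]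
  have hmeas : Measurable fun x : ℝ × ℝ => G (orbitCurve M₀ .rotPos x.1 x.2)
      * ENNReal.ofReal (phaseSpeed M₀ .rotPos x.1 x.2)⁻¹ :=
    (hG.comp (continuous_orbitCurve M₀ _).measurable).mul
      (continuous_phaseSpeed M₀ _).measurable.inv.ennreal_ofReal
  rw [lintegral_lintegral_swap (f := fun E φ => G (orbitCurve M₀ .rotPos E φ)
      * ENNReal.ofReal (phaseSpeed M₀ .rotPos E φ)⁻¹) hmeas.aemeasurable]
  refine lintegral_congr fun q => ?_
  have hsec : ∀ p, ({z : ℝ × ℝ | M₀ < energy M₀ z ∧ 0 < z.2}).indicator G (q, p)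
      = ((fun E => Real.sqrt (2 * (E + M₀ * Real.cos q))) '' Ioi M₀).indicator
          (fun p => G (q, p)) p := by
    intro p
    have : p ∈ ((fun E => Real.sqrt (2 * (E + M₀ * Real.cos q))) '' Ioi M₀)
        ↔ (q, p) ∈ {z : ℝ × ℝ | M₀ < energy M₀ z ∧ 0 < z.2} := by
      simp only [mem_image, mem_Ioi, mem_ofPred_eq, energy]
      constructor
      · rintro ⟨E, hE, rfl⟩
        have h1 : 0 < 2 * (E + M₀ * Real.cos q) := by nlinarith [Real.neg_one_le_cos q]
        rw [Real.sq_sqrt h1.le]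
        exact ⟨by linarith, Real.sqrt_pos.2 h1⟩
      · rintro ⟨h1, h2⟩
        refine ⟨_, h1, ?_⟩
        rw [show 2 * (p ^ 2 / 2 - M₀ * Real.cos q + M₀ * Real.cos q) = p ^ 2 by ring,
          Real.sqrt_sq h2.le]
    by_cases h : (q, p) ∈ {z : ℝ × ℝ | M₀ < energy M₀ z ∧ 0 < z.2}
    · rw [indicator_of_mem h, indicator_of_mem (this.2 h)]
    · rw [indicator_of_notMem h, indicator_of_notMem (fun h' => h (this.1 h'))]
  have hpos : ∀ E ∈ Ioi M₀, 0 < 2 * (E + M₀ * Real.cos q) := by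
    intro E hE
    have : M₀ < E := hE
    nlinarith [Real.neg_one_le_cos q]
  have hinj : InjOn (fun E => Real.sqrt (2 * (E + M₀ * Real.cos q))) (Ioi M₀) := by
    intro E hE E' hE' h
    have := (Real.sqrt_inj (hpos E hE).le (hpos E' hE').le).1 h
    linarith
  have hder : ∀ E ∈ Ioi M₀, HasDerivWithinAt (fun E => Real.sqrt (2 * (E + M₀ * Real.cos q)))
      (Real.sqrt (2 * (E + M₀ * Real.cos q)))⁻¹ (Ioi M₀) E := by
    intro E hE
    have h1 : HasDerivAt (fun E => 2 * (E + M₀ * Real.cos q)) (2 * 1) E :=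
      ((hasDerivAt_id E).add_const _).const_mul 2
    refine ((h1.sqrt (hpos E hE).ne').congr_deriv ?_).hasDerivWithinAt
    field_simp
  have himg : MeasurableSet ((fun E => Real.sqrt (2 * (E + M₀ * Real.cos q))) '' Ioi M₀) :=
    measurableSet_Ioi.image_of_continuousOn_injOn (by fun_prop) hinj
  simp_rw [hsec]
  rw [lintegral_indicator himg, lintegral_image_eq_lintegral_abs_deriv_mul measurableSet_Ioi hder hinj]
  refine setLIntegral_congr_fun measurableSet_Ioi fun E hE => ?_
  simp only [phaseSpeed, orbitCurve]
  rw [abs_of_pos (inv_pos.2 (Real.sqrt_pos.2 (hpos E hE))), mul_comm]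

theorem lintegral_rotNeg {M₀ : ℝ} (hM₀ : 0 < M₀) {G : ℝ × ℝ → ENNReal} (hG : Measurable G) :
    ∫⁻ z in {z | M₀ < energy M₀ z ∧ z.2 < 0}, G z ∂phaseMeasure
      = ∫⁻ E in Ioi M₀, ∫⁻ φ in Ioc (-Real.pi) Real.pi,
          G (orbitCurve M₀ .rotNeg E φ) * ENNReal.ofReal (phaseSpeed M₀ .rotNeg E φ)⁻¹ := by
  have h := lintegral_rotPos hM₀ (hG.comp measurable_neg)
  have hA : MeasurableSet {z : ℝ × ℝ | M₀ < energy M₀ z ∧ z.2 < 0} :=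
    (measurableSet_lt measurable_const (continuous_energy M₀).measurable).inter
      (measurableSet_lt measurable_snd measurable_const)
  have h2 := measurePreserving_neg_phaseMeasure.setLIntegral_comp_preimage hA hG
  rw [← h2]
  have h3 : (fun z : ℝ × ℝ => -z) ⁻¹' {z : ℝ × ℝ | M₀ < energy M₀ z ∧ z.2 < 0}
      = {z : ℝ × ℝ | M₀ < energy M₀ z ∧ 0 < z.2} := by
    ext z; simp [energy]
  rw [h3]
  exact h

/-- With x = sin(q/2) and y = p/(2√M₀) the energy becomes 2M₀(x² + y²) - M₀, so the trapped region
is the unit disc. Polar coordinates with radius k give E = 2M₀k² - M₀, and the Jacobians dq =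
2dx/√(1 - x²), dp = 2√M₀ dy, dE = 4M₀k dk combine to the reciprocal phase speed. -/
theorem lintegral_trapped {M₀ : ℝ} (hM₀ : 0 < M₀) {G : ℝ × ℝ → ENNReal} (hG : Measurable G) :
    ∫⁻ z in {z | energy M₀ z < M₀}, G z ∂phaseMeasure
      = ∫⁻ E in Ioo (-M₀) M₀, ∫⁻ φ in Ioc (-Real.pi) Real.pi,
          G (orbitCurve M₀ .trapped E φ)
            * ENNReal.ofReal (phaseSpeed M₀ .trapped E φ)⁻¹ := by
  have hs := Real.sqrt_pos.2 hM₀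
  have hA : MeasurableSet {z : ℝ × ℝ | energy M₀ z < M₀} :=
    measurableSet_lt (continuous_energy M₀).measurable measurable_const
  rw [← lintegral_indicator hA, lintegral_phaseMeasure (hG.indicator hA)]
  set H := ({z : ℝ × ℝ | energy M₀ z < M₀}).indicator G with hH
  have hHm : Measurable H := hG.indicator hA
  -- `q = 2 arcsin x`
  have himg : (fun x => 2 * Real.arcsin x) '' Ioo (-1) 1 = Ioo (-Real.pi) Real.pi := by
    ext q
    constructor
    · rintro ⟨x, hx, rfl⟩
      have h1 := Real.neg_pi_div_two_lt_arcsin.2 hx.1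
      have h2 := Real.arcsin_lt_pi_div_two.2 hx.2
      constructor <;> simp only <;> linarith
    · rintro ⟨h1, h2⟩
      refine ⟨Real.sin (q / 2), ⟨?_, ?_⟩, ?_⟩
      · rw [show (-1 : ℝ) = Real.sin (-(Real.pi / 2)) by rw [Real.sin_neg, Real.sin_pi_div_two]]
        exact Real.sin_lt_sin_of_lt_of_le_pi_div_two (by linarith) (by linarith) (by linarith)
      · rw [← Real.sin_pi_div_two]
        exact Real.sin_lt_sin_of_lt_of_le_pi_div_two (by linarith) (by linarith) (by linarith)
      · simp only
        rw [Real.arcsin_sin (by linarith) (by linarith)]; ring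
  have hinj : InjOn (fun x => 2 * Real.arcsin x) (Ioo (-1) 1) := by
    intro x hx y hy h
    have h' : Real.arcsin x = Real.arcsin y := by simpa using h
    exact Real.strictMonoOn_arcsin.injOn (Ioo_subset_Icc_self hx) (Ioo_subset_Icc_self hy) h'
  have hder : ∀ x ∈ Ioo (-1 : ℝ) 1, HasDerivWithinAt (fun x => 2 * Real.arcsin x)
      (2 * (1 / Real.sqrt (1 - x ^ 2))) (Ioo (-1) 1) x := fun x hx =>
    ((Real.hasDerivAt_arcsin hx.1.ne' hx.2.ne).const_mul 2).hasDerivWithinAt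
  have hq := lintegral_image_eq_lintegral_abs_deriv_mul measurableSet_Ioo hder hinj
    fun q => ∫⁻ p, H (q, p)
  rw [himg] at hq
  rw [← Measure.restrict_congr_set (Ioo_ae_eq_Ioc (μ := volume)), hq]
  -- `p = 2 √M₀ y`
  have hscale : ∀ F : ℝ → ENNReal, ∫⁻ p, F p
      = ∫⁻ y, ENNReal.ofReal (2 * Real.sqrt M₀) * F (2 * Real.sqrt M₀ * y) := by
    intro F
    have hne : 2 * Real.sqrt M₀ ≠ 0 := by positivity
    have h1 := lintegral_image_eq_lintegral_abs_deriv_mul (f := fun y => 2 * Real.sqrt M₀ * y)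
      (f' := fun _ => 2 * Real.sqrt M₀) MeasurableSet.univ
      (fun x _ => (((hasDerivAt_id x).const_mul (2 * Real.sqrt M₀)).congr_deriv
        (mul_one _)).hasDerivWithinAt)
      (fun x _ y _ h => by simpa [hs.ne'] using h) F
    rw [image_univ, (mul_left_surjective₀ hne).range_eq, setLIntegral_univ, setLIntegral_univ,
      abs_of_pos (by positivity)] at h1
    exact h1
  -- The integrand is extended by 0 outside the strip |x| < 1 so that the polar formula on the whole
  -- plane applies. The pair is ordered (y, x), so that in polar coordinates y = k cos φ and x = k
  -- sin φ.
  set K : ℝ × ℝ → ENNReal := fun w => (Ioo (-1 : ℝ) 1).indicator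
      (fun x => ENNReal.ofReal |2 * (1 / Real.sqrt (1 - x ^ 2))| *
        (ENNReal.ofReal (2 * Real.sqrt M₀) * H (2 * Real.arcsin x, 2 * Real.sqrt M₀ * w.1))) w.2
    with hK
  have hKm : Measurable K := by
    have : K = ({w : ℝ × ℝ | w.2 ∈ Ioo (-1 : ℝ) 1}).indicator (fun w =>
        ENNReal.ofReal |2 * (1 / Real.sqrt (1 - w.2 ^ 2))| *
        (ENNReal.ofReal (2 * Real.sqrt M₀) *
          H (2 * Real.arcsin w.2, 2 * Real.sqrt M₀ * w.1))) := by
      funext w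
      simp only [hK, indicator, mem_ofPred_eq]
    rw [this]
    refine Measurable.indicator ?_ (measurable_snd measurableSet_Ioo)
    refine Measurable.mul ?_ (measurable_const.mul (hHm.comp ?_))
    · refine Measurable.ennreal_ofReal ?_
      have : Measurable fun w : ℝ × ℝ => 2 * (1 / Real.sqrt (1 - w.2 ^ 2)) :=
        measurable_const.mul (measurable_const.div (by fun_prop))
      exact this.abs
    · exact (measurable_const.mul (Real.measurable_arcsin.comp measurable_snd)).prodMk
        (measurable_const.mul measurable_fst)
  have h1 : ∫⁻ x in Ioo (-1 : ℝ) 1, ENNReal.ofReal |2 * (1 / Real.sqrt (1 - x ^ 2))| *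
      ∫⁻ p, H (2 * Real.arcsin x, p) = ∫⁻ w, K w := by
    rw [Measure.volume_eq_prod, lintegral_prod_symm _ hKm.aemeasurable, ← lintegral_indicator measurableSet_Ioo]
    refine lintegral_congr fun x => ?_
    by_cases hx : x ∈ Ioo (-1 : ℝ) 1
    · simp only [hK, indicator_of_mem hx]
      have hm : Measurable fun y => H (2 * Real.arcsin x, 2 * Real.sqrt M₀ * y) :=
        hHm.comp (measurable_const.prodMk (measurable_const.mul measurable_id))
      rw [hscale, lintegral_const_mul _ (hm.const_mul _)]
    · simp only [hK, indicator_of_notMem hx, lintegral_zero]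
  rw [h1, ← lintegral_comp_polarCoord_symm, polarCoord_target, Measure.volume_eq_prod,
    ← Measure.prod_restrict, lintegral_prod]
  rotate_left
  · exact (measurable_fst.ennreal_ofReal.smul
      (hKm.comp continuous_polarCoord_symm.measurable)).aemeasurable
  -- `E = 2 M₀ k² - M₀`
  have hEimg : (fun k : ℝ => 2 * M₀ * k ^ 2 - M₀) '' Ioo 0 1 = Ioo (-M₀) M₀ := by
    ext E
    constructor
    · rintro ⟨k, hk, rfl⟩
      have h2 : 0 < k ^ 2 := by have := hk.1; positivity
      have h3 : k ^ 2 < 1 := by nlinarith [hk.1, hk.2]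
      constructor <;> simp only <;> nlinarith
    · rintro ⟨h2, h3⟩
      have h4 : 0 < (E + M₀) / (2 * M₀) := div_pos (by linarith) (by linarith)
      refine ⟨Real.sqrt ((E + M₀) / (2 * M₀)), ⟨Real.sqrt_pos.2 h4, ?_⟩, ?_⟩
      · rw [Real.sqrt_lt' one_pos, div_lt_iff₀ (by linarith)]; linarith
      · simp only
        rw [Real.sq_sqrt h4.le]; field_simp; ring
  have hEinj : InjOn (fun k : ℝ => 2 * M₀ * k ^ 2 - M₀) (Ioo 0 1) := by
    intro k hk k' hk' h
    have h2 : k ^ 2 = k' ^ 2 := by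
      have h3 : 2 * M₀ * k ^ 2 = 2 * M₀ * k' ^ 2 := by simpa using h
      exact mul_left_cancel₀ (by positivity) h3
    exact (pow_left_inj₀ hk.1.le hk'.1.le two_ne_zero).1 h2
  have hEder : ∀ k ∈ Ioo (0 : ℝ) 1, HasDerivWithinAt (fun k : ℝ => 2 * M₀ * k ^ 2 - M₀)
      (4 * M₀ * k) (Ioo 0 1) k := fun k _ => by
    refine (((((hasDerivAt_id k).pow 2).const_mul (2 * M₀)).sub_const M₀).congr_deriv
      ?_).hasDerivWithinAt
    simp; ring
  rw [← hEimg, lintegral_image_eq_lintegral_abs_deriv_mul measurableSet_Ioo hEder hEinj,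
    ← lintegral_indicator measurableSet_Ioi, ← lintegral_indicator measurableSet_Ioo]
  refine lintegral_congr fun k => ?_
  have henergy : ∀ x y : ℝ, x ∈ Ioo (-1 : ℝ) 1 →
      energy M₀ (2 * Real.arcsin x, 2 * Real.sqrt M₀ * y) = 2 * M₀ * (x ^ 2 + y ^ 2) - M₀ := by
    intro x y hx
    have h3 := Real.sq_sqrt hM₀.le
    simp only [energy]
    rw [Real.cos_two_mul, Real.cos_arcsin, Real.sq_sqrt (by nlinarith [hx.1, hx.2]), mul_pow, mul_pow,
      h3]
    ring
  by_cases hk0 : 0 < k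
  swap
  · rw [indicator_of_notMem (by simpa using hk0), indicator_of_notMem (fun h => hk0 h.1)]
  rw [indicator_of_mem (by simpa using hk0)]
  by_cases hk1 : k < 1
  · have hk : k ∈ Ioo (0 : ℝ) 1 := ⟨hk0, hk1⟩
    rw [indicator_of_mem hk, ← lintegral_const_mul]
    rotate_left
    · refine Measurable.mul (hG.comp ?_) ?_
      · exact ((continuous_orbitCurve M₀ .trapped).comp (Continuous.prodMk_right _)).measurable
      · exact ((continuous_phaseSpeed M₀ .trapped).comp
          (Continuous.prodMk_right _)).measurable.inv.ennreal_ofReal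
    refine lintegral_congr fun φ => ?_
    have hkk : Real.sqrt ((2 * M₀ * k ^ 2 - M₀ + M₀) / (2 * M₀)) = k := by
      rw [show (2 * M₀ * k ^ 2 - M₀ + M₀) / (2 * M₀) = k ^ 2 by field_simp; ring, Real.sqrt_sq hk0.le]
    have hx : k * Real.sin φ ∈ Ioo (-1 : ℝ) 1 := by
      refine abs_lt.1 ?_
      rw [abs_mul, abs_of_pos hk0]
      nlinarith [Real.abs_sin_le_one φ, abs_nonneg (Real.sin φ)]
    have hmem : (2 * Real.arcsin (k * Real.sin φ), 2 * Real.sqrt M₀ * (k * Real.cos φ)) ∈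
        {z : ℝ × ℝ | energy M₀ z < M₀} := by
      rw [mem_ofPred_eq, henergy _ _ hx,
        show (k * Real.sin φ) ^ 2 + (k * Real.cos φ) ^ 2
          = k ^ 2 * (Real.sin φ ^ 2 + Real.cos φ ^ 2) by ring, Real.sin_sq_add_cos_sq]
      have : k ^ 2 < 1 := by nlinarith
      nlinarith
    have hsq : (2 * M₀ * k ^ 2 - M₀ + M₀) / (2 * M₀) * Real.sin φ ^ 2 = (k * Real.sin φ) ^ 2 := by
      field_simp; ring
    simp only [polarCoord_symm_apply, hK, indicator_of_mem hx, hH, indicator_of_mem hmem,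
      phaseSpeed, orbitCurve, hkk, hsq, smul_eq_mul]
    have hr : 0 < Real.sqrt (1 - (k * Real.sin φ) ^ 2) :=
      Real.sqrt_pos.2 (by nlinarith [hx.1, hx.2])
    set g := G (2 * Real.arcsin (k * Real.sin φ), 2 * Real.sqrt M₀ * (k * Real.cos φ))
    set r := Real.sqrt (1 - (k * Real.sin φ) ^ 2)
    rw [abs_of_pos (by positivity), abs_of_pos (by positivity), mul_comm g, ← mul_assoc,
      ← mul_assoc, ← mul_assoc, ← ENNReal.ofReal_mul hk0.le, ← ENNReal.ofReal_mul (by positivity),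
      ← ENNReal.ofReal_mul (by positivity)]
    congr 2
    have h3 := Real.mul_self_sqrt hM₀.le
    have hs' : Real.sqrt M₀ ≠ 0 := hs.ne'
    rw [← h3]
    rw [Real.sqrt_mul_self hs.le]
    field_simp
    ring
  · rw [indicator_of_notMem (fun h => hk1 h.2)]
    refine (lintegral_congr fun φ => ?_).trans lintegral_zero
    simp only [polarCoord_symm_apply, hK, smul_eq_mul]
    -- Radii k ≥ 1 contribute nothing: the point lies outside the strip, or its energy is at least
    -- M₀.
    by_cases hx : k * Real.sin φ ∈ Ioo (-1 : ℝ) 1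
    · have hmem : (2 * Real.arcsin (k * Real.sin φ), 2 * Real.sqrt M₀ * (k * Real.cos φ)) ∉
          {z : ℝ × ℝ | energy M₀ z < M₀} := by
        rw [mem_ofPred_eq, henergy _ _ hx,
          show (k * Real.sin φ) ^ 2 + (k * Real.cos φ) ^ 2
            = k ^ 2 * (Real.sin φ ^ 2 + Real.cos φ ^ 2) by ring, Real.sin_sq_add_cos_sq]
        have : 1 ≤ k ^ 2 := by nlinarith [not_lt.1 hk1]
        nlinarith
      rw [indicator_of_mem hx, hH, indicator_of_notMem hmem]
      simp
    · rw [indicator_of_notMem hx, mul_zero]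

theorem energy_ne_ae (M₀ : ℝ) : ∀ᵐ z ∂phaseMeasure, energy M₀ z ≠ M₀ := by
  have hm : MeasurableSet {z : ℝ × ℝ | energy M₀ z = M₀} :=
    measurableSet_eq_fun (continuous_energy M₀).measurable measurable_const
  have h0 : phaseMeasure {z : ℝ × ℝ | energy M₀ z = M₀} = 0 := by
    rw [phaseMeasure, Measure.measure_prod_null hm]
    refine Eventually.of_forall fun q => ?_
    refine Set.Finite.measure_zero (Set.Finite.subset
      (Set.toFinite {Real.sqrt (2 * (M₀ + M₀ * Real.cos q)), -Real.sqrt (2 * (M₀ + M₀ * Real.cos q))})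
      fun p hp => ?_) _
    have h1 : p ^ 2 / 2 - M₀ * Real.cos q = M₀ := hp
    have h2 : p ^ 2 = 2 * (M₀ + M₀ * Real.cos q) := by linarith
    rw [← h2, Real.sqrt_sq_eq_abs]
    rcases abs_choice p with h | h <;> simp [h]
  exact measure_eq_zero_iff_ae_notMem.1 h0

theorem lintegral_phaseMeasure_eq_sum {M₀ : ℝ} (hM₀ : 0 < M₀) {G : ℝ × ℝ → ENNReal}
    (hG : Measurable G) :
    ∫⁻ z, G z ∂phaseMeasure = ∑ i, ∫⁻ E in energyRange M₀ i, ∫⁻ φ in Ioc (-Real.pi) Real.pi,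
      G (orbitCurve M₀ i E φ) * ENNReal.ofReal (phaseSpeed M₀ i E φ)⁻¹ := by
  have hE := (continuous_energy M₀).measurable
  have hA : MeasurableSet {z : ℝ × ℝ | M₀ < energy M₀ z ∧ 0 < z.2} :=
    (measurableSet_lt measurable_const hE).inter (measurableSet_lt measurable_const measurable_snd)
  have hB : MeasurableSet {z : ℝ × ℝ | energy M₀ z < M₀} :=
    measurableSet_lt hE measurable_const
  have hC : MeasurableSet {z : ℝ × ℝ | M₀ < energy M₀ z ∧ z.2 < 0} :=
    (measurableSet_lt measurable_const hE).inter (measurableSet_lt measurable_snd measurable_const)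
  rw [sum_region]
  simp only [energyRange]
  rw [← lintegral_rotPos hM₀ hG, ← lintegral_trapped hM₀ hG, ← lintegral_rotNeg hM₀ hG,
    ← lintegral_union hB, ← lintegral_union hC]
  · rw [← setLIntegral_univ]
    refine setLIntegral_congr ?_
    filter_upwards [energy_ne_ae M₀] with z hz
    refine propext ⟨fun _ => ?_, fun _ => trivial⟩
    rcases lt_or_gt_of_ne hz with h | h
    · exact Or.inl (Or.inr h)
    · rcases lt_trichotomy z.2 0 with h' | h' | h'
      · exact Or.inr ⟨h, h'⟩
      -- Above the separatrix the momentum cannot vanish, so the three regions cover everything but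
      -- the null set {ℰ = M₀}.
      · exfalso
        unfold energy at h
        rw [h'] at h
        nlinarith [Real.neg_one_le_cos z.1]
      · exact Or.inl (Or.inl ⟨h, h'⟩)
  · rw [Set.disjoint_left]
    rintro z (h | h) h'
    · exact absurd h.2 (not_lt.2 h'.2.le)
    · exact absurd h'.1 (not_lt.2 (le_of_lt h))
  · rw [Set.disjoint_left]
    rintro z h h'
    exact absurd h.1 (not_lt.2 (le_of_lt h'))

/-- The measure `dJ` on the actions of a region, in terms of the energy. -/
def actionMeasure (M₀ : ℝ) (i : Region) : Measure ℝ :=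
  (volume.restrict (energyRange M₀ i)).withDensity
    fun E => ENNReal.ofReal (period M₀ i E / (2 * Real.pi))

instance instSigmaFiniteActionMeasure (M₀ : ℝ) (i : Region) : SigmaFinite (actionMeasure M₀ i) := by
  unfold actionMeasure
  exact SigmaFinite.withDensity_ofReal _

/-- The uniform measure on the angles `(-π, π]`. -/
abbrev angleMeasure : Measure ℝ := volume.restrict (Ioc (-Real.pi) Real.pi)

/-- The point of angle `θ` on the orbit of energy `E`, as a function of `(E, θ)`. -/
def angleOrbit (M₀ : ℝ) (i : Region) (x : ℝ × ℝ) : ℝ × ℝ :=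
  orbit M₀ (basePoint M₀ i x.1) (x.2 * (period M₀ i x.1 / (2 * Real.pi)))

theorem measurable_angleOrbit (M₀ : ℝ) (i : Region) : Measurable (angleOrbit M₀ i) :=
  measurable_orbit_comp ((continuous_basePoint M₀ i).measurable.comp measurable_fst)
    (measurable_snd.mul (((measurable_period M₀ i).comp measurable_fst).div_const _))

/-- The angle is θ = (2π/T) · (time to reach φ). The phase speed is even, so the time is odd in φ
and equals T/2 at φ = π; hence φ ↦ θ is an increasing bijection of (-π, π]. -/
theorem lintegral_orbitCurve {M₀ : ℝ} (hM₀ : 0 < M₀) {i : Region} {E : ℝ}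
    (hE : E ∈ energyRange M₀ i) {G : ℝ × ℝ → ENNReal} (hG : Measurable G) :
    ∫⁻ φ in Ioc (-Real.pi) Real.pi,
      G (orbitCurve M₀ i E φ) * ENNReal.ofReal (phaseSpeed M₀ i E φ)⁻¹
    = ENNReal.ofReal (period M₀ i E / (2 * Real.pi)) *
        ∫⁻ θ, G (angleOrbit M₀ i (E, θ)) ∂angleMeasure := by
  have hT := period_pos hM₀ hE
  have hpi := Real.pi_pos
  set c := 2 * Real.pi / period M₀ i E with hc
  have hcpos : 0 < c := by positivity
  have himg : (fun φ => c * phaseTime M₀ i E φ) '' Ioc (-Real.pi) Real.pi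
      = Ioc (-Real.pi) Real.pi := by
    have hmono : StrictMono fun φ => c * phaseTime M₀ i E φ := fun a b h =>
      mul_lt_mul_of_pos_left (strictMono_phaseTime hM₀ hE h) hcpos
    have hcont : Continuous fun φ => c * phaseTime M₀ i E φ :=
      continuous_const.mul (continuous_iff_continuousAt.2
        fun φ => (hasDerivAt_phaseTime hM₀ hE φ).continuousAt)
    have h1 : c * phaseTime M₀ i E Real.pi = Real.pi := by
      rw [phaseTime_pi hM₀ hE, hc]; field_simp
    have h2 : c * phaseTime M₀ i E (-Real.pi) = -Real.pi := by
      rw [phaseTime_neg, mul_neg, h1]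
    refine Subset.antisymm ?_ ?_
    · rintro _ ⟨φ, hφ, rfl⟩
      refine ⟨?_, ?_⟩
      · have := hmono hφ.1
        simp only [h2] at this; exact this
      · have := hmono.monotone hφ.2
        simp only [h1] at this; exact this
    · have := intermediate_value_Ioc (f := fun φ => c * phaseTime M₀ i E φ)
        (show -Real.pi ≤ Real.pi by linarith) hcont.continuousOn
      simp only [h1, h2] at this
      exact this
  have hinj : InjOn (fun φ => c * phaseTime M₀ i E φ) (Ioc (-Real.pi) Real.pi) := by
    intro a _ b _ h
    exact (strictMono_phaseTime hM₀ hE).injective (mul_left_cancel₀ hcpos.ne' h)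
  have h1 := lintegral_image_eq_lintegral_abs_deriv_mul (f := fun φ => c * phaseTime M₀ i E φ)
    (f' := fun φ => c * (phaseSpeed M₀ i E φ)⁻¹) measurableSet_Ioc
    (fun φ _ => ((hasDerivAt_phaseTime hM₀ hE φ).const_mul c).hasDerivWithinAt) hinj
    (fun θ => G (angleOrbit M₀ i (E, θ)))
  rw [himg] at h1
  rw [h1, ← lintegral_const_mul]
  swap
  · refine Measurable.mul ?_ ?_
    · exact (((continuous_phaseSpeed_inv hM₀ hE).const_mul c).abs).measurable.ennreal_ofReal
    · refine hG.comp ((measurable_angleOrbit M₀ i).comp ?_)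
      refine measurable_const.prodMk ?_
      have hcont : Continuous fun φ => c * phaseTime M₀ i E φ :=
        continuous_const.mul (continuous_iff_continuousAt.2
          fun φ => (hasDerivAt_phaseTime hM₀ hE φ).continuousAt)
      exact hcont.measurable
  refine lintegral_congr fun φ => ?_
  have hs := phaseSpeed_pos hM₀ hE φ
  have h3 : angleOrbit M₀ i (E, c * phaseTime M₀ i E φ) = orbitCurve M₀ i E φ := by
    rw [angleOrbit, ← orbit_phaseTime hM₀ hE]
    congr 1
    simp only [hc]
    field_simp
  rw [h3, abs_of_pos (by positivity), ← mul_assoc, ← ENNReal.ofReal_mul (by positivity), mul_comm]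
  congr 2
  rw [hc]
  field_simp

/-- This is dq dp = dθ dJ, stated with the energy as coordinate through dJ = (T/2π) dE. All later
phase-space integrals pass through it, without ever inverting J(E). -/
theorem phaseMeasure_eq_sum_map {M₀ : ℝ} (hM₀ : 0 < M₀) :
    phaseMeasure = ∑ i, ((actionMeasure M₀ i).prod angleMeasure).map (angleOrbit M₀ i) := by
  refine Measure.ext_of_lintegral _ fun G hG => ?_
  rw [lintegral_phaseMeasure_eq_sum hM₀ hG, lintegral_finsetSum_measure]
  refine Finset.sum_congr rfl fun i _ => ?_
  rw [lintegral_map hG (measurable_angleOrbit M₀ i),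
    lintegral_prod (fun x => G (angleOrbit M₀ i x))
      (hG.comp (measurable_angleOrbit M₀ i)).aemeasurable, actionMeasure,
    lintegral_withDensity_eq_lintegral_mul]
  · refine setLIntegral_congr_fun (measurableSet_energyRange M₀ i) fun E hE => ?_
    rw [lintegral_orbitCurve hM₀ hE hG]
    rfl
  · exact ((measurable_period M₀ i).div_const _).ennreal_ofReal
  · exact (hG.comp (measurable_angleOrbit M₀ i)).lintegral_prod_right'

end

section

/-! ### Energy and frequency as functions of the action -/

/-- The number of times an orbit runs through its range of positions. -/
def passages : Region → ℝ
  | .rotPos => 1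
  | .trapped => 2
  | .rotNeg => 1

theorem action_eq (M₀ : ℝ) (i : Region) (E : ℝ) :
    action M₀ i E = passages i / (2 * Real.pi) *
      ∫ q in (-Real.pi)..Real.pi, Real.sqrt (2 * (E + M₀ * Real.cos q)) := by
  have := Real.pi_pos
  cases i
  · rfl
  · simp only [action, passages]; congr 1; field_simp
  · rfl

theorem continuous_action (M₀ : ℝ) (i : Region) : Continuous (action M₀ i) := by
  have h : Continuous fun E => ∫ q in (-Real.pi)..Real.pi,
      Real.sqrt (2 * (E + M₀ * Real.cos q)) := by
    refine intervalIntegral.continuous_parametric_intervalIntegral_of_continuous' ?_ _ _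
    simp only [Function.uncurry_def]
    fun_prop
  have h2 : action M₀ i = fun E => passages i / (2 * Real.pi) *
      ∫ q in (-Real.pi)..Real.pi, Real.sqrt (2 * (E + M₀ * Real.cos q)) := funext (action_eq M₀ i)
  rw [h2]
  exact continuous_const.mul h

theorem hasDerivAt_integral_sqrt {M₀ E : ℝ} (hM₀ : 0 < M₀) (hE : M₀ < E) :
    HasDerivAt (fun E => ∫ q in (-Real.pi)..Real.pi, Real.sqrt (2 * (E + M₀ * Real.cos q)))
      (∫ q in (-Real.pi)..Real.pi, (Real.sqrt (2 * (E + M₀ * Real.cos q)))⁻¹) E := by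
  obtain ⟨E₁, h1, h2⟩ := exists_between hE
  have hpos : ∀ x ∈ Ioi E₁, ∀ q, 2 * (E₁ - M₀) < 2 * (x + M₀ * Real.cos q) := by
    intro x hx q
    have : E₁ < x := hx
    nlinarith [Real.neg_one_le_cos q]
  refine (intervalIntegral.hasDerivAt_integral_of_dominated_loc_of_deriv_le
    (bound := fun _ => (Real.sqrt (2 * (E₁ - M₀)))⁻¹) (s := Ioi E₁)
    (F' := fun x q => (Real.sqrt (2 * (x + M₀ * Real.cos q)))⁻¹)
    (Ioi_mem_nhds h2) ?_ ?_ ?_ ?_ ?_ ?_).2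
  · refine Eventually.of_forall fun x => Continuous.aestronglyMeasurable ?_
    fun_prop
  · refine Continuous.intervalIntegrable ?_ _ _
    fun_prop
  · refine Measurable.aestronglyMeasurable (Measurable.inv ?_)
    exact Continuous.measurable (by fun_prop)
  · refine Eventually.of_forall fun q _ x hx => ?_
    have h3 := hpos x hx q
    have h4 : 0 < Real.sqrt (2 * (E₁ - M₀)) := Real.sqrt_pos.2 (by linarith)
    rw [Real.norm_eq_abs, abs_of_nonneg (by positivity)]
    exact inv_anti₀ h4 (Real.sqrt_le_sqrt h3.le)
  · exact intervalIntegrable_const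
  · refine Eventually.of_forall fun q _ x hx => ?_
    have h3 : 0 < 2 * (x + M₀ * Real.cos q) := by have := hpos x hx q; linarith
    have h4 : HasDerivAt (fun E => 2 * (E + M₀ * Real.cos q)) (2 * 1) x :=
      ((hasDerivAt_id x).add_const _).const_mul 2
    refine (h4.sqrt h3.ne').congr_deriv ?_
    have := Real.sqrt_pos.2 h3
    field_simp

/-- Both sides are the area of {ℰ < E}: the left in energy-phase coordinates, the right by slicing
at fixed q, where the slice has length 2√(2(E + M₀ cos q)). This avoids differentiating the action
integral directly, whose differentiated integrand is singular at the turning points. -/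
theorem lintegral_period_trapped {M₀ E : ℝ} (hM₀ : 0 < M₀) (hE : E ∈ energyRange M₀ .trapped) :
    ∫⁻ E' in Ioo (-M₀) E, ENNReal.ofReal (period M₀ .trapped E')
      = ENNReal.ofReal (2 * Real.pi * action M₀ .trapped E) := by
  have hpi := Real.pi_pos
  have hEm := (continuous_energy M₀).measurable
  have hB : MeasurableSet {z : ℝ × ℝ | energy M₀ z < E} := measurableSet_lt hEm measurable_const
  have h1 := lintegral_phaseMeasure_eq_sum hM₀
    (measurable_const.indicator hB : Measurable ({z : ℝ × ℝ | energy M₀ z < E}.indicator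
      fun _ => (1 : ENNReal)))
  have henergy : ∀ i, ∀ E' ∈ energyRange M₀ i, ∀ φ, energy M₀ (orbitCurve M₀ i E' φ) = E' :=
    fun i E' hE' φ => by
      rw [← orbit_phaseTime hM₀ hE', energy_orbit, energy_basePoint hM₀ hE']
  have hrot : ∀ i, i ≠ Region.trapped → ∫⁻ E' in energyRange M₀ i,
      ∫⁻ φ in Ioc (-Real.pi) Real.pi, ({z : ℝ × ℝ | energy M₀ z < E}.indicator
        (fun _ => (1 : ENNReal))) (orbitCurve M₀ i E' φ)
          * ENNReal.ofReal (phaseSpeed M₀ i E' φ)⁻¹ = 0 := by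
    intro i hi
    refine (setLIntegral_congr_fun (measurableSet_energyRange M₀ i) fun E' hE' => ?_).trans
      lintegral_zero
    have : ¬ E' < E := by
      have h3 : M₀ < E' := by
        cases i
        · exact hE'
        · exact absurd rfl hi
        · exact hE'
      have := hE.2
      linarith
    simp [henergy i E' hE', this]
  rw [sum_region, hrot .rotPos (by simp), hrot .rotNeg (by simp), zero_add, add_zero,
    lintegral_phaseMeasure (measurable_const.indicator hB)] at h1
  have hleft : ∫⁻ q in Ioc (-Real.pi) Real.pi, ∫⁻ p, ({z : ℝ × ℝ | energy M₀ z < E}.indicator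
      (fun _ => (1 : ENNReal))) (q, p)
      = ENNReal.ofReal (2 * Real.pi * action M₀ .trapped E) := by
    rw [action_eq, intervalIntegral.integral_of_le (by linarith)]
    have hint : IntegrableOn (fun q => Real.sqrt (2 * (E + M₀ * Real.cos q)))
        (Ioc (-Real.pi) Real.pi) :=
      (Continuous.integrableOn_Icc (by fun_prop)).mono_set Ioc_subset_Icc_self
    have : 2 * Real.pi * (passages .trapped / (2 * Real.pi) * ∫ q in Ioc (-Real.pi) Real.pi,
        Real.sqrt (2 * (E + M₀ * Real.cos q)))
        = ∫ q in Ioc (-Real.pi) Real.pi, 2 * Real.sqrt (2 * (E + M₀ * Real.cos q)) := by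
      rw [integral_const_mul, passages]; field_simp
    rw [this, ofReal_integral_eq_lintegral_ofReal (hint.const_mul 2)
      (Eventually.of_forall fun q => by positivity)]
    refine lintegral_congr fun q => ?_
    have hset : ∀ p, ({z : ℝ × ℝ | energy M₀ z < E}.indicator (fun _ => (1 : ENNReal))) (q, p)
        = (Ioo (-Real.sqrt (2 * (E + M₀ * Real.cos q)))
            (Real.sqrt (2 * (E + M₀ * Real.cos q)))).indicator (fun _ => 1) p := by
      intro p
      have : (q, p) ∈ {z : ℝ × ℝ | energy M₀ z < E} ↔
          p ∈ Ioo (-Real.sqrt (2 * (E + M₀ * Real.cos q)))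
            (Real.sqrt (2 * (E + M₀ * Real.cos q))) := by
        rw [mem_Ioo, ← abs_lt, Real.lt_sqrt (abs_nonneg p), sq_abs]
        simp only [energy, mem_ofPred_eq]
        constructor <;> intro h <;> linarith
      by_cases h : (q, p) ∈ {z : ℝ × ℝ | energy M₀ z < E}
      · rw [indicator_of_mem h, indicator_of_mem (this.1 h)]
      · rw [indicator_of_notMem h, indicator_of_notMem (fun h' => h (this.2 h'))]
    simp_rw [hset]
    rw [lintegral_indicator measurableSet_Ioo, setLIntegral_one, Real.volume_Ioo]
    congr 1
    ring
  rw [hleft] at h1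
  rw [h1]
  have hsub : Ioo (-M₀) E = energyRange M₀ .trapped ∩ Iio E := by
    ext x
    simp only [energyRange, mem_Ioo, mem_inter_iff, mem_Iio]
    have := hE.2
    constructor
    · rintro ⟨h, h'⟩; exact ⟨⟨h, by linarith⟩, h'⟩
    · rintro ⟨⟨h, _⟩, h'⟩; exact ⟨h, h'⟩
  rw [hsub, inter_comm, ← setLIntegral_indicator measurableSet_Iio]
  refine setLIntegral_congr_fun (measurableSet_energyRange M₀ _) fun E' hE' => ?_
  by_cases h : E' < E
  · simp only [indicator, mem_ofPred_eq, henergy _ E' hE', h, if_true, one_mul, mem_Iio]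
    rw [period, intervalIntegral.integral_of_le (by linarith), ofReal_integral_eq_lintegral_ofReal]
    · exact ((continuous_phaseSpeed_inv hM₀ hE').integrableOn_Icc).mono_set Ioc_subset_Icc_self
    · exact Eventually.of_forall fun φ => (inv_pos.2 (phaseSpeed_pos hM₀ hE' φ)).le
  · simp [henergy _ E' hE', h]

theorem action_trapped_nonneg (M₀ E : ℝ) : 0 ≤ action M₀ .trapped E := by
  have := Real.pi_pos
  rw [action_eq]
  refine mul_nonneg (by simp only [passages]; positivity)
    (intervalIntegral.integral_nonneg (by linarith) fun q _ => Real.sqrt_nonneg _)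

theorem integrableOn_period_trapped {M₀ E : ℝ} (hM₀ : 0 < M₀) (hE : E ∈ energyRange M₀ .trapped) :
    IntegrableOn (period M₀ .trapped) (Ioo (-M₀) E) := by
  refine ⟨(measurable_period M₀ _).aestronglyMeasurable, ?_⟩
  rw [hasFiniteIntegral_iff_ofReal, lintegral_period_trapped hM₀ hE]
  · exact ENNReal.ofReal_lt_top
  · refine (ae_restrict_iff' measurableSet_Ioo).2 (Eventually.of_forall fun E' hE' => ?_)
    exact (period_pos hM₀ (i := .trapped) ⟨hE'.1, hE'.2.trans hE.2⟩).le

theorem integral_period_trapped {M₀ E : ℝ} (hM₀ : 0 < M₀) (hE : E ∈ energyRange M₀ .trapped) :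
    ∫ E' in (-M₀)..E, period M₀ .trapped E' = 2 * Real.pi * action M₀ .trapped E := by
  have hpi := Real.pi_pos
  rw [intervalIntegral.integral_of_le hE.1.le, integral_Ioc_eq_integral_Ioo,
    integral_eq_lintegral_of_nonneg_ae, lintegral_period_trapped hM₀ hE, ENNReal.toReal_ofReal]
  · have := action_trapped_nonneg M₀ E
    positivity
  · refine (ae_restrict_iff' measurableSet_Ioo).2 (Eventually.of_forall fun E' hE' => ?_)
    exact (period_pos hM₀ (i := .trapped) ⟨hE'.1, hE'.2.trans hE.2⟩).le
  · exact (measurable_period M₀ _).aestronglyMeasurable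

theorem hasDerivAt_action {M₀ : ℝ} (hM₀ : 0 < M₀) {i : Region} {E : ℝ}
    (hE : E ∈ energyRange M₀ i) :
    HasDerivAt (action M₀ i) (period M₀ i E / (2 * Real.pi)) E := by
  have hpi := Real.pi_pos
  cases i with
  | rotPos =>
    refine ((hasDerivAt_integral_sqrt hM₀ hE).const_mul (1 / (2 * Real.pi))).congr_deriv ?_
    simp only [period, phaseSpeed]; ring
  | rotNeg =>
    refine ((hasDerivAt_integral_sqrt hM₀ hE).const_mul (1 / (2 * Real.pi))).congr_deriv ?_
    simp only [period, phaseSpeed]; ring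
  | trapped =>
    have h1 : HasDerivAt (fun E => ∫ E' in (-M₀)..E, period M₀ .trapped E')
        (period M₀ .trapped E) E := by
      refine intervalIntegral.integral_hasDerivAt_right ?_ ?_ (continuousAt_period hM₀ hE)
      · rw [intervalIntegrable_iff_integrableOn_Ioo_of_le hE.1.le]
        exact integrableOn_period_trapped hM₀ hE
      · exact (measurable_period M₀ _).stronglyMeasurable.stronglyMeasurableAtFilter
    have h2 : (fun E => ∫ E' in (-M₀)..E, period M₀ .trapped E')
        =ᶠ[𝓝 E] fun E => 2 * Real.pi * action M₀ .trapped E := by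
      filter_upwards [(isOpen_energyRange M₀ .trapped).mem_nhds hE] with E' hE'
      exact integral_period_trapped hM₀ hE'
    have h3 := (h1.congr_of_eventuallyEq h2.symm).const_mul (1 / (2 * Real.pi))
    refine (h3.congr_of_eventuallyEq (Eventually.of_forall fun E' => ?_)).congr_deriv (by ring)
    simp only; field_simp

theorem integral_sqrt_separatrix {M₀ : ℝ} (hM₀ : 0 < M₀) :
    ∫ q in (-Real.pi)..Real.pi, Real.sqrt (2 * (M₀ + M₀ * Real.cos q)) = 8 * Real.sqrt M₀ := by
  have hpi := Real.pi_pos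
  have h1 : ∀ q ∈ uIcc (-Real.pi) Real.pi, Real.sqrt (2 * (M₀ + M₀ * Real.cos q))
      = 2 * Real.sqrt M₀ * Real.cos (q / 2) := by
    intro q hq
    rw [uIcc_of_le (by linarith)] at hq
    have h2 : 0 ≤ Real.cos (q / 2) :=
      Real.cos_nonneg_of_mem_Icc ⟨by linarith [hq.1], by linarith [hq.2]⟩
    have h3 : Real.cos q = 2 * Real.cos (q / 2) ^ 2 - 1 := by
      rw [← Real.cos_two_mul]; congr 1; ring
    have h4 := Real.mul_self_sqrt hM₀.le
    rw [h3, show 2 * (M₀ + M₀ * (2 * Real.cos (q / 2) ^ 2 - 1))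
      = (2 * Real.sqrt M₀ * Real.cos (q / 2)) ^ 2 by rw [mul_pow, mul_pow, sq (Real.sqrt M₀), h4]; ring]
    exact Real.sqrt_sq (by positivity)
  rw [intervalIntegral.integral_congr h1, intervalIntegral.integral_const_mul,
    intervalIntegral.integral_comp_div Real.cos two_ne_zero, integral_cos, neg_div, Real.sin_neg,
    Real.sin_pi_div_two]
  simp only [smul_eq_mul]
  ring

/-- The closure is included so that the range of actions can be read off from the values at the
limiting energies ±M₀. -/
theorem strictMonoOn_action {M₀ : ℝ} (hM₀ : 0 < M₀) (i : Region) :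
    StrictMonoOn (action M₀ i) (closure (energyRange M₀ i)) := by
  have hconv : Convex ℝ (energyRange M₀ i) := by
    cases i
    exacts [convex_Ioi _, convex_Ioo _ _, convex_Ioi _]
  refine strictMonoOn_of_deriv_pos hconv.closure (continuous_action M₀ i).continuousOn
    fun E hE => ?_
  have hE' : E ∈ energyRange M₀ i := by
    cases i
    · simpa [energyRange, interior_Ici] using hE
    · simpa [energyRange, closure_Ioo (show -M₀ ≠ M₀ by linarith), interior_Icc] using hE
    · simpa [energyRange, interior_Ici] using hE
  rw [(hasDerivAt_action hM₀ hE').deriv]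
  have := period_pos hM₀ hE'
  have := Real.pi_pos
  positivity

theorem injOn_action {M₀ : ℝ} (hM₀ : 0 < M₀) (i : Region) :
    InjOn (action M₀ i) (energyRange M₀ i) :=
  (strictMonoOn_action hM₀ i).injOn.mono subset_closure

theorem image_Ioi_of_tendsto_atTop {f : ℝ → ℝ} {a : ℝ} (hf : ContinuousOn f (Ici a))
    (hmono : StrictMonoOn f (Ici a)) (htop : Tendsto f atTop atTop) : f '' Ioi a = Ioi (f a) := by
  refine Subset.antisymm ?_ fun y hy => ?_
  · rintro _ ⟨x, hx, rfl⟩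
    exact hmono self_mem_Ici (mem_Ici.2 (le_of_lt hx)) hx
  · obtain ⟨b, hb, hab⟩ := ((htop.eventually_gt_atTop y).and (eventually_gt_atTop a)).exists
    obtain ⟨x, hx, rfl⟩ := intermediate_value_Ioo hab.le (hf.mono Icc_subset_Ici_self) ⟨hy, hb⟩
    exact ⟨x, hx.1, rfl⟩

theorem image_action {M₀ : ℝ} (hM₀ : 0 < M₀) (i : Region) :
    action M₀ i '' energyRange M₀ i = actionRange M₀ i := by
  have hpi := Real.pi_pos
  have hsep : ∀ i, action M₀ i M₀ = passages i * (4 * Real.sqrt M₀ / Real.pi) := by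
    intro i
    rw [action_eq, integral_sqrt_separatrix hM₀]; field_simp; ring
  have htop : Tendsto (action M₀ .rotPos) atTop atTop := by
    have h1 : Tendsto (fun E => Real.sqrt (2 * (E - M₀))) atTop atTop :=
      Real.tendsto_sqrt_atTop.comp (Tendsto.const_mul_atTop two_pos (tendsto_atTop_add_const_right _ _ tendsto_id))
    refine tendsto_atTop_mono (fun E => ?_) h1
    rw [action_eq, passages]
    have h2 : ∫ q in (-Real.pi)..Real.pi, Real.sqrt (2 * (E - M₀)) ≤
        ∫ q in (-Real.pi)..Real.pi, Real.sqrt (2 * (E + M₀ * Real.cos q)) := by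
      refine intervalIntegral.integral_mono_on (by linarith) intervalIntegrable_const
        (Continuous.intervalIntegrable (by fun_prop) _ _) fun q _ => Real.sqrt_le_sqrt ?_
      nlinarith [Real.neg_one_le_cos q]
    rw [intervalIntegral.integral_const, smul_eq_mul] at h2
    rw [div_mul_eq_mul_div, le_div_iff₀ (by positivity)]
    linarith
  have hrot : action M₀ .rotPos '' Ioi M₀ = Ioi (4 * Real.sqrt M₀ / Real.pi) := by
    have h1 := strictMonoOn_action hM₀ .rotPos
    simp only [energyRange, closure_Ioi] at h1
    rw [image_Ioi_of_tendsto_atTop (continuous_action M₀ _).continuousOn h1 htop, hsep, passages,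
      one_mul]
  cases i with
  | rotPos => exact hrot
  | rotNeg => exact hrot
  | trapped =>
    have h1 := strictMonoOn_action hM₀ .trapped
    simp only [energyRange, closure_Ioo (show -M₀ ≠ M₀ by linarith)] at h1
    have h0 : action M₀ .trapped (-M₀) = 0 := by
      rw [action_eq]
      have : ∀ q, Real.sqrt (2 * (-M₀ + M₀ * Real.cos q)) = 0 := fun q =>
        Real.sqrt_eq_zero_of_nonpos (by nlinarith [Real.cos_le_one q])
      simp [this]
    have h2 : action M₀ .trapped M₀ = 8 * Real.sqrt M₀ / Real.pi := by
      rw [hsep, passages]; ring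
    simp only [energyRange, actionRange, ← h2, ← h0]
    refine Subset.antisymm ?_
      (intermediate_value_Ioo (by linarith) (continuous_action M₀ _).continuousOn)
    rintro _ ⟨E, hE, rfl⟩
    exact ⟨h1 ⟨le_rfl, by linarith⟩ (Ioo_subset_Icc_self hE) hE.1,
      h1 (Ioo_subset_Icc_self hE) ⟨by linarith, le_rfl⟩ hE.2⟩

/-! ### Energy as the inverse function of the action, and integrals over the action. -/

theorem energyOfAction_action {M₀ : ℝ} (hM₀ : 0 < M₀) {i : Region} {E : ℝ}
    (hE : E ∈ energyRange M₀ i) : energyOfAction M₀ i (action M₀ i E) = E :=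
  (injOn_action hM₀ i).leftInvOn_invFunOn hE

/-- Continuity of the period makes the action strictly differentiable, and a left inverse on an open
neighbourhood then has the reciprocal derivative. So Ω = 2π/T. -/
theorem hasDerivAt_energyOfAction {M₀ : ℝ} (hM₀ : 0 < M₀) {i : Region} {E : ℝ}
    (hE : E ∈ energyRange M₀ i) :
    HasDerivAt (energyOfAction M₀ i) (period M₀ i E / (2 * Real.pi))⁻¹ (action M₀ i E) := by
  have hpi := Real.pi_pos
  have hT := period_pos hM₀ hE
  have hnhds := (isOpen_energyRange M₀ i).mem_nhds hE
  have h1 : HasStrictDerivAt (action M₀ i) (period M₀ i E / (2 * Real.pi)) E :=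
    hasStrictDerivAt_of_hasDerivAt_of_continuousAt
      (f' := fun E => period M₀ i E / (2 * Real.pi))
      (by filter_upwards [hnhds] with E' hE' using hasDerivAt_action hM₀ hE')
      ((continuousAt_period hM₀ hE).div_const _)
  exact (h1.to_local_left_inverse (by positivity)
    (by filter_upwards [hnhds] with E' hE' using energyOfAction_action hM₀ hE')).hasDerivAt

theorem frequency_action {M₀ : ℝ} (hM₀ : 0 < M₀) {i : Region} {E : ℝ}
    (hE : E ∈ energyRange M₀ i) :
    frequency M₀ i (action M₀ i E) = (period M₀ i E / (2 * Real.pi))⁻¹ :=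
  (hasDerivAt_energyOfAction hM₀ hE).deriv

theorem angleAction_action {M₀ : ℝ} (hM₀ : 0 < M₀) {i : Region} {E : ℝ}
    (hE : E ∈ energyRange M₀ i) (θ : ℝ) :
    angleAction M₀ i θ (action M₀ i E) = angleOrbit M₀ i (E, θ) := by
  rw [angleAction, angleOrbit, energyOfAction_action hM₀ hE, frequency_action hM₀ hE, div_inv_eq_mul]

theorem deriv_actionProfile_action {M₀ : ℝ} (hM₀ : 0 < M₀) {i : Region} {E : ℝ}
    (hE : E ∈ energyRange M₀ i) {fhat : ℝ → ℝ} (hf : DifferentiableAt ℝ fhat E) :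
    deriv (actionProfile M₀ fhat i) (action M₀ i E)
      = deriv fhat E * (period M₀ i E / (2 * Real.pi))⁻¹ := by
  have h1 := hasDerivAt_energyOfAction hM₀ hE
  have h2 : HasDerivAt fhat (deriv fhat E) (energyOfAction M₀ i (action M₀ i E)) := by
    rw [energyOfAction_action hM₀ hE]; exact hf.hasDerivAt
  exact (h2.comp _ h1).deriv

/-- The substitution J = J(E), with dJ/dE = T/2π, moves all integrals over actions to energies,
where orbits and frequencies have explicit formulas. -/
theorem setIntegral_actionRange {M₀ : ℝ} (hM₀ : 0 < M₀) (i : Region) {E : Type*}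
    [NormedAddCommGroup E] [NormedSpace ℝ E] (F : ℝ → E) :
    ∫ J in actionRange M₀ i, F J = ∫ x, F (action M₀ i x) ∂actionMeasure M₀ i := by
  have hpi := Real.pi_pos
  rw [← image_action hM₀, integral_image_eq_integral_abs_deriv_smul (measurableSet_energyRange M₀ i)
    (fun x hx => (hasDerivAt_action hM₀ hx).hasDerivWithinAt) (injOn_action hM₀ i), actionMeasure,
    integral_withDensity_eq_integral_toReal_smul
      ((measurable_period M₀ i).div_const _).ennreal_ofReal
      (Eventually.of_forall fun _ => ENNReal.ofReal_lt_top)]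
  refine setIntegral_congr_fun (measurableSet_energyRange M₀ i) fun x hx => ?_
  have := period_pos hM₀ hx
  rw [abs_of_pos (by positivity), ENNReal.toReal_ofReal (by positivity)]

theorem integrableOn_actionRange_iff {M₀ : ℝ} (hM₀ : 0 < M₀) (i : Region) {E : Type*}
    [NormedAddCommGroup E] [NormedSpace ℝ E] (F : ℝ → E) :
    IntegrableOn F (actionRange M₀ i) ↔
      Integrable (fun x => F (action M₀ i x)) (actionMeasure M₀ i) := by
  have hpi := Real.pi_pos
  rw [← image_action hM₀, integrableOn_image_iff_integrableOn_abs_deriv_smul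
    (measurableSet_energyRange M₀ i)
    (fun x hx => (hasDerivAt_action hM₀ hx).hasDerivWithinAt) (injOn_action hM₀ i), actionMeasure,
    integrable_withDensity_iff_integrable_smul'
      ((measurable_period M₀ i).div_const _).ennreal_ofReal
      (Eventually.of_forall fun _ => ENNReal.ofReal_lt_top)]
  refine integrableOn_congr_fun (fun x hx => ?_) (measurableSet_energyRange M₀ i)
  have := period_pos hM₀ hx
  rw [abs_of_pos (by positivity), ENNReal.toReal_ofReal (by positivity)]

theorem ae_mem_energyRange (M₀ : ℝ) (i : Region) :
    ∀ᵐ E ∂actionMeasure M₀ i, E ∈ energyRange M₀ i :=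
  (withDensity_absolutelyContinuous _ _).ae_le (ae_restrict_mem (measurableSet_energyRange M₀ i))

end

section

/-! ### Integrability of the equilibrium profile -/

/-- A stationary solution that is a decreasing function of the energy. -/
structure IsMonotoneEquilibrium (f₀ : ℝ × ℝ → ℝ) (M₀ : ℝ) (fhat : ℝ → ℝ) : Prop where
  stationary : IsStationarySolution f₀
  orderX_eq : orderX f₀ = M₀
  orderY_eq : orderY f₀ = 0
  pos : 0 < M₀
  eq_energy : ∀ z, f₀ z = fhat (energy M₀ z)
  anti : StrictAntiOn fhat (Ici (-M₀))
  contDiffOn : ContDiffOn ℝ 1 fhat (Ici (-M₀))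

variable {f₀ : ℝ × ℝ → ℝ} {M₀ : ℝ} {fhat : ℝ → ℝ}

theorem neg_lt_energy (hM₀ : 0 < M₀) {z : ℝ × ℝ} (hz : z.2 ≠ 0) : -M₀ < energy M₀ z := by
  unfold energy
  have : 0 < z.2 ^ 2 := by positivity
  nlinarith [Real.cos_le_one z.1]

theorem ae_snd_ne_zero : ∀ᵐ z ∂phaseMeasure, z.2 ≠ 0 := by
  have h : ∀ᵐ p ∂(volume : Measure ℝ), p ≠ 0 := by simp [ae_iff]
  exact (Measure.quasiMeasurePreserving_snd (μ := volume.restrict (Ioc (-Real.pi) Real.pi))).ae h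

theorem measure_band_lt_top (r : ℝ) : phaseMeasure {z : ℝ × ℝ | |z.2| ≤ r} < ⊤ := by
  have h : {z : ℝ × ℝ | |z.2| ≤ r} = univ ×ˢ Icc (-r) r := by
    ext z; simp [abs_le]
  rw [h, phaseMeasure, Measure.prod_prod]
  refine ENNReal.mul_lt_top ?_ ?_
  · simp
  · simp

namespace IsMonotoneEquilibrium

theorem differentiableAt (h : IsMonotoneEquilibrium f₀ M₀ fhat) {E : ℝ} (hE : -M₀ < E) :
    DifferentiableAt ℝ fhat E :=
  (h.contDiffOn.differentiableOn one_ne_zero).differentiableAt (Ici_mem_nhds hE)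

theorem deriv_nonpos (h : IsMonotoneEquilibrium f₀ M₀ fhat) {E : ℝ} (hE : -M₀ < E) :
    deriv fhat E ≤ 0 := by
  rw [← derivWithin_of_mem_nhds (Ici_mem_nhds hE)]
  exact h.anti.antitoneOn.derivWithin_nonpos

theorem continuousAt_deriv (h : IsMonotoneEquilibrium f₀ M₀ fhat) {E : ℝ} (hE : -M₀ < E) :
    ContinuousAt (deriv fhat) E :=
  ((h.contDiffOn.mono Ioi_subset_Ici_self).continuousOn_deriv_of_isOpen isOpen_Ioi
    le_rfl).continuousAt (Ioi_mem_nhds hE)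

theorem exists_abs_deriv_le (h : IsMonotoneEquilibrium f₀ M₀ fhat) (R : ℝ) :
    ∃ C, 0 ≤ C ∧ ∀ E ∈ Ioc (-M₀) R, |deriv fhat E| ≤ C := by
  obtain ⟨C, hC⟩ := isCompact_Icc.exists_bound_of_continuousOn
    ((h.contDiffOn.continuousOn_derivWithin (uniqueDiffOn_Ici _) le_rfl).mono
      (Icc_subset_Ici_self : Icc (-M₀) R ⊆ Ici (-M₀)))
  refine ⟨max C 0, le_max_right _ _, fun E hE => ?_⟩
  rw [← derivWithin_of_mem_nhds (Ici_mem_nhds hE.1)]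
  exact (hC E (Ioc_subset_Icc_self hE)).trans (le_max_left _ _)

/-- A negative value would persist at all higher energies, hence bound |f₀| from below on a
half-cylinder of infinite measure, against integrability. Only boundedness from below is wanted: it
gives the limit of the profile at infinity. -/
theorem profile_nonneg (h : IsMonotoneEquilibrium f₀ M₀ fhat) {E : ℝ} (hE : -M₀ ≤ E) :
    0 ≤ fhat E := by
  by_contra hneg
  push Not at hneg
  have h1 := h.stationary.integrable.measure_norm_ge_lt_top (neg_pos.2 hneg)
  obtain ⟨r, hr⟩ : ∃ r : ℝ, ∀ p, r ≤ p → E + M₀ ≤ p ^ 2 / 2 := by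
    refine ⟨E + M₀ + 1, fun p hp => ?_⟩
    nlinarith
  have h2 : univ ×ˢ Ici r ⊆ {z : ℝ × ℝ | -fhat E ≤ ‖f₀ z‖} := by
    rintro ⟨q, p⟩ ⟨-, hp⟩
    have h3 : E ≤ energy M₀ (q, p) := by
      have := hr p hp
      unfold energy
      nlinarith [Real.cos_le_one q, h.pos]
    have h4 := h.anti.antitoneOn hE (hE.trans h3) h3
    rw [mem_ofPred_eq, h.eq_energy, Real.norm_eq_abs]
    have := neg_abs_le (fhat (energy M₀ (q, p)))
    linarith
  have h5 := (measure_mono h2).trans_lt h1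
  rw [phaseMeasure, Measure.prod_prod] at h5
  have hpi := Real.pi_pos
  simp only [Measure.restrict_apply_univ, Real.volume_Ioc, Real.volume_Ici] at h5
  rw [ENNReal.mul_top] at h5
  · exact lt_irrefl _ h5
  · simp only [sub_neg_eq_add, ne_eq, ENNReal.ofReal_eq_zero, not_le]; linarith

theorem exists_tendsto (h : IsMonotoneEquilibrium f₀ M₀ fhat) : ∃ l, Tendsto fhat atTop (𝓝 l) := by
  have h1 : Antitone fun E => fhat (max E (-M₀)) := fun a b hab =>
    h.anti.antitoneOn (mem_Ici.2 (le_max_right _ _)) (mem_Ici.2 (le_max_right _ _))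
      (max_le_max_right _ hab)
  have h2 : BddBelow (range fun E => fhat (max E (-M₀))) :=
    ⟨0, by rintro _ ⟨E, rfl⟩; exact h.profile_nonneg (le_max_right _ _)⟩
  refine ⟨_, (tendsto_atTop_ciInf h1 h2).congr' ?_⟩
  filter_upwards [eventually_ge_atTop (-M₀)] with E hE
  rw [max_eq_left hE]

theorem hasDerivAt_snd (h : IsMonotoneEquilibrium f₀ M₀ fhat) (q : ℝ) {p : ℝ} (hp : p ≠ 0) :
    HasDerivAt (fun p => f₀ (q, p)) (p * deriv fhat (energy M₀ (q, p))) p := by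
  have h1 : HasDerivAt (fun p => energy M₀ (q, p)) p p := by
    refine ((((hasDerivAt_id p).pow 2).div_const 2).sub_const (M₀ * Real.cos q)).congr_deriv ?_
    simp
  have h2 := (h.differentiableAt (neg_lt_energy h.pos (z := (q, p)) hp)).hasDerivAt.comp p h1
  refine (h2.congr_deriv (mul_comm _ _)).congr_of_eventuallyEq (Eventually.of_forall fun p => ?_)
  exact h.eq_energy _

theorem hasDerivAt_fst (h : IsMonotoneEquilibrium f₀ M₀ fhat) (q : ℝ) {p : ℝ} (hp : p ≠ 0) :
    HasDerivAt (fun q => f₀ (q, p)) (M₀ * Real.sin q * deriv fhat (energy M₀ (q, p))) q := by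
  have h1 : HasDerivAt (fun q => energy M₀ (q, p)) (M₀ * Real.sin q) q := by
    refine (((Real.hasDerivAt_cos q).const_mul M₀).const_sub (p ^ 2 / 2)).congr_deriv ?_
    ring
  have h2 := (h.differentiableAt (neg_lt_energy h.pos (z := (q, p)) hp)).hasDerivAt.comp q h1
  refine (h2.congr_deriv (mul_comm _ _)).congr_of_eventuallyEq (Eventually.of_forall fun p => ?_)
  exact h.eq_energy _

end IsMonotoneEquilibrium

/-- The derivative `fhat'(E)` of the profile as a function on phase space. -/
def profileDeriv (M₀ : ℝ) (fhat : ℝ → ℝ) (z : ℝ × ℝ) : ℝ := deriv fhat (energy M₀ z)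

theorem measurable_profileDeriv (M₀ : ℝ) (fhat : ℝ → ℝ) : Measurable (profileDeriv M₀ fhat) :=
  (measurable_deriv fhat).comp (continuous_energy M₀).measurable

theorem profileDeriv_neg (M₀ : ℝ) (fhat : ℝ → ℝ) (z : ℝ × ℝ) :
    profileDeriv M₀ fhat (-z) = profileDeriv M₀ fhat z := by
  simp [profileDeriv, energy]

theorem profileDeriv_orbit (M₀ : ℝ) (fhat : ℝ → ℝ) (z : ℝ × ℝ) (t : ℝ) :
    profileDeriv M₀ fhat (orbit M₀ z t) = profileDeriv M₀ fhat z := by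
  simp [profileDeriv, energy_orbit]

namespace IsMonotoneEquilibrium

/-- The function is ∂ₚf₀. On p > 0 it has constant sign, so its absolute integral over p is f₀(q, 0)
minus the limit at infinity, which is continuous in q. -/
theorem integrable_snd_mul (h : IsMonotoneEquilibrium f₀ M₀ fhat) :
    Integrable (fun z => z.2 * profileDeriv M₀ fhat z) phaseMeasure := by
  set F : ℝ × ℝ → ℝ := fun z => z.2 * profileDeriv M₀ fhat z with hF
  have hFm : Measurable F := measurable_snd.mul (measurable_profileDeriv M₀ fhat)
  set F₁ := ({z : ℝ × ℝ | 0 < z.2}).indicator F with hF₁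
  have hA : MeasurableSet {z : ℝ × ℝ | 0 < z.2} := measurableSet_lt measurable_const measurable_snd
  obtain ⟨l, hl⟩ := h.exists_tendsto
  have hcont : Continuous f₀ := h.stationary.differentiable.continuous
  have hsec : ∀ q p, F₁ (q, p) = (Ioi (0 : ℝ)).indicator (fun p => F (q, p)) p := by
    intro q p; simp [hF₁, indicator]
  have hneg : ∀ q, ∀ p ∈ Ioi (0 : ℝ), F (q, p) ≤ 0 := fun q p hp =>
    mul_nonpos_of_nonneg_of_nonpos (le_of_lt hp)
      (h.deriv_nonpos (neg_lt_energy h.pos (z := (q, p)) (ne_of_gt hp)))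
  have htend : ∀ q, Tendsto (fun p => f₀ (q, p)) atTop (𝓝 l) := by
    intro q
    have h0 : Tendsto (fun p : ℝ => p ^ 2 / 2) atTop atTop :=
      (tendsto_pow_atTop two_ne_zero).atTop_div_const two_pos
    have h1 : Tendsto (fun p => energy M₀ (q, p)) atTop atTop := by
      simpa only [energy, sub_eq_add_neg] using
        tendsto_atTop_add_const_right atTop (-(M₀ * Real.cos q)) h0
    exact (hl.comp h1).congr fun p => (h.eq_energy _).symm
  have hcw : ∀ q, ContinuousWithinAt (fun p => f₀ (q, p)) (Ici 0) 0 := fun q =>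
    (hcont.comp (Continuous.prodMk_right q)).continuousWithinAt
  have hint : ∀ q, IntegrableOn (fun p => F (q, p)) (Ioi 0) := fun q =>
    integrableOn_Ioi_deriv_of_nonpos (hcw q)
      (fun p hp => h.hasDerivAt_snd q (ne_of_gt hp)) (hneg q) (htend q)
  have hval : ∀ q, ∫ p, ‖F₁ (q, p)‖ = f₀ (q, 0) - l := by
    intro q
    have h1 := integral_Ioi_of_hasDerivAt_of_nonpos (hcw q)
      (fun p hp => h.hasDerivAt_snd q (ne_of_gt hp)) (hneg q) (htend q)
    have h2 : ∀ p, ‖F₁ (q, p)‖ = (Ioi (0 : ℝ)).indicator (fun p => -F (q, p)) p := by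
      intro p
      rw [hsec]
      by_cases hp : p ∈ Ioi (0 : ℝ)
      · rw [indicator_of_mem hp, indicator_of_mem hp, Real.norm_eq_abs,
          abs_of_nonpos (hneg q p hp)]
      · rw [indicator_of_notMem hp, indicator_of_notMem hp, norm_zero]
    simp_rw [h2]
    rw [integral_indicator measurableSet_Ioi, integral_neg]
    have h3 : ∫ p in Ioi 0, F (q, p) = l - f₀ (q, 0) := h1
    rw [h3]; ring
  have hI : Integrable F₁ phaseMeasure := by
    rw [phaseMeasure, integrable_prod_iff (hFm.indicator hA).aestronglyMeasurable]
    refine ⟨Eventually.of_forall fun q => ?_, ?_⟩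
    · exact ((integrable_indicator_iff measurableSet_Ioi).2 (hint q)).congr
        (Eventually.of_forall fun p => (hsec q p).symm)
    · have : Continuous fun q => f₀ (q, 0) - l :=
        (hcont.comp (Continuous.prodMk_left 0)).sub continuous_const
      exact (this.integrableOn_Icc.mono_set Ioc_subset_Icc_self).congr
        (Eventually.of_forall fun q => (hval q).symm)
  have hI2 : Integrable (fun z => F₁ (-z)) phaseMeasure :=
    measurePreserving_neg_phaseMeasure.integrable_comp_of_integrable hI
  -- The function is odd under z ↦ -z, so it equals F₁(z) - F₁(-z).
  refine (hI.sub hI2).congr (Eventually.of_forall fun z => ?_)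
  simp only [Pi.sub_apply, hF₁, indicator, mem_ofPred_eq, Prod.snd_neg, hF, profileDeriv_neg]
  rcases lt_trichotomy z.2 0 with hz | hz | hz
  · simp [hz, not_lt.2 hz.le]
  · simp [hz]
  · simp [hz, not_lt.2 hz.le]

/-- For |p| > 1 the function is dominated by p f̂'(ℰ). The band |p| ≤ 1 has finite measure, and f̂'
is bounded there because f̂ is C¹ up to the endpoint -M₀. -/
theorem integrable_profileDeriv (h : IsMonotoneEquilibrium f₀ M₀ fhat) :
    Integrable (profileDeriv M₀ fhat) phaseMeasure := by
  -- On the band |p| ≤ 1 the energy is at most 1/2 + M₀.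
  obtain ⟨C, hC0, hC⟩ := h.exists_abs_deriv_le (1 / 2 + M₀)
  have hband : MeasurableSet {z : ℝ × ℝ | |z.2| ≤ 1} :=
    measurableSet_le measurable_snd.abs measurable_const
  have h1 : Integrable (({z : ℝ × ℝ | |z.2| ≤ 1}).indicator fun _ => C) phaseMeasure :=
    (integrable_indicator_iff hband).2 (integrableOn_const (measure_band_lt_top 1).ne)
  refine (h.integrable_snd_mul.norm.add h1).mono'
    (measurable_profileDeriv M₀ fhat).aestronglyMeasurable ?_
  filter_upwards [ae_snd_ne_zero] with z hz
  simp only [Pi.add_apply, norm_mul, Real.norm_eq_abs]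
  by_cases h2 : |z.2| ≤ 1
  · rw [indicator_of_mem (by exact h2)]
    have h3 : |profileDeriv M₀ fhat z| ≤ C := by
      refine hC _ ⟨neg_lt_energy h.pos hz, ?_⟩
      unfold energy
      have : z.2 ^ 2 ≤ 1 := by rw [← sq_abs]; nlinarith [abs_nonneg z.2]
      nlinarith [Real.neg_one_le_cos z.1, h.pos]
    have : 0 ≤ |z.2| * |profileDeriv M₀ fhat z| := by positivity
    linarith
  · rw [indicator_of_notMem (by exact h2), add_zero]
    nlinarith [abs_nonneg (profileDeriv M₀ fhat z), not_le.1 h2]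

theorem integrable_mul_profileDeriv (h : IsMonotoneEquilibrium f₀ M₀ fhat) {g : ℝ × ℝ → ℝ}
    (hg : Measurable g) {C : ℝ} (hb : ∀ z, |g z| ≤ C) :
    Integrable (fun z => g z * profileDeriv M₀ fhat z) phaseMeasure :=
  h.integrable_profileDeriv.bdd_mul hg.aestronglyMeasurable (Eventually.of_forall hb)

theorem deriv_snd_ae (h : IsMonotoneEquilibrium f₀ M₀ fhat) : ∀ᵐ z ∂phaseMeasure,
    deriv (fun p => f₀ (z.1, p)) z.2 = z.2 * profileDeriv M₀ fhat z := by
  filter_upwards [ae_snd_ne_zero] with z hz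
  exact (h.hasDerivAt_snd z.1 hz).deriv

theorem criterion_integrand_ae (h : IsMonotoneEquilibrium f₀ M₀ fhat) :
    (fun z : ℝ × ℝ => Real.cos z.1 ^ 2 * (1 / z.2 * deriv (fun p' : ℝ => f₀ (z.1, p')) z.2))
      =ᵐ[phaseMeasure] fun z => Real.cos z.1 ^ 2 * profileDeriv M₀ fhat z := by
  filter_upwards [ae_snd_ne_zero, h.deriv_snd_ae] with z hz h2
  rw [h2]; field_simp

theorem integrable_sq_mul (h : IsMonotoneEquilibrium f₀ M₀ fhat) {A : ℝ → ℝ} (hA : Continuous A)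
    (hb : ∀ q, |A q| ≤ 1) :
    Integrable (fun z => A z.1 ^ 2 * profileDeriv M₀ fhat z) phaseMeasure := by
  refine h.integrable_mul_profileDeriv (C := 1) ((hA.measurable.comp measurable_fst).pow_const 2)
    fun z => ?_
  rw [abs_pow]
  exact pow_le_one₀ (abs_nonneg _) (hb _)

theorem integral_criterion (h : IsMonotoneEquilibrium f₀ M₀ fhat) :
    ∫ q in (-Real.pi)..Real.pi, Real.cos q ^ 2 *
        ∫ p : ℝ, 1 / p * deriv (fun p' : ℝ => f₀ (q, p')) p
      = ∫ z, Real.cos z.1 ^ 2 * profileDeriv M₀ fhat z ∂phaseMeasure := by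
  rw [← integral_congr_ae h.criterion_integrand_ae, phaseMeasure, integral_prod,
    intervalIntegral.integral_of_le (by linarith [Real.pi_pos])]
  · simp_rw [integral_const_mul]
  · exact (h.integrable_sq_mul Real.continuous_cos Real.abs_cos_le_one).congr
      h.criterion_integrand_ae.symm

/-- Self-consistency in disguise: integrate M₀ = ∬ cos q f₀ by parts in q, use ∂_q f₀ = M₀ sin q
f̂'(ℰ), and cancel M₀ > 0. This identity is the source of D_y(0) = 0, the neutral direction of
rotations. -/
theorem integral_sin_sq (h : IsMonotoneEquilibrium f₀ M₀ fhat) :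
    ∫ z, Real.sin z.1 ^ 2 * profileDeriv M₀ fhat z ∂phaseMeasure = -1 := by
  have hcos : Integrable (fun z => Real.cos z.1 * f₀ z) phaseMeasure :=
    h.stationary.integrable.bdd_mul (c := 1)
      (Real.continuous_cos.measurable.comp measurable_fst).aestronglyMeasurable
      (Eventually.of_forall fun z => Real.abs_cos_le_one _)
  have h1 := h.orderX_eq
  have h2 := h.integrable_sq_mul Real.continuous_sin Real.abs_sin_le_one
  rw [orderX, phaseMeasure, integral_prod_symm _ hcos] at h1
  -- For p ≠ 0 the energy stays above -M₀, where the two-sided derivative of the profile is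
  -- continuous; p = 0 is a null set.
  have key : ∀ p : ℝ, p ≠ 0 → ∫ q in Ioc (-Real.pi) Real.pi, Real.cos q * f₀ (q, p)
      = -M₀ * ∫ q in Ioc (-Real.pi) Real.pi, Real.sin q ^ 2 * profileDeriv M₀ fhat (q, p) := by
    intro p hp
    have hle : -Real.pi ≤ Real.pi := by linarith [Real.pi_pos]
    rw [← intervalIntegral.integral_of_le hle, ← intervalIntegral.integral_of_le hle]
    have hc : Continuous fun q => M₀ * Real.sin q * deriv fhat (energy M₀ (q, p)) := by
      refine (by fun_prop : Continuous fun q => M₀ * Real.sin q).mul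
        (continuous_iff_continuousAt.2 fun q => ?_)
      exact (h.continuousAt_deriv (neg_lt_energy h.pos (z := (q, p)) hp)).comp
        (f := fun q => energy M₀ (q, p))
        ((continuous_energy M₀).comp (Continuous.prodMk_left p)).continuousAt
    have h3 := intervalIntegral.integral_mul_deriv_eq_deriv_mul (a := -Real.pi) (b := Real.pi)
      (fun q _ => h.hasDerivAt_fst q hp) (fun q _ => Real.hasDerivAt_sin q)
      (hc.intervalIntegrable _ _) (Real.continuous_cos.intervalIntegrable _ _)
    simp only [Real.sin_neg, Real.sin_pi, neg_zero, mul_zero, sub_zero, zero_sub] at h3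
    simp_rw [mul_comm (Real.cos _)]
    rw [h3, ← intervalIntegral.integral_neg, ← intervalIntegral.integral_const_mul]
    refine intervalIntegral.integral_congr fun q _ => ?_
    simp only [profileDeriv]; ring
  have hae : ∀ᵐ p ∂(volume : Measure ℝ), p ≠ 0 := by simp [ae_iff]
  rw [integral_congr_ae (hae.mono key), integral_const_mul] at h1
  rw [phaseMeasure, integral_prod_symm _ h2]
  have := h.pos
  set I := ∫ p : ℝ, ∫ q in Ioc (-Real.pi) Real.pi, Real.sin q ^ 2 * profileDeriv M₀ fhat (q, p)
  have h4 : M₀ * (I + 1) = 0 := by linarith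
  have := (mul_eq_zero.1 h4).resolve_left this.ne'
  linarith

end IsMonotoneEquilibrium

/-! ### Phase-space integrals in angle-action coordinates -/

theorem integrable_comp_angleOrbit (hM₀ : 0 < M₀) {E : Type*} [NormedAddCommGroup E]
    {F : ℝ × ℝ → E} (hF : Integrable F phaseMeasure) (i : Region) :
    Integrable (fun x => F (angleOrbit M₀ i x)) ((actionMeasure M₀ i).prod angleMeasure) := by
  have h1 : ((actionMeasure M₀ i).prod angleMeasure).map (angleOrbit M₀ i) ≤ phaseMeasure := by
    conv_rhs => rw [phaseMeasure_eq_sum_map hM₀]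
    exact Finset.single_le_sum (f := fun i => ((actionMeasure M₀ i).prod angleMeasure).map
      (angleOrbit M₀ i)) (fun _ _ => Measure.zero_le _) (Finset.mem_univ i)
  exact (hF.mono_measure h1).comp_measurable (measurable_angleOrbit M₀ i)

theorem integral_phaseMeasure (hM₀ : 0 < M₀) {E : Type*} [NormedAddCommGroup E] [NormedSpace ℝ E]
    {F : ℝ × ℝ → E} (hF : Integrable F phaseMeasure) :
    ∫ z, F z ∂phaseMeasure
      = ∑ i, ∫ x, F (angleOrbit M₀ i x) ∂(actionMeasure M₀ i).prod angleMeasure := by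
  have hsum := phaseMeasure_eq_sum_map hM₀
  have h1 : ∀ i, ((actionMeasure M₀ i).prod angleMeasure).map (angleOrbit M₀ i) ≤ phaseMeasure := by
    intro i
    conv_rhs => rw [hsum]
    exact Finset.single_le_sum (f := fun i => ((actionMeasure M₀ i).prod angleMeasure).map
      (angleOrbit M₀ i)) (fun _ _ => Measure.zero_le _) (Finset.mem_univ i)
  conv_lhs => rw [hsum]
  rw [integral_finsetSum_measure fun i _ => hF.mono_measure (h1 i)]
  refine Finset.sum_congr rfl fun i _ => ?_
  exact integral_map (measurable_angleOrbit M₀ i).aemeasurable (hF.mono_measure (h1 i)).1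

theorem energy_angleOrbit (hM₀ : 0 < M₀) {i : Region} {E : ℝ} (hE : E ∈ energyRange M₀ i) (θ : ℝ) :
    energy M₀ (angleOrbit M₀ i (E, θ)) = E := by
  rw [angleOrbit, energy_orbit, energy_basePoint hM₀ hE]

theorem ae_prod_mem_energyRange (M₀ : ℝ) (i : Region) :
    ∀ᵐ x ∂(actionMeasure M₀ i).prod angleMeasure, x.1 ∈ energyRange M₀ i :=
  Measure.quasiMeasurePreserving_fst.ae (ae_mem_energyRange M₀ i)

/-- In angle-action coordinates f̂'(ℰ) does not depend on the angle, so integrability in (E, θ)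
descends to E. -/
theorem IsMonotoneEquilibrium.integrable_deriv (h : IsMonotoneEquilibrium f₀ M₀ fhat) (i : Region) :
    Integrable (deriv fhat) (actionMeasure M₀ i) := by
  have hpi := Real.pi_pos
  have h1 := integrable_comp_angleOrbit h.pos h.integrable_profileDeriv i
  have h2 : Integrable (fun x : ℝ × ℝ => deriv fhat x.1)
      ((actionMeasure M₀ i).prod angleMeasure) := by
    refine h1.congr ?_
    filter_upwards [ae_prod_mem_energyRange M₀ i] with x hx
    rw [profileDeriv, energy_angleOrbit h.pos hx]
  have h3 := h2.integral_prod_left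
  simp only [integral_const, smul_eq_mul] at h3
  have h4 : angleMeasure.real univ ≠ 0 := by
    rw [measureReal_restrict_apply_univ, Real.volume_real_Ioc_of_le (by linarith)]
    linarith
  exact (integrable_const_mul_iff (IsUnit.mk0 _ h4) _).1 h3

end

section

/-! ### The flow on the cylinder -/

/-- The translate of a point of the plane to the fundamental domain `(-π, π] × ℝ`. -/
def wrap (z : ℝ × ℝ) : ℝ × ℝ :=
  z + (((-⌈(z.1 - Real.pi) / (2 * Real.pi)⌉ : ℤ) : ℝ) * (2 * Real.pi), 0)

theorem measurable_wrap : Measurable wrap := by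
  unfold wrap
  refine measurable_id.add (Measurable.prodMk (Measurable.mul_const ?_ _) measurable_const)
  have h : Measurable fun z : ℝ × ℝ => ⌈(z.1 - Real.pi) / (2 * Real.pi)⌉ :=
    Int.measurable_ceil.comp ((measurable_fst.sub_const _).div_const _)
  exact (measurable_from_top (f := fun n : ℤ => ((-n : ℤ) : ℝ))).comp h

theorem wrap_eq_of_mem {z : ℝ × ℝ} {n : ℤ}
    (h : z.1 + n * (2 * Real.pi) ∈ Ioc (-Real.pi) Real.pi) :
    wrap z = z + (n * (2 * Real.pi), 0) := by
  have hpi := Real.pi_pos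
  have h1 : ⌈(z.1 - Real.pi) / (2 * Real.pi)⌉ = -n := by
    rw [Int.ceil_eq_iff]
    push_cast
    constructor
    · rw [lt_div_iff₀ (by positivity)]; nlinarith [h.1]
    · rw [div_le_iff₀ (by positivity)]; nlinarith [h.2]
  rw [wrap, h1, neg_neg]

theorem wrap_fst_mem (z : ℝ × ℝ) : (wrap z).1 ∈ Ioc (-Real.pi) Real.pi := by
  have hpi := Real.pi_pos
  have h1 := Int.le_ceil ((z.1 - Real.pi) / (2 * Real.pi))
  have h2 := Int.ceil_lt_add_one ((z.1 - Real.pi) / (2 * Real.pi))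
  rw [div_le_iff₀ (by positivity)] at h1
  rw [← sub_lt_iff_lt_add, lt_div_iff₀ (by positivity)] at h2
  simp only [wrap, Prod.fst_add, mem_Ioc]
  push_cast
  constructor <;> linarith

theorem wrap_snd (z : ℝ × ℝ) : (wrap z).2 = z.2 := by simp [wrap]

theorem exists_wrap_eq (z : ℝ × ℝ) : ∃ n : ℤ, wrap z = z + ((n : ℝ) * (2 * Real.pi), 0) :=
  ⟨_, rfl⟩

theorem wrap_add_int_mul (z : ℝ × ℝ) (n : ℤ) :
    wrap (z + ((n : ℝ) * (2 * Real.pi), 0)) = wrap z := by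
  obtain ⟨m, hm⟩ := exists_wrap_eq z
  have h := wrap_fst_mem z
  rw [hm] at h ⊢
  have h2 := wrap_eq_of_mem (z := z + ((n : ℝ) * (2 * Real.pi), 0)) (n := m - n) (by
    convert h using 1
    simp only [Prod.fst_add]; push_cast; ring)
  rw [h2]
  ext <;> simp
  ring

theorem wrap_ae_eq : ∀ᵐ z ∂phaseMeasure, wrap z = z := by
  have h : ∀ᵐ q ∂(volume.restrict (Ioc (-Real.pi) Real.pi)), q ∈ Ioc (-Real.pi) Real.pi :=
    ae_restrict_mem measurableSet_Ioc
  have h2 := (Measure.quasiMeasurePreserving_fst (ν := (volume : Measure ℝ))).ae h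
  filter_upwards [h2] with z hz
  rw [wrap_eq_of_mem (z := z) (n := 0) (by simpa using hz)]
  ext <;> simp

theorem comp_wrap {α : Type*} {φ : ℝ × ℝ → α} (hφ : ∀ q p, φ (q + 2 * Real.pi, p) = φ (q, p))
    (z : ℝ × ℝ) : φ (wrap z) = φ z := by
  obtain ⟨n, hn⟩ := exists_wrap_eq z
  have h : Function.Periodic (fun q => φ (q, z.2)) (2 * Real.pi) := fun q => hφ q z.2
  calc φ (wrap z) = φ (z.1 + n * (2 * Real.pi), z.2) := by
        rw [hn]; congr 1; ext <;> simp
    _ = φ z := h.int_mul n z.1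

/-- The time-`t` map of the flow on the cylinder. -/
def cylinderFlow (M₀ t : ℝ) (z : ℝ × ℝ) : ℝ × ℝ := wrap (orbit M₀ z t)

theorem cylinderFlow_cylinderFlow (M₀ s t : ℝ) (z : ℝ × ℝ) :
    cylinderFlow M₀ t (cylinderFlow M₀ s z) = cylinderFlow M₀ (s + t) z := by
  obtain ⟨n, hn⟩ := exists_wrap_eq (orbit M₀ z s)
  rw [cylinderFlow, cylinderFlow, hn, orbit_add_int_mul, wrap_add_int_mul, orbit_orbit,
    cylinderFlow]

theorem measurable_cylinderFlow_comp {X : Type*} [MeasurableSpace X] {M₀ : ℝ} {f : X → ℝ × ℝ}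
    {g : X → ℝ} (hf : Measurable f) (hg : Measurable g) :
    Measurable fun x => cylinderFlow M₀ (g x) (f x) :=
  measurable_wrap.comp (measurable_orbit_comp hf hg)

theorem lintegral_comp_add_of_periodic {g : ℝ → ENNReal} (hg : Measurable g)
    (hp : Function.Periodic g (2 * Real.pi)) (c : ℝ) :
    ∫⁻ θ, g (θ + c) ∂angleMeasure = ∫⁻ θ, g θ ∂angleMeasure := by
  have hpi := Real.pi_pos
  have h1 := (measurePreserving_add_right volume c).setLIntegral_comp_preimage
    (measurableSet_Ioc (a := -Real.pi + c) (b := -Real.pi + c + 2 * Real.pi)) hg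
  have h2 : (fun x => x + c) ⁻¹' Ioc (-Real.pi + c) (-Real.pi + c + 2 * Real.pi)
      = Ioc (-Real.pi) Real.pi := by
    ext x; simp only [mem_preimage, mem_Ioc]
    constructor <;> rintro ⟨h, h'⟩ <;> constructor <;> linarith
  rw [h2] at h1
  have hinv : ∀ (n : AddSubgroup.zmultiples (2 * Real.pi)) (x : ℝ), g (n +ᵥ x) = g x := by
    rintro ⟨_, n, rfl⟩ x
    have h3 := hp.zsmul n x
    rw [add_comm] at h3
    exact h3
  rw [h1, (isAddFundamentalDomain_Ioc (show 0 < 2 * Real.pi by positivity)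
    (-Real.pi + c) volume).setLIntegral_eq (isAddFundamentalDomain_Ioc (by positivity) (-Real.pi)
      volume) g hinv]
  congr 3
  ring

variable {M₀ : ℝ}

theorem angleOrbit_add_two_pi (hM₀ : 0 < M₀) {i : Region} {E : ℝ} (hE : E ∈ energyRange M₀ i)
    (θ : ℝ) : angleOrbit M₀ i (E, θ + 2 * Real.pi)
      = angleOrbit M₀ i (E, θ) + (winding i * (2 * Real.pi), 0) := by
  have hpi := Real.pi_pos
  simp only [angleOrbit]
  rw [← orbit_add_period hM₀ hE]
  congr 1
  field_simp

theorem orbit_angleOrbit (hM₀ : 0 < M₀) {i : Region} {E : ℝ} (hE : E ∈ energyRange M₀ i)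
    (θ t : ℝ) : orbit M₀ (angleOrbit M₀ i (E, θ)) t
      = angleOrbit M₀ i (E, θ + (period M₀ i E / (2 * Real.pi))⁻¹ * t) := by
  have hpi := Real.pi_pos
  have hT := period_pos hM₀ hE
  simp only [angleOrbit]
  rw [orbit_orbit]
  congr 1
  field_simp

/-- Liouville's theorem: in angle-action coordinates the flow is the rotation θ ↦ θ + Ωt on each
orbit, which preserves integrals of 2π-periodic functions. Wrapping makes the integrand periodic
also on rotating orbits, where q gains ±2π per turn. -/
theorem measurePreserving_cylinderFlow (hM₀ : 0 < M₀) (t : ℝ) :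
    MeasurePreserving (cylinderFlow M₀ t) phaseMeasure phaseMeasure := by
  have hm : Measurable (cylinderFlow M₀ t) :=
    measurable_cylinderFlow_comp measurable_id measurable_const
  refine ⟨hm, Measure.ext_of_lintegral _ fun G hG => ?_⟩
  have h0 : ∫⁻ z, G z ∂phaseMeasure = ∫⁻ z, G (wrap z) ∂phaseMeasure :=
    lintegral_congr_ae (wrap_ae_eq.mono fun z hz => by simp only [hz])
  have hform : ∀ F : ℝ × ℝ → ENNReal, Measurable F → ∫⁻ z, F z ∂phaseMeasure
      = ∑ i, ∫⁻ E, ∫⁻ θ, F (angleOrbit M₀ i (E, θ)) ∂angleMeasure ∂actionMeasure M₀ i := by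
    intro F hF
    conv_lhs => rw [phaseMeasure_eq_sum_map hM₀]
    rw [lintegral_finsetSum_measure]
    refine Finset.sum_congr rfl fun i _ => ?_
    rw [lintegral_map hF (measurable_angleOrbit M₀ i),
      lintegral_prod (fun x => F (angleOrbit M₀ i x))
        (hF.comp (measurable_angleOrbit M₀ i)).aemeasurable]
  rw [lintegral_map hG hm, h0, hform (fun z => G (cylinderFlow M₀ t z)) (hG.comp hm),
    hform (fun z => G (wrap z)) (hG.comp measurable_wrap)]
  refine Finset.sum_congr rfl fun i _ => lintegral_congr_ae ?_
  filter_upwards [ae_mem_energyRange M₀ i] with E hE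
  have hper : Function.Periodic (fun θ => G (wrap (angleOrbit M₀ i (E, θ)))) (2 * Real.pi) := by
    intro θ
    simp only
    rw [angleOrbit_add_two_pi hM₀ hE, wrap_add_int_mul]
  have hgm : Measurable fun θ => G (wrap (angleOrbit M₀ i (E, θ))) :=
    hG.comp (measurable_wrap.comp ((measurable_angleOrbit M₀ i).comp measurable_prodMk_left))
  rw [← lintegral_comp_add_of_periodic hgm hper ((period M₀ i E / (2 * Real.pi))⁻¹ * t)]
  refine lintegral_congr fun θ => ?_
  rw [cylinderFlow, orbit_angleOrbit hM₀ hE]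

theorem integral_comp_cylinderFlow (hM₀ : 0 < M₀) (t : ℝ) {E : Type*} [NormedAddCommGroup E]
    [NormedSpace ℝ E] {F : ℝ × ℝ → E} (hF : AEStronglyMeasurable F phaseMeasure) :
    ∫ z, F (cylinderFlow M₀ t z) ∂phaseMeasure = ∫ z, F z ∂phaseMeasure := by
  have h := measurePreserving_cylinderFlow hM₀ t
  conv_rhs => rw [← h.map_eq]
  rw [integral_map h.measurable.aemeasurable (by rwa [h.map_eq])]

/-! ### Test functions -/

namespace IsTestFunction

variable {φ : ℝ × ℝ → ℂ}

/-- Smoothness of the flow keeps φ ∘ (flow) C¹, equivariance keeps it periodic, and energy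
conservation keeps its momentum support bounded. -/
theorem comp_orbit (hM₀ : 0 < M₀) (hφ : IsTestFunction φ) {t : ℝ} (ht : 0 ≤ t) :
    IsTestFunction fun z => φ (orbit M₀ z t) := by
  refine ⟨hφ.contDiff.comp (contDiff_orbit M₀ ht), fun q p => ?_, ?_⟩
  · have h := orbit_add_int_mul M₀ (q, p) 1 t
    simp only [Int.cast_one, one_mul, Prod.mk_add_mk, add_zero] at h
    rw [h, ← Prod.mk.eta (p := orbit M₀ (q, p) t), Prod.mk_add_mk, add_zero]
    exact hφ.periodic _ _
  · obtain ⟨r, hr⟩ := hφ.support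
    refine ⟨r + 2 * Real.sqrt M₀, fun q p hp => ?_⟩
    have h := abs_snd_orbit_le hM₀ (q, p) t
    have h' : r ≤ |(orbit M₀ (q, p) t).2| := by simp only at h; linarith
    exact hr _ _ h'

end IsTestFunction

theorem exists_norm_le_of_periodic {ψ : ℝ × ℝ → ℂ} (hc : Continuous ψ)
    (hp : ∀ q p, ψ (q + 2 * Real.pi, p) = ψ (q, p)) {r : ℝ}
    (hr : ∀ q p, r ≤ |p| → ψ (q, p) = 0) : ∃ C, 0 ≤ C ∧ ∀ z, ‖ψ z‖ ≤ C := by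
  obtain ⟨C, hC⟩ := (isCompact_Icc.prod isCompact_Icc :
    IsCompact (Icc (-Real.pi) Real.pi ×ˢ Icc (-r) r)).exists_bound_of_continuousOn hc.continuousOn
  refine ⟨max C 0, le_max_right _ _, fun z => ?_⟩
  rw [← comp_wrap hp]
  by_cases h : r ≤ |z.2|
  · have : ψ (wrap z) = 0 := hr _ _ (by simpa [wrap_snd] using h)
    rw [this, norm_zero]; exact le_max_right _ _
  · refine (hC _ ⟨Ioc_subset_Icc_self (wrap_fst_mem z), ?_⟩).trans (le_max_left _ _)
    rw [wrap_snd]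
    exact abs_le.1 (not_le.1 h).le

/-- The transport derivative `{H, φ}` of a function along the Hamiltonian flow. -/
def transport (M₀ : ℝ) (φ : ℝ × ℝ → ℂ) (z : ℝ × ℝ) : ℂ := fderiv ℝ φ z (hamiltonField M₀ z)

theorem poisson_energy {φ : ℝ × ℝ → ℂ} (hφ : ContDiff ℝ 1 φ) (z : ℝ × ℝ) :
    poisson (fun w => ((energy M₀ w : ℝ) : ℂ)) φ z = transport M₀ φ z := by
  have hd : HasFDerivAt φ (fderiv ℝ φ z) z := (hφ.differentiable one_ne_zero z).hasFDerivAt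
  have h1 : HasDerivAt (fun q => φ (q, z.2)) (fderiv ℝ φ z (1, 0)) z.1 :=
    HasFDerivAt.comp_hasDerivAt (f := fun q => (q, z.2)) z.1 hd
      ((hasDerivAt_id z.1).prodMk (hasDerivAt_const _ _))
  have h2 : HasDerivAt (fun p => φ (z.1, p)) (fderiv ℝ φ z (0, 1)) z.2 :=
    HasFDerivAt.comp_hasDerivAt (f := fun p => (z.1, p)) z.2 hd
      ((hasDerivAt_const _ _).prodMk (hasDerivAt_id z.2))
  have h3 : HasDerivAt (fun p : ℝ => ((energy M₀ (z.1, p) : ℝ) : ℂ)) (z.2 : ℂ) z.2 := by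
    refine HasDerivAt.ofReal_comp ?_
    refine ((((hasDerivAt_id z.2).pow 2).div_const 2).sub_const (M₀ * Real.cos z.1)).congr_deriv ?_
    simp
  have h4 : HasDerivAt (fun q : ℝ => ((energy M₀ (q, z.2) : ℝ) : ℂ))
      ((M₀ * Real.sin z.1 : ℝ) : ℂ) z.1 := by
    refine HasDerivAt.ofReal_comp ?_
    refine (((Real.hasDerivAt_cos z.1).const_mul M₀).const_sub (z.2 ^ 2 / 2)).congr_deriv ?_
    ring
  rw [poisson, h1.deriv, h2.deriv, h3.deriv, h4.deriv, transport]
  have h5 : hamiltonField M₀ z = z.2 • ((1, 0) : ℝ × ℝ) + (-(M₀ * Real.sin z.1)) • (0, 1) := by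
    ext <;> simp [hamiltonField]
  rw [h5, map_add, map_smul, map_smul, Complex.real_smul, Complex.real_smul]
  push_cast
  ring

theorem hasDerivAt_comp_orbit {φ : ℝ × ℝ → ℂ} (hφ : ContDiff ℝ 1 φ) (z : ℝ × ℝ) (t : ℝ) :
    HasDerivAt (fun t => φ (orbit M₀ z t)) (transport M₀ φ (orbit M₀ z t)) t :=
  ((hφ.differentiable one_ne_zero _).hasFDerivAt).comp_hasDerivAt t (hasDerivAt_orbit M₀ z t)

/-- The transport derivative commutes with the flow that generates it: differentiate τ ↦ φ(orbit at
time τ + t) at τ = 0 in two ways. -/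
theorem transport_comp_orbit {φ : ℝ × ℝ → ℂ} (hφ : ContDiff ℝ 1 φ) (z : ℝ × ℝ) {t : ℝ}
    (ht : 0 ≤ t) : transport M₀ (fun z => φ (orbit M₀ z t)) z = transport M₀ φ (orbit M₀ z t) := by
  have h1 := hasDerivAt_comp_orbit (M₀ := M₀) (hφ.comp (contDiff_orbit M₀ ht)) z 0
  have h2 : HasDerivAt (fun τ => φ (orbit M₀ z (τ + t))) (transport M₀ φ (orbit M₀ z (0 + t))) 0 :=
    (hasDerivAt_comp_orbit (M₀ := M₀) hφ z (0 + t)).comp_add_const 0 t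
  have h3 : (fun τ => (φ ∘ fun z => orbit M₀ z t) (orbit M₀ z τ))
      = fun τ => φ (orbit M₀ z (τ + t)) := by
    funext τ
    rw [Function.comp_apply, orbit_orbit]
  rw [h3, orbit_zero] at h1
  have := h1.unique h2
  rw [zero_add] at this
  exact this

theorem continuous_transport {φ : ℝ × ℝ → ℂ} (hφ : ContDiff ℝ 1 φ) :
    Continuous (transport M₀ φ) := by
  have h1 := hφ.continuous_fderiv one_ne_zero
  have h2 : Continuous (hamiltonField M₀) := (hamiltonField_lipschitz M₀).continuous
  exact h1.clm_apply h2

theorem transport_periodic {φ : ℝ × ℝ → ℂ} (hφ : IsTestFunction φ) (q p : ℝ) :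
    transport M₀ φ (q + 2 * Real.pi, p) = transport M₀ φ (q, p) := by
  have h1 : (fun z : ℝ × ℝ => φ (z + (2 * Real.pi, 0))) = φ := by
    funext z
    rw [← Prod.mk.eta (p := z), Prod.mk_add_mk, add_zero]
    exact hφ.periodic _ _
  have h2 := fderiv_comp_add_right (𝕜 := ℝ) (f := φ) (x := (q, p)) (2 * Real.pi, 0)
  rw [h1, Prod.mk_add_mk, add_zero] at h2
  rw [transport, transport, h2]
  simp [hamiltonField]

theorem exists_norm_transport_le {φ : ℝ × ℝ → ℂ} (hφ : IsTestFunction φ) :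
    ∃ C, 0 ≤ C ∧ ∀ z, ‖transport M₀ φ z‖ ≤ C := by
  obtain ⟨r, hr⟩ := hφ.support
  refine exists_norm_le_of_periodic (r := r + 1) (continuous_transport hφ.contDiff)
    (transport_periodic hφ) fun q p hp => ?_
  have h1 : φ =ᶠ[𝓝 (q, p)] fun _ => 0 := by
    have h2 : ∀ᶠ z : ℝ × ℝ in 𝓝 (q, p), r < |z.2| :=
      (continuous_snd.abs).continuousAt.eventually (lt_mem_nhds (show r < |p| by linarith))
    filter_upwards [h2] with z hz
    exact hr z.1 z.2 hz.le
  rw [transport, h1.fderiv_eq]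
  simp

theorem IsTestFunction.exists_norm_le {φ : ℝ × ℝ → ℂ} (hφ : IsTestFunction φ) :
    ∃ C, 0 ≤ C ∧ ∀ z, ‖φ z‖ ≤ C := by
  obtain ⟨r, hr⟩ := hφ.support
  exact exists_norm_le_of_periodic hφ.contDiff.continuous hφ.periodic hr

/-- The periodic extension of a bump supported in the open strip is smooth across q = ±π. It
supplies enough test functions for the uniqueness lemma below. -/
theorem isTestFunction_comp_wrap {g : ℝ × ℝ → ℝ} (hg : ContDiff ℝ 1 g) (hc : HasCompactSupport g)
    (hs : tsupport g ⊆ Ioo (-Real.pi) Real.pi ×ˢ univ) :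
    IsTestFunction fun z => ((g (wrap z) : ℝ) : ℂ) := by
  have hpi := Real.pi_pos
  have hzero : ∀ z : ℝ × ℝ, z.1 ∉ Ioo (-Real.pi) Real.pi → g z = 0 := fun z hz =>
    image_eq_zero_of_notMem_tsupport fun h => hz (hs h).1
  refine ⟨?_, fun q p => ?_, ?_⟩
  · refine Complex.ofRealCLM.contDiff.comp (contDiff_iff_contDiffAt.2 fun z₀ => ?_)
    obtain ⟨n, hn⟩ := exists_wrap_eq z₀
    have hmem := wrap_fst_mem z₀
    rw [hn] at hmem
    simp only [Prod.fst_add, mem_Ioc] at hmem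
    -- Near z₀ the translated position lies in (-π, 3π), so only the translates by n and n - 1 can
    -- meet the support, and at most one of them is nonzero at a given point.
    have hev : (fun z => g (wrap z)) =ᶠ[𝓝 z₀] fun z => g (z + ((n : ℝ) * (2 * Real.pi), 0))
        + g (z + (((n - 1 : ℤ) : ℝ) * (2 * Real.pi), 0)) := by
      have hopen : ∀ᶠ z : ℝ × ℝ in 𝓝 z₀,
          z.1 + n * (2 * Real.pi) ∈ Ioo (-Real.pi) (3 * Real.pi) := by
        have hlt : z₀.1 + n * (2 * Real.pi) < 3 * Real.pi := by linarith [hmem.2]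
        exact (continuous_fst.add continuous_const).continuousAt.eventually
          (Ioo_mem_nhds hmem.1 hlt)
      filter_upwards [hopen] with z hz
      by_cases h : z.1 + n * (2 * Real.pi) ≤ Real.pi
      · rw [wrap_eq_of_mem (n := n) ⟨hz.1, h⟩, hzero (z + (((n - 1 : ℤ) : ℝ) * (2 * Real.pi), 0)),
          add_zero]
        simp only [Prod.fst_add, mem_Ioo, not_and_or, not_lt]
        left; push_cast; linarith
      · rw [wrap_eq_of_mem (z := z) (n := n - 1), hzero (z + ((n : ℝ) * (2 * Real.pi), 0)), zero_add]
        · simp only [Prod.fst_add, mem_Ioo, not_and_or, not_lt]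
          right; linarith
        · push_cast
          constructor <;> linarith [hz.2]
    refine ContDiffAt.congr_of_eventuallyEq ?_ hev
    exact ((hg.comp (contDiff_id.add contDiff_const)).add
      (hg.comp (contDiff_id.add contDiff_const))).contDiffAt
  · have h := wrap_add_int_mul (q, p) 1
    simp only [Int.cast_one, one_mul, Prod.mk_add_mk, add_zero] at h
    rw [h]
  · obtain ⟨r, hr⟩ := hc.isCompact.isBounded.subset_closedBall 0
    refine ⟨r + 1, fun q p hp => ?_⟩
    have : g (wrap (q, p)) = 0 := by
      refine image_eq_zero_of_notMem_tsupport fun h => ?_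
      have h1 := mem_closedBall_zero_iff.1 (hr h)
      have h2 := (norm_snd_le (wrap (q, p))).trans h1
      rw [wrap_snd, Real.norm_eq_abs] at h2
      simp only at h2
      linarith
    rw [this, Complex.ofReal_zero]

/-- The seam q = π is null, so bumps supported in the open strip already detect f. -/
theorem ae_eq_zero_of_forall_testFunction {f : ℝ × ℝ → ℂ} (hf : Integrable f phaseMeasure)
    (h : ∀ φ, IsTestFunction φ → ∫ z, f z * φ z ∂phaseMeasure = 0) : f =ᵐ[phaseMeasure] 0 := by
  have hU : IsOpen (Ioo (-Real.pi) Real.pi ×ˢ (univ : Set ℝ)) := isOpen_Ioo.prod isOpen_univ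
  have h1 := hU.ae_eq_zero_of_integral_contDiff_smul_eq_zero (μ := phaseMeasure) (f := f)
    (hf.locallyIntegrable.locallyIntegrableOn _) (fun g hg hc hs => by
      rw [← h _ (isTestFunction_comp_wrap (hg.of_le (by exact_mod_cast le_top)) hc hs)]
      refine integral_congr_ae (wrap_ae_eq.mono fun z hz => ?_)
      simp only [hz, Complex.real_smul, mul_comm])
  have h2 : ∀ᵐ z ∂phaseMeasure, z ∈ Ioo (-Real.pi) Real.pi ×ˢ (univ : Set ℝ) := by
    have h3 : ∀ᵐ q ∂(volume.restrict (Ioc (-Real.pi) Real.pi)), q ∈ Ioo (-Real.pi) Real.pi := by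
      rw [← Measure.restrict_congr_set (Ioo_ae_eq_Ioc (μ := volume))]
      exact ae_restrict_mem measurableSet_Ioo
    have h4 := (Measure.quasiMeasurePreserving_fst (ν := (volume : Measure ℝ))).ae h3
    filter_upwards [h4] with z hz
    exact ⟨hz, mem_univ _⟩
  filter_upwards [h1, h2] with z h3 h4 using h3 h4

end

section

/-! ### The resolvent of the free transport operator -/

variable {M₀ : ℝ} {s : ℂ}

/-- The measure `dt` on `(0, ∞)`. -/
abbrev timeMeasure : Measure ℝ := volume.restrict (Ioi 0)

theorem integrable_exp_mul (hs : 0 < s.re) :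
    Integrable (fun t : ℝ => Complex.exp (-s * t)) timeMeasure :=
  integrableOn_exp_mul_complex_Ioi (by simpa using hs) 0

theorem integrable_mul_comp_flow (hM₀ : 0 < M₀) (hs : 0 < s.re) {g : ℝ × ℝ → ℂ}
    (hgm : Measurable g) (hg : Integrable g phaseMeasure) :
    Integrable (fun x : ℝ × (ℝ × ℝ) => Complex.exp (-s * x.1) * g (cylinderFlow M₀ (-x.1) x.2))
      (timeMeasure.prod phaseMeasure) := by
  have hm : Measurable fun x : ℝ × (ℝ × ℝ) =>
      Complex.exp (-s * x.1) * g (cylinderFlow M₀ (-x.1) x.2) :=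
    (by fun_prop : Measurable fun x : ℝ × (ℝ × ℝ) => Complex.exp (-s * x.1)).mul
      (hgm.comp (measurable_cylinderFlow_comp measurable_snd measurable_fst.neg))
  rw [integrable_prod_iff hm.aestronglyMeasurable]
  refine ⟨Eventually.of_forall fun t => ?_, ?_⟩
  · have h : Integrable (fun z => g (cylinderFlow M₀ (-t) z)) phaseMeasure :=
      (measurePreserving_cylinderFlow hM₀ (-t)).integrable_comp_of_integrable hg
    exact h.const_mul (Complex.exp (-s * t))
  · simp only [norm_mul, integral_const_mul]
    have : ∀ t : ℝ, ∫ z, ‖g (cylinderFlow M₀ (-t) z)‖ ∂phaseMeasure = ∫ z, ‖g z‖ ∂phaseMeasure :=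
      fun t => integral_comp_cylinderFlow hM₀ (-t) hg.norm.1
    simp only [this]
    exact (integrable_exp_mul hs).norm.mul_const _

/-- `(s - T)⁻¹ g`, where `T` is the generator of the transport along the flow. -/
def transportResolventFun (M₀ : ℝ) (s : ℂ) (g : ℝ × ℝ → ℂ) (z : ℝ × ℝ) : ℂ :=
  ∫ t, Complex.exp (-s * t) * g (cylinderFlow M₀ (-t) z) ∂timeMeasure

theorem integrable_transportResolventFun (hM₀ : 0 < M₀) (hs : 0 < s.re) {g : ℝ × ℝ → ℂ}
    (hgm : Measurable g) (hg : Integrable g phaseMeasure) :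
    Integrable (transportResolventFun M₀ s g) phaseMeasure :=
  (integrable_mul_comp_flow hM₀ hs hgm hg).integral_prod_right

theorem integral_norm_transportResolventFun_le (hM₀ : 0 < M₀) (hs : 0 < s.re) {g : ℝ × ℝ → ℂ}
    (hgm : Measurable g) (hg : Integrable g phaseMeasure) :
    ∫ z, ‖transportResolventFun M₀ s g z‖ ∂phaseMeasure
      ≤ (∫ t : ℝ, ‖Complex.exp (-s * t)‖ ∂timeMeasure) * ∫ z, ‖g z‖ ∂phaseMeasure := by
  have h := integrable_mul_comp_flow hM₀ hs hgm hg
  calc ∫ z, ‖transportResolventFun M₀ s g z‖ ∂phaseMeasure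
      ≤ ∫ z, ∫ t, ‖Complex.exp (-s * t) * g (cylinderFlow M₀ (-t) z)‖ ∂timeMeasure
          ∂phaseMeasure :=
        integral_mono (integrable_transportResolventFun hM₀ hs hgm hg).norm
          h.norm.integral_prod_right fun z => norm_integral_le_integral_norm _
    _ = ∫ t : ℝ, ∫ z, ‖Complex.exp (-s * t) * g (cylinderFlow M₀ (-t) z)‖ ∂phaseMeasure
          ∂timeMeasure := (integral_integral_swap (f := fun (t : ℝ) z =>
            ‖Complex.exp (-s * t) * g (cylinderFlow M₀ (-t) z)‖) h.norm).symm
    _ = _ := by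
        simp only [norm_mul, integral_const_mul]
        rw [← integral_mul_const]
        refine integral_congr_ae (Eventually.of_forall fun t => ?_)
        simp only
        rw [integral_comp_cylinderFlow hM₀ (-t) (F := fun z => ‖g z‖) hg.norm.1]

/-- The adjoint formula: Fubini and invariance of the measure turn the backward flow acting on g
into the forward flow acting on ψ. -/
theorem integral_transportResolventFun_mul (hM₀ : 0 < M₀) (hs : 0 < s.re) {g : ℝ × ℝ → ℂ}
    (hgm : Measurable g) (hg : Integrable g phaseMeasure) {ψ : ℝ × ℝ → ℂ} (hψm : Measurable ψ)
    (hψ : ∀ q p, ψ (q + 2 * Real.pi, p) = ψ (q, p)) {C : ℝ} (hC : ∀ z, ‖ψ z‖ ≤ C) :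
    ∫ z, transportResolventFun M₀ s g z * ψ z ∂phaseMeasure
      = ∫ z, g z * ∫ t, Complex.exp (-s * t) * ψ (orbit M₀ z t) ∂timeMeasure ∂phaseMeasure := by
  have h := integrable_mul_comp_flow hM₀ hs hgm hg
  have h1 : Integrable (fun x : ℝ × (ℝ × ℝ) =>
      Complex.exp (-s * x.1) * g (cylinderFlow M₀ (-x.1) x.2) * ψ x.2)
      (timeMeasure.prod phaseMeasure) :=
    h.mul_bdd (hψm.comp measurable_snd).aestronglyMeasurable
      (Eventually.of_forall fun x => hC x.2)
  have h2 : Integrable (fun x : ℝ × (ℝ × ℝ) =>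
      Complex.exp (-s * x.1) * (g x.2 * ψ (orbit M₀ x.2 x.1))) (timeMeasure.prod phaseMeasure) := by
    have h3 : Integrable (fun x : ℝ × (ℝ × ℝ) => Complex.exp (-s * x.1) * g x.2)
        (timeMeasure.prod phaseMeasure) := (integrable_exp_mul hs).mul_prod hg
    refine (h3.mul_bdd (g := fun x : ℝ × (ℝ × ℝ) => ψ (orbit M₀ x.2 x.1))
      (hψm.comp (measurable_orbit_comp measurable_snd measurable_fst)).aestronglyMeasurable
      (Eventually.of_forall fun x => hC _)).congr (Eventually.of_forall fun x => ?_)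
    simp only; ring
  calc ∫ z, transportResolventFun M₀ s g z * ψ z ∂phaseMeasure
      = ∫ z, ∫ t, Complex.exp (-s * t) * g (cylinderFlow M₀ (-t) z) * ψ z ∂timeMeasure
          ∂phaseMeasure := by
        simp only [transportResolventFun, integral_mul_const]
    _ = ∫ t, ∫ z, Complex.exp (-s * t) * g (cylinderFlow M₀ (-t) z) * ψ z ∂phaseMeasure
          ∂timeMeasure := (integral_integral_swap (f := fun (t : ℝ) z =>
            Complex.exp (-s * t) * g (cylinderFlow M₀ (-t) z) * ψ z) h1).symm
    _ = ∫ t, ∫ z, Complex.exp (-s * t) * (g z * ψ (orbit M₀ z t)) ∂phaseMeasure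
          ∂timeMeasure := by
        refine integral_congr_ae (Eventually.of_forall fun t => ?_)
        have h4 := integral_comp_cylinderFlow hM₀ (-t)
          (F := fun w => Complex.exp (-s * t) * (g w * ψ (orbit M₀ w t)))
          (measurable_const.mul (hgm.mul (hψm.comp
            (measurable_orbit_comp measurable_id measurable_const)))).aestronglyMeasurable
        simp only
        rw [← h4]
        refine integral_congr_ae (Eventually.of_forall fun z => ?_)
        have h5 : ψ (orbit M₀ (cylinderFlow M₀ (-t) z) t) = ψ z := by
          rw [← comp_wrap hψ (orbit M₀ (cylinderFlow M₀ (-t) z) t)]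
          have h6 : wrap (orbit M₀ (cylinderFlow M₀ (-t) z) t) = wrap z := by
            have h7 := cylinderFlow_cylinderFlow M₀ (-t) t z
            have h8 : cylinderFlow M₀ 0 z = wrap z := by rw [cylinderFlow, orbit_zero]
            rw [neg_add_cancel, h8] at h7
            exact h7
          rw [h6, comp_wrap hψ]
        simp only [h5, mul_assoc]
    _ = ∫ z, ∫ t, Complex.exp (-s * t) * (g z * ψ (orbit M₀ z t)) ∂timeMeasure
          ∂phaseMeasure := integral_integral_swap (f := fun (t : ℝ) z =>
            Complex.exp (-s * t) * (g z * ψ (orbit M₀ z t))) h2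
    _ = _ := by
        refine integral_congr_ae (Eventually.of_forall fun z => ?_)
        simp only
        rw [← integral_const_mul]
        refine integral_congr_ae (Eventually.of_forall fun t => ?_)
        simp only; ring

theorem integrable_exp_mul_comp_orbit (hs : 0 < s.re) {ψ : ℝ × ℝ → ℂ} (hψ : Measurable ψ)
    {C : ℝ} (hC : ∀ z, ‖ψ z‖ ≤ C) (z : ℝ × ℝ) :
    Integrable (fun t : ℝ => Complex.exp (-s * t) * ψ (orbit M₀ z t)) timeMeasure :=
  (integrable_exp_mul hs).mul_bdd
    (hψ.comp (measurable_orbit_comp measurable_const measurable_id)).aestronglyMeasurable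
    (Eventually.of_forall fun _ => hC _)

theorem hasDerivAt_exp_neg_mul (s : ℂ) (t : ℝ) :
    HasDerivAt (fun t : ℝ => Complex.exp (-s * t)) (-s * Complex.exp (-s * t)) t := by
  have h1 : HasDerivAt (fun t : ℝ => -s * (t : ℂ)) (-s * 1) t :=
    (Complex.ofRealCLM.hasDerivAt (x := t)).const_mul (-s)
  exact h1.cexp.congr_deriv (by ring)

theorem integral_laplace_deriv (hs : 0 < s.re) {u u' : ℝ → ℂ} (hu : ∀ t, HasDerivAt u (u' t) t)
    (hi : Integrable (fun t : ℝ => Complex.exp (-s * t) * u t) timeMeasure)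
    (hi' : Integrable (fun t : ℝ => Complex.exp (-s * t) * u' t) timeMeasure)
    {C : ℝ} (hC : ∀ t, ‖u t‖ ≤ C) :
    ∫ t, Complex.exp (-s * t) * u' t ∂timeMeasure
      = -u 0 + s * ∫ t, Complex.exp (-s * t) * u t ∂timeMeasure := by
  have hd : ∀ t : ℝ, HasDerivAt (fun t : ℝ => Complex.exp (-s * t) * u t)
      (-s * (Complex.exp (-s * t) * u t) + Complex.exp (-s * t) * u' t) t := fun t =>
    ((hasDerivAt_exp_neg_mul s t).mul (hu t)).congr_deriv (by ring)
  have hlim : Tendsto (fun t : ℝ => Complex.exp (-s * t) * u t) atTop (𝓝 0) := by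
    have h1 : Tendsto (fun t : ℝ => Real.exp (-s.re * t) * C) atTop (𝓝 (0 * C)) := by
      refine Tendsto.mul_const C (Real.tendsto_exp_atBot.comp ?_)
      exact tendsto_id.const_mul_atTop_of_neg (neg_neg_of_pos hs)
    rw [zero_mul] at h1
    refine squeeze_zero_norm (fun t => ?_) h1
    rw [norm_mul, Complex.norm_exp]
    have : (-s * (t : ℂ)).re = -s.re * t := by simp
    rw [this]
    exact mul_le_mul_of_nonneg_left (hC t) (Real.exp_pos _).le
  have h2 := integral_Ioi_of_hasDerivAt_of_tendsto' (a := 0) (fun t _ => hd t)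
    ((hi.const_mul (-s)).add hi') hlim
  rw [integral_add (hi.const_mul (-s)) hi', integral_const_mul] at h2
  simp only [Complex.ofReal_zero, mul_zero, Complex.exp_zero, one_mul, zero_sub] at h2
  linear_combination h2

/-- Once the flow acts on the test function, the equation is the Laplace rule ∫ e^{-st} u' = -u(0) +
s ∫ e^{-st} u with u(t) = φ(orbit at time t), integrated against g. -/
theorem transportResolventFun_weak (hM₀ : 0 < M₀) (hs : 0 < s.re) {g : ℝ × ℝ → ℂ}
    (hgm : Measurable g) (hg : Integrable g phaseMeasure) {φ : ℝ × ℝ → ℂ} (hφ : IsTestFunction φ) :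
    ∫ z, (s * transportResolventFun M₀ s g z - g z) * φ z ∂phaseMeasure
      = ∫ z, transportResolventFun M₀ s g z * transport M₀ φ z ∂phaseMeasure := by
  obtain ⟨C, hC0, hC⟩ := hφ.exists_norm_le
  obtain ⟨C', hC0', hC'⟩ := exists_norm_transport_le (M₀ := M₀) hφ
  have hφm := hφ.contDiff.continuous.measurable
  have hTm := (continuous_transport (M₀ := M₀) hφ.contDiff).measurable
  have hR := integrable_transportResolventFun hM₀ hs hgm hg
  have hlap : ∀ z, ∫ t, Complex.exp (-s * t) * transport M₀ φ (orbit M₀ z t) ∂timeMeasure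
      = -φ z + s * ∫ t, Complex.exp (-s * t) * φ (orbit M₀ z t) ∂timeMeasure := by
    intro z
    have := integral_laplace_deriv hs (fun t => hasDerivAt_comp_orbit (M₀ := M₀) hφ.contDiff z t)
      (integrable_exp_mul_comp_orbit hs hφm hC z) (integrable_exp_mul_comp_orbit hs hTm hC' z)
      (fun t => hC _)
    rwa [orbit_zero] at this
  rw [integral_transportResolventFun_mul hM₀ hs hgm hg hTm (transport_periodic hφ) hC']
  have hgφ : Integrable (fun z => g z * φ z) phaseMeasure :=
    hg.mul_bdd hφm.aestronglyMeasurable (Eventually.of_forall hC)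
  have hRφ : Integrable (fun z => transportResolventFun M₀ s g z * φ z) phaseMeasure :=
    hR.mul_bdd hφm.aestronglyMeasurable (Eventually.of_forall hC)
  have hgL : Integrable (fun z => g z * ∫ t, Complex.exp (-s * t) * φ (orbit M₀ z t) ∂timeMeasure)
      phaseMeasure := by
    have hLm : StronglyMeasurable fun z =>
        ∫ t, Complex.exp (-s * t) * φ (orbit M₀ z t) ∂timeMeasure := by
      have : Measurable fun x : (ℝ × ℝ) × ℝ => Complex.exp (-s * x.2) * φ (orbit M₀ x.1 x.2) :=
        (by fun_prop : Measurable fun x : (ℝ × ℝ) × ℝ => Complex.exp (-s * x.2)).mul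
          (hφm.comp (measurable_orbit_comp measurable_fst measurable_snd))
      exact this.stronglyMeasurable.integral_prod_right
    refine hg.mul_bdd (c := ∫ t : ℝ, ‖Complex.exp (-s * t)‖ * C ∂timeMeasure)
      hLm.aestronglyMeasurable (Eventually.of_forall fun z => ?_)
    refine norm_integral_le_of_norm_le ((integrable_exp_mul hs).norm.mul_const C)
      (Eventually.of_forall fun t => ?_)
    rw [norm_mul]
    exact mul_le_mul_of_nonneg_left (hC _) (norm_nonneg _)
  have h1 : ∫ z, (s * transportResolventFun M₀ s g z - g z) * φ z ∂phaseMeasure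
      = s * (∫ z, transportResolventFun M₀ s g z * φ z ∂phaseMeasure)
        - ∫ z, g z * φ z ∂phaseMeasure := by
    rw [← integral_const_mul, ← integral_sub (hRφ.const_mul s) hgφ]
    refine integral_congr_ae (Eventually.of_forall fun z => ?_)
    simp only; ring
  rw [h1, integral_transportResolventFun_mul hM₀ hs hgm hg hφm hφ.periodic hC,
    ← integral_const_mul, ← integral_sub (hgL.const_mul s) hgφ]
  refine integral_congr_ae (Eventually.of_forall fun z => ?_)
  simp only [hlap]; ring

/-- Put u(t) = ∬ f · (ψ along the flow for time t). Since ψ along the flow is again a test function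
for t ≥ 0, the weak equation gives u' = su there, hence u(t) = e^{st} u(0). But u is bounded and Re
s > 0, so u(0) = 0 for every ψ. -/
theorem ae_eq_zero_of_transport_eigenfunction (hM₀ : 0 < M₀) (hs : 0 < s.re) {f : ℝ × ℝ → ℂ}
    (hf : Integrable f phaseMeasure)
    (h : ∀ φ, IsTestFunction φ → ∫ z, s * f z * φ z ∂phaseMeasure
      = ∫ z, f z * transport M₀ φ z ∂phaseMeasure) : f =ᵐ[phaseMeasure] 0 := by
  refine ae_eq_zero_of_forall_testFunction hf fun ψ hψ => ?_
  obtain ⟨C, hC0, hC⟩ := hψ.exists_norm_le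
  obtain ⟨C', hC0', hC'⟩ := exists_norm_transport_le (M₀ := M₀) hψ
  have hψm := hψ.contDiff.continuous.measurable
  have hTm := (continuous_transport (M₀ := M₀) hψ.contDiff).measurable
  have horb : ∀ t, Measurable fun z => orbit M₀ z t := fun t =>
    measurable_orbit_comp measurable_id measurable_const
  set u : ℝ → ℂ := fun t => ∫ z, f z * ψ (orbit M₀ z t) ∂phaseMeasure with hu
  have hint : ∀ t, Integrable (fun z => f z * ψ (orbit M₀ z t)) phaseMeasure := fun t =>
    hf.mul_bdd (hψm.comp (horb t)).aestronglyMeasurable (Eventually.of_forall fun z => hC _)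
  have hder : ∀ t, HasDerivAt u (∫ z, f z * transport M₀ ψ (orbit M₀ z t) ∂phaseMeasure) t := by
    intro t
    refine (hasDerivAt_integral_of_dominated_loc_of_deriv_le
      (F := fun t z => f z * ψ (orbit M₀ z t))
      (F' := fun t z => f z * transport M₀ ψ (orbit M₀ z t)) (bound := fun z => ‖f z‖ * C')
      (s := univ) univ_mem (Eventually.of_forall fun t => (hint t).1) (hint t) ?_ ?_ ?_ ?_).2
    · exact hf.1.mul (hTm.comp (horb t)).aestronglyMeasurable
    · refine Eventually.of_forall fun z t _ => ?_
      rw [norm_mul]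
      exact mul_le_mul_of_nonneg_left (hC' _) (norm_nonneg _)
    · exact hf.norm.mul_const _
    · exact Eventually.of_forall fun z t _ =>
        (hasDerivAt_comp_orbit hψ.contDiff z t).const_mul (f z)
  have hder' : ∀ t, 0 ≤ t → HasDerivAt u (s * u t) t := by
    intro t ht
    refine (hder t).congr_deriv ?_
    have h1 := h _ (hψ.comp_orbit hM₀ ht)
    simp only [transport_comp_orbit hψ.contDiff _ ht] at h1
    rw [← h1, hu, ← integral_const_mul]
    simp only [mul_assoc]
  have hconst : ∀ T : ℝ, 0 ≤ T → Complex.exp (-s * T) * u T = u 0 := by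
    intro T hT
    have hd : ∀ t : ℝ, 0 ≤ t → HasDerivAt (fun t : ℝ => Complex.exp (-s * t) * u t) 0 t :=
      fun t ht => ((hasDerivAt_exp_neg_mul s t).mul (hder' t ht)).congr_deriv (by ring)
    have := constant_of_has_deriv_right_zero (a := 0) (b := T)
      (fun t ht => (hd t ht.1).continuousAt.continuousWithinAt)
      (fun t ht => (hd t ht.1).hasDerivWithinAt) T ⟨hT, le_rfl⟩
    simpa using this
  have hbound : ∀ t, ‖u t‖ ≤ ∫ z, ‖f z‖ * C ∂phaseMeasure := fun t =>
    norm_integral_le_of_norm_le (hf.norm.mul_const C) (Eventually.of_forall fun z => by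
      rw [norm_mul]; exact mul_le_mul_of_nonneg_left (hC _) (norm_nonneg _))
  have hlim : Tendsto (fun t : ℝ => Real.exp (-s.re * t) * ∫ z, ‖f z‖ * C ∂phaseMeasure)
      atTop (𝓝 0) := by
    have h1 : Tendsto (fun t : ℝ => Real.exp (-s.re * t)) atTop (𝓝 0) :=
      Real.tendsto_exp_atBot.comp (tendsto_id.const_mul_atTop_of_neg (neg_neg_of_pos hs))
    simpa using h1.mul_const (∫ z, ‖f z‖ * C ∂phaseMeasure)
  have h0 : ‖u 0‖ ≤ 0 := by
    refine ge_of_tendsto hlim ?_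
    filter_upwards [eventually_ge_atTop 0] with t ht
    rw [← hconst t ht, norm_mul, Complex.norm_exp]
    have : (-s * (t : ℂ)).re = -s.re * t := by simp
    rw [this]
    exact mul_le_mul_of_nonneg_left (hbound t) (Real.exp_pos _).le
  have h2 : u 0 = 0 := norm_le_zero_iff.1 h0
  simpa [hu, orbit_zero] using h2

/-! ### The weak transport equation and the resolvent as a bounded operator on L¹. -/

theorem measurable_coeFn (g : Perturbation) : Measurable (g : ℝ × ℝ → ℂ) :=
  (Lp.stronglyMeasurable g).measurable

theorem integrable_coeFn (g : Perturbation) : Integrable g phaseMeasure := L1.integrable_coeFn g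

theorem integrable_mul_testFunction {f φ : ℝ × ℝ → ℂ} (hf : Integrable f phaseMeasure)
    (hφ : IsTestFunction φ) : Integrable (fun z => f z * φ z) phaseMeasure := by
  obtain ⟨C, hC0, hC⟩ := hφ.exists_norm_le
  exact hf.mul_bdd hφ.contDiff.continuous.measurable.aestronglyMeasurable (Eventually.of_forall hC)

theorem integrable_mul_transport {f φ : ℝ × ℝ → ℂ} (hf : Integrable f phaseMeasure)
    (hφ : IsTestFunction φ) : Integrable (fun z => f z * transport M₀ φ z) phaseMeasure := by
  obtain ⟨C, hC0, hC⟩ := exists_norm_transport_le (M₀ := M₀) hφ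
  exact hf.mul_bdd (continuous_transport hφ.contDiff).measurable.aestronglyMeasurable
    (Eventually.of_forall hC)

/-- The equation `s f - T f = g` in the sense of distributions. -/
def TransportEquation (M₀ : ℝ) (s : ℂ) (f g : ℝ × ℝ → ℂ) : Prop :=
  ∀ φ, IsTestFunction φ → ∫ z, (s * f z - g z) * φ z ∂phaseMeasure
    = ∫ z, f z * transport M₀ φ z ∂phaseMeasure

/-- Uniqueness with sources that agree only almost everywhere. The resolvent integrates a chosen
representative along orbits, so this also shows independence of that choice. -/
theorem TransportEquation.ae_eq (hM₀ : 0 < M₀) (hs : 0 < s.re) {f₁ f₂ g₁ g₂ : ℝ × ℝ → ℂ}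
    (hf₁ : Integrable f₁ phaseMeasure) (hf₂ : Integrable f₂ phaseMeasure)
    (hg₁ : Integrable g₁ phaseMeasure) (hg₂ : Integrable g₂ phaseMeasure)
    (hg : g₁ =ᵐ[phaseMeasure] g₂)
    (h₁ : TransportEquation M₀ s f₁ g₁) (h₂ : TransportEquation M₀ s f₂ g₂) :
    f₁ =ᵐ[phaseMeasure] f₂ := by
  have h := ae_eq_zero_of_transport_eigenfunction hM₀ hs (hf₁.sub hf₂) fun φ hφ => by
    have e₁ := h₁ φ hφ
    have e₂ := h₂ φ hφ
    have i₁ := integrable_mul_testFunction ((hf₁.const_mul s).sub hg₁) hφ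
    have i₂ := integrable_mul_testFunction ((hf₂.const_mul s).sub hg₂) hφ
    have e₃ := integral_sub i₁ i₂
    have e₄ := integral_sub (integrable_mul_transport (M₀ := M₀) hf₁ hφ)
      (integrable_mul_transport (M₀ := M₀) hf₂ hφ)
    simp only [Pi.sub_apply] at e₃ ⊢
    have e₅ : ∫ z, s * (f₁ z - f₂ z) * φ z ∂phaseMeasure
        = ∫ z, ((s * f₁ z - g₁ z) * φ z - (s * f₂ z - g₂ z) * φ z) ∂phaseMeasure := by
      refine integral_congr_ae (hg.mono fun z hz => ?_)
      simp only [hz]; ring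
    have e₆ : ∫ z, (f₁ z - f₂ z) * transport M₀ φ z ∂phaseMeasure
        = ∫ z, (f₁ z * transport M₀ φ z - f₂ z * transport M₀ φ z) ∂phaseMeasure := by
      simp only [sub_mul]
    rw [e₅, e₆, e₃, e₄, e₁, e₂]
  filter_upwards [h] with z hz
  exact sub_eq_zero.1 hz

theorem transportEquation_transportResolventFun (hM₀ : 0 < M₀) (hs : 0 < s.re) {g : ℝ × ℝ → ℂ}
    (hgm : Measurable g) (hg : Integrable g phaseMeasure) :
    TransportEquation M₀ s (transportResolventFun M₀ s g) g :=
  fun _ hφ => transportResolventFun_weak hM₀ hs hgm hg hφ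

theorem TransportEquation.congr {f f' g g' : ℝ × ℝ → ℂ} (hf : f =ᵐ[phaseMeasure] f')
    (hg : g =ᵐ[phaseMeasure] g') (h : TransportEquation M₀ s f g) : TransportEquation M₀ s f' g' := by
  intro φ hφ
  have e₁ : ∫ z, (s * f' z - g' z) * φ z ∂phaseMeasure
      = ∫ z, (s * f z - g z) * φ z ∂phaseMeasure :=
    integral_congr_ae (by filter_upwards [hf, hg] with z h1 h2; rw [h1, h2])
  have e₂ : ∫ z, f' z * transport M₀ φ z ∂phaseMeasure
      = ∫ z, f z * transport M₀ φ z ∂phaseMeasure :=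
    integral_congr_ae (by filter_upwards [hf] with z h1; rw [h1])
  rw [e₁, e₂]
  exact h φ hφ

theorem TransportEquation.add {f₁ f₂ g₁ g₂ : ℝ × ℝ → ℂ}
    (hf₁ : Integrable f₁ phaseMeasure) (hf₂ : Integrable f₂ phaseMeasure)
    (hg₁ : Integrable g₁ phaseMeasure) (hg₂ : Integrable g₂ phaseMeasure)
    (h₁ : TransportEquation M₀ s f₁ g₁) (h₂ : TransportEquation M₀ s f₂ g₂) :
    TransportEquation M₀ s (f₁ + f₂) (g₁ + g₂) := by
  intro φ hφ
  have e₃ := integral_add (integrable_mul_testFunction ((hf₁.const_mul s).sub hg₁) hφ)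
    (integrable_mul_testFunction ((hf₂.const_mul s).sub hg₂) hφ)
  have e₄ := integral_add (integrable_mul_transport (M₀ := M₀) hf₁ hφ)
    (integrable_mul_transport (M₀ := M₀) hf₂ hφ)
  simp only [Pi.sub_apply] at e₃
  have e₅ := h₁ φ hφ
  have e₆ := h₂ φ hφ
  rw [← e₅, ← e₆, ← e₃] at e₄
  simp only [Pi.add_apply]
  simp only [add_mul]
  rw [e₄]
  refine integral_congr_ae (Eventually.of_forall fun z => ?_)
  simp only; ring

theorem TransportEquation.const_mul {f g : ℝ × ℝ → ℂ} (c : ℂ) (h : TransportEquation M₀ s f g) :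
    TransportEquation M₀ s (fun z => c * f z) (fun z => c * g z) := by
  intro φ hφ
  have e := congrArg (c * ·) (h φ hφ)
  simp only [← integral_const_mul] at e
  simp only [mul_assoc]
  rw [← e]
  refine integral_congr_ae (Eventually.of_forall fun z => ?_)
  simp only; ring

/-- The bounded operator `(s - T)⁻¹` on `L¹`. -/
def transportResolvent (hM₀ : 0 < M₀) (hs : 0 < s.re) : Perturbation →L[ℂ] Perturbation :=
  LinearMap.mkContinuous
    { toFun := fun g => (integrable_transportResolventFun hM₀ hs (measurable_coeFn g)
        (integrable_coeFn g)).toL1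
      -- The representatives of g + g' and of the two summands agree only almost everywhere, so
      -- linearity is deduced from uniqueness for the weak equation rather than pointwise.
      map_add' := fun g g' => by
        have hi := fun g : Perturbation => integrable_transportResolventFun hM₀ hs
          (measurable_coeFn g) (integrable_coeFn g)
        have ht := fun g : Perturbation => transportEquation_transportResolventFun hM₀ hs
          (measurable_coeFn g) (integrable_coeFn g)
        rw [← Integrable.toL1_add, Integrable.toL1_eq_toL1_iff]
        exact (ht _).ae_eq hM₀ hs (hi _) ((hi _).add (hi _)) (integrable_coeFn _)
          ((integrable_coeFn _).add (integrable_coeFn _)) (Lp.coeFn_add g g')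
          ((ht _).add (hi _) (hi _) (integrable_coeFn _) (integrable_coeFn _) (ht _))
      map_smul' := fun c g => by
        have hi := fun g : Perturbation => integrable_transportResolventFun hM₀ hs
          (measurable_coeFn g) (integrable_coeFn g)
        have ht := fun g : Perturbation => transportEquation_transportResolventFun hM₀ hs
          (measurable_coeFn g) (integrable_coeFn g)
        rw [RingHom.id_apply, ← Integrable.toL1_smul, Integrable.toL1_eq_toL1_iff]
        exact (ht _).ae_eq hM₀ hs (hi _) ((hi _).const_mul c) (integrable_coeFn _)
          ((integrable_coeFn _).const_mul c) (Lp.coeFn_smul c g) ((ht _).const_mul c) }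
    (∫ t : ℝ, ‖Complex.exp (-s * t)‖ ∂timeMeasure) fun g => by
      have h := integral_norm_transportResolventFun_le hM₀ hs (measurable_coeFn g)
        (integrable_coeFn g)
      simp only [LinearMap.coe_mk, AddHom.coe_mk]
      rw [L1.norm_eq_integral_norm, L1.norm_eq_integral_norm]
      refine le_trans (le_of_eq (integral_congr_ae ?_)) h
      filter_upwards [Integrable.coeFn_toL1 (integrable_transportResolventFun hM₀ hs
        (measurable_coeFn g) (integrable_coeFn g))] with z hz
      rw [hz]

theorem coeFn_transportResolvent (hM₀ : 0 < M₀) (hs : 0 < s.re) (g : Perturbation) :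
    transportResolvent hM₀ hs g =ᵐ[phaseMeasure] transportResolventFun M₀ s g :=
  Integrable.coeFn_toL1 (integrable_transportResolventFun hM₀ hs (measurable_coeFn g)
    (integrable_coeFn g))

theorem transportEquation_iff (hM₀ : 0 < M₀) (hs : 0 < s.re) (f g : Perturbation) :
    TransportEquation M₀ s f g ↔ f = transportResolvent hM₀ hs g := by
  have h0 : TransportEquation M₀ s (transportResolvent hM₀ hs g) g :=
    (transportEquation_transportResolventFun hM₀ hs (measurable_coeFn g)
      (integrable_coeFn g)).congr (coeFn_transportResolvent hM₀ hs g).symm EventuallyEq.rfl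
  constructor
  · intro h
    exact Lp.ext (h.ae_eq hM₀ hs (integrable_coeFn f) (integrable_coeFn _) (integrable_coeFn g)
      (integrable_coeFn g) EventuallyEq.rfl h0)
  · rintro rfl
    exact h0

end

section

/-! ### Fourier coefficients of periodic functions -/

/-- The Fourier coefficient `(2π)⁻¹ ∫_{-π}^{π} u(θ) e^{-imθ} dθ`. -/
def fourierMode (u : ℝ → ℝ) (m : ℤ) : ℂ :=
  (1 / (2 * Real.pi) : ℂ) * ∫ θ in (-Real.pi)..Real.pi, (u θ : ℂ) * Complex.exp (-Complex.I * m * θ)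

instance instFactTwoPiPos : Fact (0 < 2 * Real.pi) := ⟨Real.two_pi_pos⟩

/-- A continuous `2π`-periodic real function as a complex function on the circle. -/
def circleLift (u : ℝ → ℝ) (hc : Continuous u) (hp : Function.Periodic u (2 * Real.pi)) :
    C(AddCircle (2 * Real.pi), ℂ) where
  toFun := Function.Periodic.lift (f := fun θ => (u θ : ℂ)) fun θ => by simp only [hp θ]
  continuous_toFun := (Complex.continuous_ofReal.comp hc).quotient_lift _

theorem circleLift_coe (u : ℝ → ℝ) (hc : Continuous u) (hp : Function.Periodic u (2 * Real.pi))
    (θ : ℝ) : circleLift u hc hp (θ : AddCircle (2 * Real.pi)) = u θ := rfl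

theorem fourierCoeff_circleLift (u : ℝ → ℝ) (hc : Continuous u)
    (hp : Function.Periodic u (2 * Real.pi)) (m : ℤ) :
    fourierCoeff (circleLift u hc hp) m = fourierMode u m := by
  rw [fourierCoeff_eq_intervalIntegral _ _ (-Real.pi), fourierMode]
  have : -Real.pi + 2 * Real.pi = Real.pi := by ring
  rw [this, Complex.real_smul]
  congr 1
  · push_cast; rfl
  · refine intervalIntegral.integral_congr fun θ _ => ?_
    simp only [circleLift_coe, fourier_coe_apply, smul_eq_mul]
    rw [mul_comm]
    congr 2
    push_cast
    have : (Real.pi : ℂ) ≠ 0 := by exact_mod_cast Real.pi_ne_zero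
    field_simp

theorem exp_mode_periodic (m : ℤ) :
    Function.Periodic (fun θ : ℝ => Complex.exp (-Complex.I * m * θ)) (2 * Real.pi) := by
  intro θ
  simp only
  rw [Complex.exp_eq_exp_iff_exists_int]
  exact ⟨-m, by push_cast; ring⟩

theorem fourierMode_comp_sub {u : ℝ → ℝ} (hp : Function.Periodic u (2 * Real.pi)) (m : ℤ) (τ : ℝ) :
    fourierMode (fun θ => u (θ - τ)) m = Complex.exp (-Complex.I * m * τ) * fourierMode u m := by
  have h1 : ∀ θ : ℝ, (u (θ - τ) : ℂ) * Complex.exp (-Complex.I * m * θ)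
      = Complex.exp (-Complex.I * m * τ) *
        ((u (θ - τ) : ℂ) * Complex.exp (-Complex.I * m * (θ - τ : ℝ))) := by
    intro θ
    rw [mul_left_comm, ← Complex.exp_add]
    congr 2
    push_cast; ring
  have h2 : Function.Periodic (fun θ : ℝ => (u θ : ℂ) * Complex.exp (-Complex.I * m * θ))
      (2 * Real.pi) := by
    intro θ
    have := exp_mode_periodic m θ
    simp only at this ⊢
    rw [hp θ, this]
  simp only [fourierMode, h1, intervalIntegral.integral_const_mul]
  rw [intervalIntegral.integral_comp_sub_right
    (fun θ : ℝ => (u θ : ℂ) * Complex.exp (-Complex.I * m * θ)) τ]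
  have h3 := h2.intervalIntegral_add_eq (-Real.pi - τ) (-Real.pi)
  have e1 : -Real.pi - τ + 2 * Real.pi = Real.pi - τ := by ring
  have e2 : -Real.pi + 2 * Real.pi = Real.pi := by ring
  rw [e1, e2] at h3
  rw [h3]; ring

theorem norm_fourierMode_neg (u : ℝ → ℝ) (m : ℤ) : ‖fourierMode u (-m)‖ = ‖fourierMode u m‖ := by
  have : fourierMode u (-m) = (starRingEnd ℂ) (fourierMode u m) := by
    simp only [fourierMode, map_mul]
    rw [intervalIntegral.integral_of_le (by linarith [Real.pi_pos]),
      intervalIntegral.integral_of_le (by linarith [Real.pi_pos]), ← integral_conj]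
    congr 1
    · simp [map_ofNat]
    · refine integral_congr_ae (Eventually.of_forall fun θ => ?_)
      simp only [map_mul, ← Complex.exp_conj, Complex.conj_ofReal, map_neg, Complex.conj_I,
        map_intCast]
      push_cast
      congr 2; ring
  rw [this, Complex.norm_conj]

/-- Parseval for u and its translate, whose m-th coefficient is e^{-imτ} times that of u. The phases
e^{-imτ} become time evolution when τ = Ωt. -/
theorem hasSum_sq_fourierMode_mul_exp {u : ℝ → ℝ} (hc : Continuous u)
    (hp : Function.Periodic u (2 * Real.pi)) (τ : ℝ) :
    HasSum (fun m : ℤ => ((‖fourierMode u m‖ ^ 2 : ℝ) : ℂ) * Complex.exp (-Complex.I * m * τ))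
      ((1 / (2 * Real.pi) : ℝ) * (∫ θ in (-Real.pi)..Real.pi, u θ * u (θ - τ) : ℝ)) := by
  have hp' : Function.Periodic (fun θ => u (θ - τ)) (2 * Real.pi) := by
    intro θ
    have := hp (θ - τ)
    simp only
    rw [← this]; congr 1; ring
  have hc' : Continuous fun θ => u (θ - τ) := by fun_prop
  set U := circleLift u hc hp
  set V := circleLift _ hc' hp'
  have h := fourierBasis.hasSum_inner_mul_inner
    (ContinuousMap.toLp (E := ℂ) 2 (AddCircle.haarAddCircle (T := 2 * Real.pi)) ℂ U)
    (ContinuousMap.toLp (E := ℂ) 2 (AddCircle.haarAddCircle (T := 2 * Real.pi)) ℂ V)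
  rw [ContinuousMap.inner_toLp] at h
  have e : ∫ x, V x * (starRingEnd ℂ) (U x) ∂AddCircle.haarAddCircle
      = (1 / (2 * Real.pi) : ℝ) * (∫ θ in (-Real.pi)..Real.pi, u θ * u (θ - τ) : ℝ) := by
    have e1 := fourierCoeff_eq_intervalIntegral (T := 2 * Real.pi)
      (fun x => V x * (starRingEnd ℂ) (U x)) 0 (-Real.pi)
    have e2 : -Real.pi + 2 * Real.pi = Real.pi := by ring
    rw [e2, fourierCoeff] at e1
    simp only [neg_zero, fourier_zero, one_smul] at e1
    rw [e1, Complex.real_smul, ← intervalIntegral.integral_ofReal]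
    congr 1
    refine intervalIntegral.integral_congr fun θ _ => ?_
    simp only [U, V, circleLift_coe, Complex.conj_ofReal]
    push_cast; ring
  rw [e] at h
  refine h.congr_fun fun m => ?_
  rw [← inner_conj_symm, ← fourierBasis.repr_apply_apply, ← fourierBasis.repr_apply_apply,
    fourierBasis_repr, fourierBasis_repr, fourierCoeff_toLp, fourierCoeff_toLp,
    fourierCoeff_circleLift, fourierCoeff_circleLift, fourierMode_comp_sub hp]
  have := Complex.conj_mul' (fourierMode u m)
  push_cast
  linear_combination (-Complex.exp (-Complex.I * m * τ)) * this

theorem hasSum_sq_fourierMode {u : ℝ → ℝ} (hc : Continuous u)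
    (hp : Function.Periodic u (2 * Real.pi)) :
    HasSum (fun m : ℤ => ‖fourierMode u m‖ ^ 2)
      (1 / (2 * Real.pi) * ∫ θ in (-Real.pi)..Real.pi, u θ ^ 2) := by
  have h := hasSum_sq_fourierMode_mul_exp hc hp 0
  simp only [Complex.ofReal_zero, mul_zero, Complex.exp_zero, mul_one, sub_zero, ← sq] at h
  rw [← Complex.ofReal_mul] at h
  exact Complex.hasSum_ofReal.1 h

end

section

/-! ### The spectral measure of an observable -/

variable {f₀ : ℝ × ℝ → ℝ} {M₀ : ℝ} {fhat : ℝ → ℝ} {A : ℝ → ℝ}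

/-- A bounded continuous function of the position on the circle. -/
structure IsObservable (A : ℝ → ℝ) : Prop where
  continuous : Continuous A
  periodic : Function.Periodic A (2 * Real.pi)
  abs_le : ∀ q, |A q| ≤ 1

theorem isObservable_cos : IsObservable Real.cos :=
  ⟨Real.continuous_cos, Real.cos_periodic, Real.abs_cos_le_one⟩

theorem isObservable_sin : IsObservable Real.sin :=
  ⟨Real.continuous_sin, Real.sin_periodic, Real.abs_sin_le_one⟩

/-- An observable along the orbit of energy `E`, as a function of the angle. -/
def orbitSignal (M₀ : ℝ) (A : ℝ → ℝ) (i : Region) (E θ : ℝ) : ℝ := A (angleOrbit M₀ i (E, θ)).1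

theorem continuous_orbitSignal (hA : IsObservable A) (i : Region) (E : ℝ) :
    Continuous (orbitSignal M₀ A i E) :=
  hA.continuous.comp (continuous_orbit_comp (f := fun _ => basePoint M₀ i E) continuous_const
    (continuous_mul_const (period M₀ i E / (2 * Real.pi)))).fst

theorem periodic_orbitSignal (hA : IsObservable A) (hM₀ : 0 < M₀) {i : Region} {E : ℝ}
    (hE : E ∈ energyRange M₀ i) : Function.Periodic (orbitSignal M₀ A i E) (2 * Real.pi) := by
  intro θ
  rw [orbitSignal, angleOrbit_add_two_pi hM₀ hE]
  exact hA.periodic.int_mul (winding i) _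

theorem measurable_orbitSignal (hA : IsObservable A) (i : Region) :
    Measurable fun x : ℝ × ℝ => orbitSignal M₀ A i x.1 x.2 :=
  hA.continuous.measurable.comp (measurable_angleOrbit M₀ i).fst

theorem measurable_fourierMode_orbitSignal (hA : IsObservable A) (i : Region) (m : ℤ) :
    Measurable fun E => fourierMode (orbitSignal M₀ A i E) m := by
  refine Measurable.const_mul ?_ _
  simp only [intervalIntegral.integral_of_le (show -Real.pi ≤ Real.pi by linarith [Real.pi_pos])]
  have h : Measurable fun x : ℝ × ℝ =>
      (orbitSignal M₀ A i x.1 x.2 : ℂ) * Complex.exp (-Complex.I * m * x.2) :=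
    (Complex.measurable_ofReal.comp (measurable_orbitSignal hA i)).mul (by fun_prop)
  exact (h.stronglyMeasurable.integral_prod_right (ν := angleMeasure)).measurable

/-- The density of the `m`-th harmonic of an observable. -/
def modeWeight (M₀ : ℝ) (fhat A : ℝ → ℝ) (i : Region) (m : ℤ) (E : ℝ) : ℝ :=
  -(2 * Real.pi * deriv fhat E) * ‖fourierMode (orbitSignal M₀ A i E) m‖ ^ 2

/-- The frequency of the orbit of energy `E`. -/
def orbitFrequency (M₀ : ℝ) (i : Region) (E : ℝ) : ℝ := (period M₀ i E / (2 * Real.pi))⁻¹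

theorem orbitFrequency_pos (hM₀ : 0 < M₀) {i : Region} {E : ℝ} (hE : E ∈ energyRange M₀ i) :
    0 < orbitFrequency M₀ i E :=
  inv_pos.2 (div_pos (period_pos hM₀ hE) Real.two_pi_pos)

theorem measurable_orbitFrequency (M₀ : ℝ) (i : Region) : Measurable (orbitFrequency M₀ i) :=
  ((measurable_period M₀ i).div_const _).inv

theorem measurable_modeWeight (hA : IsObservable A) (i : Region) (m : ℤ) :
    Measurable (modeWeight M₀ fhat A i m) :=
  ((measurable_deriv fhat).const_mul _).neg.mul
    ((measurable_fourierMode_orbitSignal hA i m).norm.pow_const 2)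

/-- The spectral measure of an observable in one region, carried by the harmonics of the orbit
frequencies. -/
def regionSpectralMeasure (M₀ : ℝ) (fhat A : ℝ → ℝ) (i : Region) : Measure ℝ :=
  Measure.sum fun m : ℤ => ((actionMeasure M₀ i).withDensity
    fun E => ENNReal.ofReal (modeWeight M₀ fhat A i m E)).map fun E => m * orbitFrequency M₀ i E

/-- The spectral measure of an observable. -/
def spectralMeasure (M₀ : ℝ) (fhat A : ℝ → ℝ) : Measure ℝ :=
  ∑ i, regionSpectralMeasure M₀ fhat A i

namespace IsMonotoneEquilibrium

theorem modeWeight_nonneg (h : IsMonotoneEquilibrium f₀ M₀ fhat) {i : Region} {E : ℝ}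
    (hE : E ∈ energyRange M₀ i) (m : ℤ) : 0 ≤ modeWeight M₀ fhat A i m E := by
  have h1 := h.deriv_nonpos (neg_lt_of_mem_energyRange h.pos hE)
  refine mul_nonneg ?_ (by positivity)
  have := mul_nonpos_of_nonneg_of_nonpos Real.two_pi_pos.le h1
  linarith

theorem hasSum_modeWeight (h : IsMonotoneEquilibrium f₀ M₀ fhat) (hA : IsObservable A) {i : Region}
    {E : ℝ} (hE : E ∈ energyRange M₀ i) :
    HasSum (fun m => modeWeight M₀ fhat A i m E)
      (-(deriv fhat E) * ∫ θ in (-Real.pi)..Real.pi, orbitSignal M₀ A i E θ ^ 2) := by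
  have := (hasSum_sq_fourierMode (continuous_orbitSignal hA i E)
    (periodic_orbitSignal hA h.pos hE)).mul_left (-(2 * Real.pi * deriv fhat E))
  convert! this using 1
  field_simp [Real.pi_ne_zero]

theorem hasSum_modeWeight_mul_exp (h : IsMonotoneEquilibrium f₀ M₀ fhat) (hA : IsObservable A)
    {i : Region} {E : ℝ} (hE : E ∈ energyRange M₀ i) (τ : ℝ) :
    HasSum (fun m : ℤ => (modeWeight M₀ fhat A i m E : ℂ) * Complex.exp (-Complex.I * m * τ))
      ((-(deriv fhat E) * ∫ θ in (-Real.pi)..Real.pi,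
        orbitSignal M₀ A i E θ * orbitSignal M₀ A i E (θ - τ) : ℝ) : ℂ) := by
  have := (hasSum_sq_fourierMode_mul_exp (continuous_orbitSignal hA i E)
    (periodic_orbitSignal hA h.pos hE) τ).mul_left ((-(2 * Real.pi * deriv fhat E) : ℝ) : ℂ)
  convert! this using 1
  · ext m
    rw [modeWeight]; push_cast; ring
  · rw [← Complex.ofReal_mul, ← Complex.ofReal_mul]
    congr 1
    field_simp [Real.pi_ne_zero]

/-- By Parseval the weights at energy E sum to -f̂'(E) ∫ A² dθ ≤ 2π|f̂'(E)|, which is integrable.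
The absolute convergence of all dispersion sums rests on this. -/
theorem lintegral_tsum_modeWeight_lt_top (h : IsMonotoneEquilibrium f₀ M₀ fhat)
    (hA : IsObservable A) (i : Region) :
    ∫⁻ E, ∑' m, ENNReal.ofReal (modeWeight M₀ fhat A i m E) ∂actionMeasure M₀ i < ⊤ := by
  have hi := ((h.integrable_deriv i).const_mul (-(2 * Real.pi))).lintegral_lt_top
  refine lt_of_le_of_lt (lintegral_mono_ae ?_) hi
  filter_upwards [ae_mem_energyRange M₀ i] with E hE
  have hs := h.hasSum_modeWeight hA hE
  rw [← ENNReal.ofReal_tsum_of_nonneg (fun m => h.modeWeight_nonneg hE m) hs.summable,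
    hs.tsum_eq]
  refine ENNReal.ofReal_le_ofReal ?_
  have h1 : ∫ θ in (-Real.pi)..Real.pi, orbitSignal M₀ A i E θ ^ 2 ≤ 2 * Real.pi := by
    have h2 : ∫ θ in (-Real.pi)..Real.pi, orbitSignal M₀ A i E θ ^ 2
        ≤ ∫ θ in (-Real.pi)..Real.pi, (1 : ℝ) :=
      intervalIntegral.integral_mono_on (by linarith [Real.pi_pos])
        (((continuous_orbitSignal hA i E).pow 2).intervalIntegrable _ _)
        (by simp) fun θ _ => (sq_le_one_iff_abs_le_one _).2 (hA.abs_le _)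
    refine h2.trans (le_of_eq ?_)
    rw [intervalIntegral.integral_const, smul_eq_mul]
    ring
  have h3 := h.deriv_nonpos (neg_lt_of_mem_energyRange h.pos hE)
  nlinarith

theorem isFiniteMeasure_regionSpectralMeasure (h : IsMonotoneEquilibrium f₀ M₀ fhat)
    (hA : IsObservable A) (i : Region) :
    IsFiniteMeasure (regionSpectralMeasure M₀ fhat A i) := by
  constructor
  have := h.lintegral_tsum_modeWeight_lt_top hA i
  rw [lintegral_tsum fun m => (measurable_modeWeight hA i m).ennreal_ofReal.aemeasurable] at this
  rw [regionSpectralMeasure, Measure.sum_apply _ MeasurableSet.univ]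
  refine lt_of_le_of_lt (ENNReal.tsum_le_tsum fun m => ?_) this
  rw [Measure.map_apply ((measurable_orbitFrequency M₀ i).const_mul _) MeasurableSet.univ,
    preimage_univ, withDensity_apply _ MeasurableSet.univ, Measure.restrict_univ]

theorem isFiniteMeasure_spectralMeasure (h : IsMonotoneEquilibrium f₀ M₀ fhat)
    (hA : IsObservable A) : IsFiniteMeasure (spectralMeasure M₀ fhat A) := by
  have := h.isFiniteMeasure_regionSpectralMeasure hA
  unfold spectralMeasure
  infer_instance

theorem integrable_spectralMeasure (h : IsMonotoneEquilibrium f₀ M₀ fhat)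
    (hA : IsObservable A) (i : Region) {F : ℝ → ℂ} (hF : Measurable F) {C : ℝ}
    (hC : ∀ y, ‖F y‖ ≤ C) : Integrable F (regionSpectralMeasure M₀ fhat A i) :=
  have := h.isFiniteMeasure_regionSpectralMeasure hA i
  .of_bound hF.aestronglyMeasurable C (Eventually.of_forall hC)

theorem integral_spectralMeasure (h : IsMonotoneEquilibrium f₀ M₀ fhat)
    (hA : IsObservable A) {F : ℝ → ℂ} (hF : Measurable F) {C : ℝ} (hC : ∀ y, ‖F y‖ ≤ C) :
    ∫ y, F y ∂spectralMeasure M₀ fhat A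
      = ∑ i, ∫ y, F y ∂regionSpectralMeasure M₀ fhat A i :=
  integral_finsetSum_measure fun i _ => h.integrable_spectralMeasure hA i hF hC

/-- The m-th harmonic alone is a measure bounded by the whole spectral measure, against which
bounded functions are integrable. -/
theorem integrable_mode (h : IsMonotoneEquilibrium f₀ M₀ fhat)
    (hA : IsObservable A) (i : Region) {F : ℝ → ℂ} (hF : Measurable F) {C : ℝ}
    (hC : ∀ y, ‖F y‖ ≤ C) (m : ℤ) :
    Integrable (fun E => (modeWeight M₀ fhat A i m E : ℂ) * F (m * orbitFrequency M₀ i E))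
      (actionMeasure M₀ i) := by
  have h1 := (h.integrable_spectralMeasure hA i hF hC).mono_measure (Measure.le_sum _ m)
  rw [integrable_map_measure hF.aestronglyMeasurable
    ((measurable_orbitFrequency M₀ i).const_mul _).aemeasurable,
    integrable_withDensity_iff_integrable_smul' (measurable_modeWeight hA i m).ennreal_ofReal
      (Eventually.of_forall fun _ => ENNReal.ofReal_lt_top)] at h1
  refine h1.congr ?_
  filter_upwards [ae_mem_energyRange M₀ i] with E hE
  rw [ENNReal.toReal_ofReal (h.modeWeight_nonneg hE m), Complex.real_smul, Function.comp_apply]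

/-- The dictionary between the two descriptions: integrals of bounded functions against the spectral
measure are the sums over harmonics occurring in the dispersion functions. -/
theorem hasSum_integral_mode (h : IsMonotoneEquilibrium f₀ M₀ fhat)
    (hA : IsObservable A) (i : Region) {F : ℝ → ℂ} (hF : Measurable F) {C : ℝ}
    (hC : ∀ y, ‖F y‖ ≤ C) :
    HasSum (fun m : ℤ => ∫ E, (modeWeight M₀ fhat A i m E : ℂ) * F (m * orbitFrequency M₀ i E)
      ∂actionMeasure M₀ i) (∫ y, F y ∂regionSpectralMeasure M₀ fhat A i) := by
  refine (hasSum_integral_measure (h.integrable_spectralMeasure hA i hF hC)).congr_fun fun m => ?_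
  rw [integral_map ((measurable_orbitFrequency M₀ i).const_mul _).aemeasurable
    hF.aestronglyMeasurable,
    integral_withDensity_eq_integral_toReal_smul (measurable_modeWeight hA i m).ennreal_ofReal
      (Eventually.of_forall fun _ => ENNReal.ofReal_lt_top)]
  refine integral_congr_ae ?_
  filter_upwards [ae_mem_energyRange M₀ i] with E hE
  rw [ENNReal.toReal_ofReal (h.modeWeight_nonneg hE m), Complex.real_smul]

/-- The spectral measure is symmetric. -/
theorem integral_spectralMeasure_neg (h : IsMonotoneEquilibrium f₀ M₀ fhat)
    (hA : IsObservable A) {F : ℝ → ℂ} (hF : Measurable F) {C : ℝ} (hC : ∀ y, ‖F y‖ ≤ C) :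
    ∫ y, F (-y) ∂spectralMeasure M₀ fhat A = ∫ y, F y ∂spectralMeasure M₀ fhat A := by
  have hF' : Measurable fun y => F (-y) := hF.comp measurable_neg
  rw [h.integral_spectralMeasure hA hF hC, h.integral_spectralMeasure hA hF' fun y => hC _]
  refine Finset.sum_congr rfl fun i _ => ?_
  have h1 := h.hasSum_integral_mode hA i hF' fun y => hC _
  have h2 := (Equiv.neg ℤ).hasSum_iff.2 (h.hasSum_integral_mode hA i hF hC)
  refine h1.unique (h2.congr_fun fun m => ?_)
  refine integral_congr_ae (Eventually.of_forall fun E => ?_)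
  simp only [Equiv.neg_apply, modeWeight, norm_fourierMode_neg]
  rw [Int.cast_neg, neg_mul (m : ℝ)]

theorem summable_integral_modeWeight (h : IsMonotoneEquilibrium f₀ M₀ fhat)
    (hA : IsObservable A) (i : Region) :
    Summable fun m : ℤ => ∫ E, modeWeight M₀ fhat A i m E ∂actionMeasure M₀ i := by
  have h1 := (h.hasSum_integral_mode hA i (F := fun _ => 1) measurable_const
    (C := 1) (by simp)).summable
  simp only [mul_one, integral_complex_ofReal] at h1
  exact Complex.summable_ofReal.1 h1

/-- The Fourier transform of the spectral measure is the autocorrelation. -/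
theorem integral_exp_spectralMeasure (h : IsMonotoneEquilibrium f₀ M₀ fhat)
    (hA : IsObservable A) (t : ℝ) :
    ∫ y : ℝ, Complex.exp (-Complex.I * y * t) ∂spectralMeasure M₀ fhat A
      = ((-∫ z, A z.1 * A (orbit M₀ z (-t)).1 * profileDeriv M₀ fhat z ∂phaseMeasure : ℝ) : ℂ) := by
  have hFm : Measurable fun y : ℝ => Complex.exp (-Complex.I * y * t) := by fun_prop
  have hFb : ∀ y : ℝ, ‖Complex.exp (-Complex.I * y * t)‖ ≤ 1 := by
    intro y
    rw [Complex.norm_exp]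
    simp
  have hm : Measurable fun z : ℝ × ℝ => A z.1 * A (orbit M₀ z (-t)).1 :=
    (hA.continuous.measurable.comp measurable_fst).mul (hA.continuous.measurable.comp
      (measurable_orbit_comp measurable_id measurable_const).fst)
  have hint := h.integrable_mul_profileDeriv hm (C := 1) fun z => by
    rw [abs_mul]; exact mul_le_one₀ (hA.abs_le _) (abs_nonneg _) (hA.abs_le _)
  rw [h.integral_spectralMeasure hA hFm hFb, integral_phaseMeasure h.pos hint,
    ← Finset.sum_neg_distrib, Complex.ofReal_sum]
  refine Finset.sum_congr rfl fun i _ => ?_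
  have hi := integrable_comp_angleOrbit h.pos hint i
  rw [integral_prod _ hi]
  have hs := h.hasSum_integral_mode hA i hFm hFb
  have hs' := hasSum_integral_of_summable_integral_norm (μ := actionMeasure M₀ i)
    (F := fun (m : ℤ) E => (modeWeight M₀ fhat A i m E : ℂ) *
      Complex.exp (-Complex.I * (m * orbitFrequency M₀ i E : ℝ) * t))
    (fun m => h.integrable_mode hA i hFm hFb m) ((h.summable_integral_modeWeight hA i).congr
      fun m => integral_congr_ae ?_)
  swap
  · filter_upwards [ae_mem_energyRange M₀ i] with E hE
    have hn : ‖Complex.exp (-Complex.I * (m * orbitFrequency M₀ i E : ℝ) * t)‖ = 1 := by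
      rw [Complex.norm_exp]; simp
    rw [norm_mul, hn, mul_one, Complex.norm_real, Real.norm_eq_abs,
      abs_of_nonneg (h.modeWeight_nonneg hE m)]
  rw [hs.unique hs', ← integral_neg, ← integral_complex_ofReal]
  refine integral_congr_ae ?_
  filter_upwards [ae_mem_energyRange M₀ i] with E hE
  -- Moving back by the time t shifts the angle by Ωt, so Parseval is used with the shift τ = Ωt.
  have h3 := h.hasSum_modeWeight_mul_exp hA hE (orbitFrequency M₀ i E * t)
  have h4 : ∀ m : ℤ, Complex.exp (-Complex.I * (m * orbitFrequency M₀ i E : ℝ) * t)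
      = Complex.exp (-Complex.I * m * (orbitFrequency M₀ i E * t : ℝ)) := fun m => by
    congr 1; push_cast; ring
  simp only [h4]
  rw [h3.tsum_eq]
  congr 1
  rw [intervalIntegral.integral_of_le (by linarith [Real.pi_pos]), neg_mul,
    ← integral_const_mul]
  congr 1
  refine integral_congr_ae (Eventually.of_forall fun θ => ?_)
  simp only [profileDeriv, energy_angleOrbit h.pos hE, orbit_angleOrbit h.pos hE, orbitSignal]
  rw [mul_neg, ← sub_eq_add_neg, orbitFrequency]
  ring

theorem spectralMeasure_real_univ (h : IsMonotoneEquilibrium f₀ M₀ fhat) (hA : IsObservable A) :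
    (spectralMeasure M₀ fhat A).real univ
      = -∫ z, A z.1 ^ 2 * profileDeriv M₀ fhat z ∂phaseMeasure := by
  have h1 := h.integral_exp_spectralMeasure hA 0
  simp only [Complex.ofReal_zero, mul_zero, Complex.exp_zero, neg_zero, orbit_zero, ← sq] at h1
  simp only [integral_const, Complex.real_smul, mul_one] at h1
  exact_mod_cast h1

/-- Because Ω > 0, the value mΩ is 0 only for m = 0: the atom at 0 is the zeroth harmonic, and it is
subtracted from the total mass. -/
theorem spectralMeasure_real_compl_zero (h : IsMonotoneEquilibrium f₀ M₀ fhat)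
    (hA : IsObservable A) :
    (spectralMeasure M₀ fhat A).real {0}ᶜ
      = -(∫ z, A z.1 ^ 2 * profileDeriv M₀ fhat z ∂phaseMeasure)
        - ∑ i, ∫ E, modeWeight M₀ fhat A i 0 E ∂actionMeasure M₀ i := by
  have hfin := h.isFiniteMeasure_spectralMeasure hA
  have hFm : Measurable (({0}ᶜ : Set ℝ).indicator fun _ => (1 : ℂ)) :=
    measurable_const.indicator (measurableSet_singleton 0).compl
  have hFb : ∀ y, ‖({0}ᶜ : Set ℝ).indicator (fun _ => (1 : ℂ)) y‖ ≤ 1 := fun y => by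
    by_cases hy : y ∈ ({0}ᶜ : Set ℝ)
    · simp [indicator_of_mem hy]
    · simp [indicator_of_notMem hy]
  have hGm : Measurable fun _ : ℝ => (1 : ℂ) := measurable_const
  have hGb : ∀ y : ℝ, ‖(fun _ : ℝ => (1 : ℂ)) y‖ ≤ 1 := by simp
  have key : ∀ i, (∫ y, (1 : ℂ) ∂regionSpectralMeasure M₀ fhat A i)
      - ∫ y, ({0}ᶜ : Set ℝ).indicator (fun _ => (1 : ℂ)) y ∂regionSpectralMeasure M₀ fhat A i
      = ((∫ E, modeWeight M₀ fhat A i 0 E ∂actionMeasure M₀ i : ℝ) : ℂ) := by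
    intro i
    have h1 := (h.hasSum_integral_mode hA i hGm hGb).sub (h.hasSum_integral_mode hA i hFm hFb)
    refine h1.unique ?_
    have h2 := hasSum_single (f := fun m : ℤ =>
      (∫ E, (modeWeight M₀ fhat A i m E : ℂ) * 1 ∂actionMeasure M₀ i) -
      ∫ E, (modeWeight M₀ fhat A i m E : ℂ) *
        ({0}ᶜ : Set ℝ).indicator (fun _ => (1 : ℂ)) (m * orbitFrequency M₀ i E)
        ∂actionMeasure M₀ i) 0 fun m hm => by
      rw [sub_eq_zero]
      refine integral_congr_ae ?_
      filter_upwards [ae_mem_energyRange M₀ i] with E hE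
      rw [indicator_of_mem]
      exact mul_ne_zero (Int.cast_ne_zero.2 hm) (orbitFrequency_pos h.pos hE).ne'
    convert! h2 using 1
    simp [integral_complex_ofReal]
  have h3 := Finset.sum_congr rfl fun i (_ : i ∈ Finset.univ) => key i
  rw [Finset.sum_sub_distrib, ← h.integral_spectralMeasure hA hGm hGb,
    ← h.integral_spectralMeasure hA hFm hFb, integral_indicator_const _
      (measurableSet_singleton 0).compl, integral_const, Complex.real_smul, Complex.real_smul,
    h.spectralMeasure_real_univ hA, mul_one, mul_one, ← Complex.ofReal_sum] at h3
  have h4 : -(∫ z, A z.1 ^ 2 * profileDeriv M₀ fhat z ∂phaseMeasure)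
      - (spectralMeasure M₀ fhat A).real {0}ᶜ
      = ∑ i, ∫ E, modeWeight M₀ fhat A i 0 E ∂actionMeasure M₀ i := by exact_mod_cast h3
  linarith

end IsMonotoneEquilibrium

end

section

/-! ### The dispersion functions in terms of the spectral measures -/

variable {f₀ : ℝ × ℝ → ℝ} {M₀ : ℝ} {fhat : ℝ → ℝ} {A : ℝ → ℝ}

/-- `a` is the family of Fourier coefficients of the observable `A` in angle-action coordinates. -/
def IsModeFamily (M₀ : ℝ) (A : ℝ → ℝ) (a : ℤ → Region → ℝ → ℂ) : Prop :=
  ∀ m i E, E ∈ energyRange M₀ i → a m i (action M₀ i E) = fourierMode (orbitSignal M₀ A i E) m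

theorem isModeFamily_cosCoeff (hM₀ : 0 < M₀) : IsModeFamily M₀ Real.cos (cosCoeff M₀) := by
  intro m i E hE
  simp only [cosCoeff, fourierMode, orbitSignal, angleAction_action hM₀ hE]

theorem isModeFamily_sinCoeff (hM₀ : 0 < M₀) : IsModeFamily M₀ Real.sin (sinCoeff M₀) := by
  intro m i E hE
  simp only [sinCoeff, fourierMode, orbitSignal, angleAction_action hM₀ hE]

theorem im_le_norm_sub (y : ℝ) (ω : ℂ) : |ω.im| ≤ ‖(y : ℂ) - ω‖ := by
  have := Complex.abs_im_le_norm ((y : ℂ) - ω)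
  simpa using this

theorem ofReal_sub_ne_zero (y : ℝ) {ω : ℂ} (hω : ω.im ≠ 0) : (y : ℂ) - ω ≠ 0 := by
  intro h0
  have := im_le_norm_sub y ω
  rw [h0, norm_zero] at this
  exact hω (abs_eq_zero.1 (le_antisymm this (abs_nonneg _)))

theorem measurable_div_sub (ω : ℂ) : Measurable fun y : ℝ => (y : ℂ) / (y - ω) := by fun_prop

theorem norm_div_sub_le {ω : ℂ} (hω : ω.im ≠ 0) (y : ℝ) :
    ‖(y : ℂ) / (y - ω)‖ ≤ 1 + ‖ω‖ / |ω.im| := by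
  have h0 := ofReal_sub_ne_zero y hω
  have h1 : (y : ℂ) / (y - ω) = 1 + ω / (y - ω) := by field_simp; ring
  rw [h1]
  refine (norm_add_le _ _).trans ?_
  rw [norm_one, norm_div]
  gcongr
  exact im_le_norm_sub y ω

/-- On the imaginary axis the bound does not depend on ε, unlike the one above; this is the
domination for the limit ε → 0+. -/
theorem norm_div_sub_mul_I_le {ε : ℝ} (y : ℝ) :
    ‖(y : ℂ) / (y - ε * Complex.I)‖ ≤ 1 := by
  rw [norm_div]
  refine div_le_one_of_le₀ ?_ (norm_nonneg _)
  have := Complex.abs_re_le_norm ((y : ℂ) - ε * Complex.I)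
  simpa using this

namespace IsMonotoneEquilibrium

/-- The chain rule f̃' = f̂' Ω turns m f̃'/(mΩ - ω) into f̂' · y/(y - ω) with y = mΩ, a bounded
function of y. -/
theorem dispersionIntegrand_action (h : IsMonotoneEquilibrium f₀ M₀ fhat)
    {a : ℤ → Region → ℝ → ℂ} (ha : IsModeFamily M₀ A a) (ω : ℂ) (m : ℤ) {i : Region} {E : ℝ}
    (hE : E ∈ energyRange M₀ i) :
    dispersionIntegrand M₀ fhat a ω m i (action M₀ i E)
      = (-(1 / (2 * Real.pi)) : ℂ) * ((modeWeight M₀ fhat A i m E : ℂ) *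
        (((m * orbitFrequency M₀ i E : ℝ) : ℂ) / ((m * orbitFrequency M₀ i E : ℝ) - ω))) := by
  rw [dispersionIntegrand, ha m i E hE, frequency_action h.pos hE, deriv_actionProfile_action h.pos
    hE (h.differentiableAt (neg_lt_of_mem_energyRange h.pos hE)), modeWeight, ← orbitFrequency]
  push_cast
  have : (Real.pi : ℂ) ≠ 0 := by exact_mod_cast Real.pi_ne_zero
  field_simp

theorem actionIntegrable_dispersionIntegrand (h : IsMonotoneEquilibrium f₀ M₀ fhat)
    (hA : IsObservable A) {a : ℤ → Region → ℝ → ℂ} (ha : IsModeFamily M₀ A a) {ω : ℂ}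
    (hω : ω.im ≠ 0) (m : ℤ) : ActionIntegrable M₀ (dispersionIntegrand M₀ fhat a ω m) := by
  intro i
  rw [integrableOn_actionRange_iff h.pos]
  refine ((h.integrable_mode hA i (measurable_div_sub ω) (norm_div_sub_le hω) m).const_mul
    (-(1 / (2 * Real.pi)) : ℂ)).congr ?_
  filter_upwards [ae_mem_energyRange M₀ i] with E hE
  rw [h.dispersionIntegrand_action ha ω m hE]

theorem hasSum_actionIntegral (h : IsMonotoneEquilibrium f₀ M₀ fhat)
    (hA : IsObservable A) {a : ℤ → Region → ℝ → ℂ} (ha : IsModeFamily M₀ A a) {ω : ℂ}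
    (hω : ω.im ≠ 0) :
    HasSum (fun m : ℤ => actionIntegral M₀ (dispersionIntegrand M₀ fhat a ω m))
      ((-(1 / (2 * Real.pi)) : ℂ) * ∫ y : ℝ, (y : ℂ) / (y - ω) ∂spectralMeasure M₀ fhat A) := by
  rw [h.integral_spectralMeasure hA (measurable_div_sub ω) (norm_div_sub_le hω)]
  have h1 := (hasSum_sum fun i (_ : i ∈ Finset.univ) => h.hasSum_integral_mode hA i
    (measurable_div_sub ω) (norm_div_sub_le hω)).mul_left (-(1 / (2 * Real.pi)) : ℂ)
  refine h1.congr_fun fun m => ?_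
  rw [Finset.mul_sum, sum_region, actionIntegral, setIntegral_actionRange h.pos,
    setIntegral_actionRange h.pos, setIntegral_actionRange h.pos]
  simp only [← integral_const_mul]
  congr 1
  · congr 1 <;> refine integral_congr_ae ?_ <;>
    · filter_upwards [ae_mem_energyRange M₀ _] with E hE
      rw [h.dispersionIntegrand_action ha ω m hE]
  · refine integral_congr_ae ?_
    filter_upwards [ae_mem_energyRange M₀ _] with E hE
    rw [h.dispersionIntegrand_action ha ω m hE]

theorem dispersionConverges (h : IsMonotoneEquilibrium f₀ M₀ fhat)
    (hA : IsObservable A) {a : ℤ → Region → ℝ → ℂ} (ha : IsModeFamily M₀ A a) {ω : ℂ}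
    (hω : ω.im ≠ 0) : DispersionConverges M₀ fhat a ω :=
  ⟨h.actionIntegrable_dispersionIntegrand hA ha hω, (h.hasSum_actionIntegral hA ha hω).summable⟩

theorem dispersion_eq (h : IsMonotoneEquilibrium f₀ M₀ fhat)
    (hA : IsObservable A) {a : ℤ → Region → ℝ → ℂ} (ha : IsModeFamily M₀ A a) {ω : ℂ}
    (hω : ω.im ≠ 0) :
    dispersion M₀ fhat a ω = 1 - ∫ y : ℝ, (y : ℂ) / (y - ω) ∂spectralMeasure M₀ fhat A := by
  rw [dispersion, (h.hasSum_actionIntegral hA ha hω).tsum_eq]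
  have : (Real.pi : ℂ) ≠ 0 := by exact_mod_cast Real.pi_ne_zero
  field_simp
  ring

/-- Dominated convergence: y/(y - iε) tends to 1 for y ≠ 0 and is identically 0 for y = 0, so the
limit loses exactly the atom at 0. -/
theorem tendsto_dispersion (h : IsMonotoneEquilibrium f₀ M₀ fhat)
    (hA : IsObservable A) {a : ℤ → Region → ℝ → ℂ} (ha : IsModeFamily M₀ A a) :
    Tendsto (fun ε : ℝ => dispersion M₀ fhat a (ε * Complex.I)) (𝓝[>] 0)
      (𝓝 ((1 - (spectralMeasure M₀ fhat A).real {0}ᶜ : ℝ) : ℂ)) := by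
  have hfin := h.isFiniteMeasure_spectralMeasure hA
  have h1 : Tendsto (fun ε : ℝ => ∫ y : ℝ, (y : ℂ) / (y - ε * Complex.I)
      ∂spectralMeasure M₀ fhat A) (𝓝[>] 0)
      (𝓝 (∫ y, ({0}ᶜ : Set ℝ).indicator (fun _ => (1 : ℂ)) y ∂spectralMeasure M₀ fhat A)) := by
    refine tendsto_integral_filter_of_dominated_convergence (fun _ => 1)
      (Eventually.of_forall fun ε => (measurable_div_sub _).aestronglyMeasurable)
      (Eventually.of_forall fun ε => Eventually.of_forall fun y => norm_div_sub_mul_I_le y)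
      (integrable_const _) (Eventually.of_forall fun y => ?_)
    by_cases hy : y = 0
    · simp [hy]
    · rw [indicator_of_mem (show y ∈ ({0}ᶜ : Set ℝ) from hy)]
      have hy' : (y : ℂ) ≠ 0 := by exact_mod_cast hy
      have h2 : ContinuousAt (fun ε : ℝ => (y : ℂ) / (y - ε * Complex.I)) 0 := by
        refine ContinuousAt.div (by fun_prop) (by fun_prop) (by simpa using hy')
      have h3 := h2.tendsto
      simp only [Complex.ofReal_zero, zero_mul, sub_zero, div_self hy'] at h3
      exact h3.mono_left nhdsWithin_le_nhds
  rw [integral_indicator_const _ (measurableSet_singleton 0).compl, Complex.real_smul,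
    mul_one] at h1
  have h2 := h1.const_sub 1
  rw [Complex.ofReal_sub, Complex.ofReal_one]
  refine h2.congr' ?_
  filter_upwards [self_mem_nhdsWithin] with ε hε
  have hε' : ((ε : ℂ) * Complex.I).im ≠ 0 := by simpa using (ne_of_gt hε)
  exact (h.dispersion_eq hA ha hε').symm

theorem criterionIntegrand_action (h : IsMonotoneEquilibrium f₀ M₀ fhat) {i : Region} {E : ℝ}
    (hE : E ∈ energyRange M₀ i) :
    criterionIntegrand M₀ fhat i (action M₀ i E)
      = -(1 / (2 * Real.pi)) * modeWeight M₀ fhat Real.cos i 0 E := by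
  rw [criterionIntegrand, isModeFamily_cosCoeff h.pos 0 i E hE, frequency_action h.pos hE,
    deriv_actionProfile_action h.pos hE (h.differentiableAt (neg_lt_of_mem_energyRange h.pos hE)),
    modeWeight, ← orbitFrequency]
  have := (orbitFrequency_pos h.pos hE).ne'
  field_simp [Real.pi_ne_zero]

theorem integrable_modeWeight (h : IsMonotoneEquilibrium f₀ M₀ fhat) (hA : IsObservable A)
    (i : Region) (m : ℤ) : Integrable (modeWeight M₀ fhat A i m) (actionMeasure M₀ i) := by
  have h1 := (h.integrable_mode hA i (F := fun _ => 1) measurable_const (C := 1) (by simp) m).re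
  simpa using h1

theorem criterionConverges (h : IsMonotoneEquilibrium f₀ M₀ fhat) :
    CriterionConverges M₀ fhat f₀ := by
  refine ⟨(h.integrable_sq_mul Real.continuous_cos Real.abs_cos_le_one).congr
    h.criterion_integrand_ae.symm, fun i => ?_⟩
  rw [integrableOn_actionRange_iff h.pos]
  refine ((h.integrable_modeWeight isObservable_cos i 0).const_mul (-(1 / (2 * Real.pi)))).congr ?_
  filter_upwards [ae_mem_energyRange M₀ i] with E hE
  rw [h.criterionIntegrand_action hE]

/-- Since ∂ₚf₀/p = f̂'(ℰ), the middle term of I[f₀] is minus the total mass of the cos measure, and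
the action integral adds its atom at 0 back. -/
theorem criterion_eq (h : IsMonotoneEquilibrium f₀ M₀ fhat) :
    criterion M₀ fhat f₀ = 1 - (spectralMeasure M₀ fhat Real.cos).real {0}ᶜ := by
  have h1 : 2 * Real.pi * actionIntegral M₀ (criterionIntegrand M₀ fhat)
      = -∑ i, ∫ E, modeWeight M₀ fhat Real.cos i 0 E ∂actionMeasure M₀ i := by
    have h2 : ∀ i, ∫ J in actionRange M₀ i, criterionIntegrand M₀ fhat i J
        = -(1 / (2 * Real.pi)) * ∫ E, modeWeight M₀ fhat Real.cos i 0 E ∂actionMeasure M₀ i := by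
      intro i
      rw [setIntegral_actionRange h.pos, ← integral_const_mul]
      refine integral_congr_ae ?_
      filter_upwards [ae_mem_energyRange M₀ i] with E hE
      rw [h.criterionIntegrand_action hE]
    rw [actionIntegral, h2, h2, h2, sum_region]
    field_simp [Real.pi_ne_zero]
    ring
  rw [criterion, h.integral_criterion, h1, h.spectralMeasure_real_compl_zero isObservable_cos]
  ring

/-- Angles are counted from q = 0, so time reversal makes q, hence sin q, an odd function of the
angle. -/
theorem fourierMode_sin_zero (M₀ : ℝ) (i : Region) (E : ℝ) :
    fourierMode (orbitSignal M₀ Real.sin i E) 0 = 0 := by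
  have h0 : (basePoint M₀ i E).1 = 0 := by cases i <;> rfl
  have hodd : ∀ θ, orbitSignal M₀ Real.sin i E (-θ) = -orbitSignal M₀ Real.sin i E θ := by
    intro θ
    have h1 := orbit_reverse M₀ 0 (basePoint M₀ i E).2 (-θ * (period M₀ i E / (2 * Real.pi)))
    have h2 : ((0 : ℝ), (basePoint M₀ i E).2) = basePoint M₀ i E := Prod.ext h0.symm rfl
    rw [neg_zero, h2] at h1
    simp only [orbitSignal, angleOrbit]
    have h3 : -(-θ * (period M₀ i E / (2 * Real.pi))) = θ * (period M₀ i E / (2 * Real.pi)) := by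
      ring
    rw [h1, h3, Real.sin_neg]
  have h3 : ∫ θ in (-Real.pi)..Real.pi, orbitSignal M₀ Real.sin i E θ = 0 := by
    have h4 := intervalIntegral.integral_comp_neg (a := -Real.pi) (b := Real.pi)
      (fun θ => orbitSignal M₀ Real.sin i E θ)
    simp only [hodd, intervalIntegral.integral_neg, neg_neg] at h4
    linarith
  simp only [fourierMode, Int.cast_zero, mul_zero, zero_mul, Complex.exp_zero, mul_one,
    intervalIntegral.integral_ofReal, h3, Complex.ofReal_zero]

theorem spectralMeasure_sin_real_compl_zero (h : IsMonotoneEquilibrium f₀ M₀ fhat) :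
    (spectralMeasure M₀ fhat Real.sin).real {0}ᶜ = 1 := by
  rw [h.spectralMeasure_real_compl_zero isObservable_sin, h.integral_sin_sq]
  simp [modeWeight, fourierMode_sin_zero]

end IsMonotoneEquilibrium

end

section

/-! ### The response of the transport operator to a mean-field force -/

variable {f₀ : ℝ × ℝ → ℝ} {M₀ : ℝ} {fhat : ℝ → ℝ} {A A' B B' : ℝ → ℝ} {s : ℂ}

/-- The perturbation `{A, f₀}` created by the potential `A(q)`, whose derivative is `A'`. -/
def forceSource (M₀ : ℝ) (fhat A' : ℝ → ℝ) (z : ℝ × ℝ) : ℂ :=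
  ((-(A' z.1 * (z.2 * profileDeriv M₀ fhat z)) : ℝ) : ℂ)

theorem measurable_forceSource (hA' : IsObservable A') : Measurable (forceSource M₀ fhat A') :=
  Complex.measurable_ofReal.comp (((hA'.continuous.measurable.comp measurable_fst).mul
    (measurable_snd.mul (measurable_profileDeriv M₀ fhat))).neg)

theorem integrable_forceSource (h : IsMonotoneEquilibrium f₀ M₀ fhat) (hA' : IsObservable A') :
    Integrable (forceSource M₀ fhat A') phaseMeasure :=
  ((h.integrable_snd_mul.bdd_mul (c := 1)
    (hA'.continuous.measurable.comp measurable_fst).aestronglyMeasurable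
    (Eventually.of_forall fun _ => hA'.abs_le _)).neg).ofReal

theorem forceSource_periodic (hA' : IsObservable A') (q p : ℝ) :
    forceSource M₀ fhat A' (q + 2 * Real.pi, p) = forceSource M₀ fhat A' (q, p) := by
  simp only [forceSource, profileDeriv, energy, Real.cos_add_two_pi, hA'.periodic q]

/-- The Laplace transform of an observable along the backward orbits. -/
def laplaceOrbit (M₀ : ℝ) (s : ℂ) (A : ℝ → ℝ) (z : ℝ × ℝ) : ℂ :=
  ∫ t : ℝ, Complex.exp (-s * t) * (A (orbit M₀ z (-t)).1 : ℂ) ∂timeMeasure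

theorem measurable_comp_orbit_neg (hA : IsObservable A) :
    Measurable fun x : ℝ × (ℝ × ℝ) => (A (orbit M₀ x.2 (-x.1)).1 : ℂ) :=
  Complex.measurable_ofReal.comp (hA.continuous.measurable.comp
    (measurable_orbit_comp measurable_snd measurable_fst.neg).fst)

theorem norm_observable_le (hA : IsObservable A) (q : ℝ) : ‖(A q : ℂ)‖ ≤ 1 := by
  rw [Complex.norm_real]; exact hA.abs_le q

/-- Along a backward orbit f̂'(ℰ) is constant and -A'(q) p is the time derivative of A(q(-t)), so
the resolvent integral can be integrated by parts. -/
theorem transportResolventFun_forceSource (hM₀ : 0 < M₀) (hs : 0 < s.re) (hA : IsObservable A)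
    (hA' : IsObservable A') (hd : ∀ q, HasDerivAt A (A' q) q) (z : ℝ × ℝ) :
    transportResolventFun M₀ s (forceSource M₀ fhat A') z
      = (profileDeriv M₀ fhat z : ℂ) * (-(A z.1 : ℂ) + s * laplaceOrbit M₀ s A z) := by
  have hder : ∀ t : ℝ, HasDerivAt (fun t : ℝ => (A (orbit M₀ z (-t)).1 : ℂ))
      ((-(A' (orbit M₀ z (-t)).1 * (orbit M₀ z (-t)).2) : ℝ) : ℂ) t := by
    intro t
    have h1 := (hasDerivAt_orbit_fst M₀ z (-t)).scomp t (hasDerivAt_neg t)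
    have h2 := (hd (orbit M₀ z (-t)).1).comp t h1
    exact (h2.congr_deriv (by simp)).ofReal_comp
  have horb : Measurable fun t : ℝ => orbit M₀ z (-t) :=
    measurable_orbit_comp measurable_const measurable_neg
  have hlap := integral_laplace_deriv hs hder
    ((integrable_exp_mul hs).mul_bdd (c := 1) (Complex.measurable_ofReal.comp
      (hA.continuous.measurable.comp horb.fst)).aestronglyMeasurable
      (Eventually.of_forall fun t => norm_observable_le hA _))
    ((integrable_exp_mul hs).mul_bdd (c := |z.2| + 2 * Real.sqrt M₀) (Complex.measurable_ofReal.comp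
      ((hA'.continuous.measurable.comp horb.fst).mul horb.snd).neg).aestronglyMeasurable
      (Eventually.of_forall fun t => by
        have h3 := abs_snd_orbit_le hM₀ (orbit M₀ z (-t)) t
        rw [orbit_orbit, neg_add_cancel, orbit_zero] at h3
        rw [Complex.norm_real, Real.norm_eq_abs, abs_neg, abs_mul]
        calc |A' (orbit M₀ z (-t)).1| * |(orbit M₀ z (-t)).2|
            ≤ 1 * |(orbit M₀ z (-t)).2| :=
              mul_le_mul_of_nonneg_right (hA'.abs_le _) (abs_nonneg _)
          _ ≤ _ := by
            rw [one_mul]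
            exact h3))
    (fun t => norm_observable_le hA _)
  rw [neg_zero, orbit_zero] at hlap
  rw [laplaceOrbit, ← hlap, transportResolventFun, ← integral_const_mul]
  refine integral_congr_ae (Eventually.of_forall fun t => ?_)
  simp only [cylinderFlow]
  rw [comp_wrap (forceSource_periodic hA'), forceSource, profileDeriv_orbit]
  push_cast; ring

namespace IsMonotoneEquilibrium

theorem integrable_observable_mul (h : IsMonotoneEquilibrium f₀ M₀ fhat) (hs : 0 < s.re)
    (hA : IsObservable A) (hB : IsObservable B) :
    Integrable (fun x : ℝ × (ℝ × ℝ) => Complex.exp (-s * x.1) *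
      ((B x.2.1 * A (orbit M₀ x.2 (-x.1)).1 * profileDeriv M₀ fhat x.2 : ℝ) : ℂ))
      (timeMeasure.prod phaseMeasure) := by
  have h1 : Integrable (fun x : ℝ × (ℝ × ℝ) => Complex.exp (-s * x.1) *
      (profileDeriv M₀ fhat x.2 : ℂ)) (timeMeasure.prod phaseMeasure) :=
    (integrable_exp_mul hs).mul_prod h.integrable_profileDeriv.ofReal
  have h2 := h1.bdd_mul (c := 1)
    (f := fun x : ℝ × (ℝ × ℝ) => (B x.2.1 : ℂ) * (A (orbit M₀ x.2 (-x.1)).1 : ℂ))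
    ((Complex.measurable_ofReal.comp
      (hB.continuous.measurable.comp measurable_snd.fst)).mul
      (measurable_comp_orbit_neg hA)).aestronglyMeasurable
    (Eventually.of_forall fun x => by
      rw [norm_mul]
      exact mul_le_one₀ (norm_observable_le hB _) (norm_nonneg _) (norm_observable_le hA _))
  refine h2.congr (Eventually.of_forall fun x => ?_)
  simp only
  push_cast; ring

theorem integral_observable_mul_response (h : IsMonotoneEquilibrium f₀ M₀ fhat) (hs : 0 < s.re)
    (hA : IsObservable A) (hA' : IsObservable A') (hd : ∀ q, HasDerivAt A (A' q) q)
    (hB : IsObservable B) :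
    ∫ z, (B z.1 : ℂ) * transportResolventFun M₀ s (forceSource M₀ fhat A') z ∂phaseMeasure
      = ((-∫ z, B z.1 * A z.1 * profileDeriv M₀ fhat z ∂phaseMeasure : ℝ) : ℂ)
        + s * ∫ t : ℝ, Complex.exp (-s * t) *
          ((∫ z, B z.1 * A (orbit M₀ z (-t)).1 * profileDeriv M₀ fhat z ∂phaseMeasure : ℝ) : ℂ)
          ∂timeMeasure := by
  have hi := h.integrable_observable_mul hs hA hB
  have hBA : Integrable (fun z : ℝ × ℝ => B z.1 * A z.1 * profileDeriv M₀ fhat z) phaseMeasure :=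
    h.integrable_mul_profileDeriv ((hB.continuous.measurable.comp measurable_fst).mul
      (hA.continuous.measurable.comp measurable_fst)) (C := 1) fun z => by
        rw [abs_mul]; exact mul_le_one₀ (hB.abs_le _) (abs_nonneg _) (hA.abs_le _)
  have h1 : ∀ z : ℝ × ℝ, (B z.1 : ℂ) * transportResolventFun M₀ s (forceSource M₀ fhat A') z
      = -((B z.1 * A z.1 * profileDeriv M₀ fhat z : ℝ) : ℂ)
        + s * ∫ t : ℝ, Complex.exp (-s * t) *
          ((B z.1 * A (orbit M₀ z (-t)).1 * profileDeriv M₀ fhat z : ℝ) : ℂ) ∂timeMeasure := by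
    intro z
    rw [transportResolventFun_forceSource h.pos hs hA hA' hd, laplaceOrbit]
    have h2 : ∫ t : ℝ, Complex.exp (-s * t) *
          ((B z.1 * A (orbit M₀ z (-t)).1 * profileDeriv M₀ fhat z : ℝ) : ℂ) ∂timeMeasure
        = (B z.1 * profileDeriv M₀ fhat z : ℂ) *
          ∫ t : ℝ, Complex.exp (-s * t) * (A (orbit M₀ z (-t)).1 : ℂ) ∂timeMeasure := by
      rw [← integral_const_mul]
      refine integral_congr_ae (Eventually.of_forall fun t => ?_)
      simp only; push_cast; ring
    rw [h2]; push_cast; ring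
  simp only [h1]
  rw [integral_add (f := fun z : ℝ × ℝ => -((B z.1 * A z.1 * profileDeriv M₀ fhat z : ℝ) : ℂ))
    hBA.ofReal.neg (hi.integral_prod_right.const_mul s), integral_neg,
    integral_const_mul, integral_complex_ofReal, Complex.ofReal_neg]
  congr 2
  rw [← integral_integral_swap (f := fun (t : ℝ) (z : ℝ × ℝ) => Complex.exp (-s * t) *
    ((B z.1 * A (orbit M₀ z (-t)).1 * profileDeriv M₀ fhat z : ℝ) : ℂ)) hi]
  simp only [integral_const_mul, integral_complex_ofReal]

/-- The autocorrelation is minus the Fourier transform of the spectral measure ν, and e^{-iyt} has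
the Laplace transform 1/(s + iy). Hence the mean is ∫ (1 - s/(s + iy)) dν = ∫ y/(y - is) dν, that
is, 1 - D(is). -/
theorem integral_observable_mul_response_self (h : IsMonotoneEquilibrium f₀ M₀ fhat)
    (hs : 0 < s.re) (hA : IsObservable A) (hA' : IsObservable A')
    (hd : ∀ q, HasDerivAt A (A' q) q) :
    ∫ z, (A z.1 : ℂ) * transportResolventFun M₀ s (forceSource M₀ fhat A') z ∂phaseMeasure
      = ∫ y : ℝ, (y : ℂ) / (y - Complex.I * s) ∂spectralMeasure M₀ fhat A := by
  have hfin := h.isFiniteMeasure_spectralMeasure hA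
  rw [h.integral_observable_mul_response hs hA hA' hd hA]
  have h1 : ∀ t : ℝ, ((∫ z, A z.1 * A (orbit M₀ z (-t)).1 * profileDeriv M₀ fhat z
      ∂phaseMeasure : ℝ) : ℂ)
      = -∫ y : ℝ, Complex.exp (-Complex.I * y * t) ∂spectralMeasure M₀ fhat A := by
    intro t
    rw [h.integral_exp_spectralMeasure hA t]; push_cast; ring
  have h2 := h.spectralMeasure_real_univ hA
  simp only [sq] at h2
  have h10 : ∫ t : ℝ, Complex.exp (-s * t) *
      (-∫ y : ℝ, Complex.exp (-Complex.I * y * t) ∂spectralMeasure M₀ fhat A) ∂timeMeasure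
      = -∫ t : ℝ, ∫ y : ℝ, Complex.exp (-s * t) * Complex.exp (-Complex.I * y * t)
        ∂spectralMeasure M₀ fhat A ∂timeMeasure := by
    simp only [mul_neg, integral_neg, ← integral_const_mul]
  simp only [h1, h10, ← h2]
  rw [mul_neg]
  have hi : Integrable (fun x : ℝ × ℝ => Complex.exp (-s * x.1) *
      Complex.exp (-Complex.I * x.2 * x.1)) (timeMeasure.prod (spectralMeasure M₀ fhat A)) := by
    have h3 : Integrable (fun x : ℝ × ℝ => Complex.exp (-s * x.1) * (1 : ℂ))
        (timeMeasure.prod (spectralMeasure M₀ fhat A)) :=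
      (integrable_exp_mul hs).mul_prod (integrable_const (1 : ℂ))
    have h4 := h3.mul_bdd (c := 1) (g := fun x : ℝ × ℝ => Complex.exp (-Complex.I * x.2 * x.1))
      (by fun_prop : Measurable fun x : ℝ × ℝ =>
        Complex.exp (-Complex.I * x.2 * x.1)).aestronglyMeasurable
      (Eventually.of_forall fun x => by rw [Complex.norm_exp]; simp)
    simpa using h4
  rw [integral_integral_swap (f := fun (t y : ℝ) => Complex.exp (-s * t) *
      Complex.exp (-Complex.I * y * t)) hi]
  have hre : ∀ y : ℝ, 0 < (s + Complex.I * y).re := fun y => by simpa using hs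
  have h5 : ∀ y : ℝ, ∫ t : ℝ, Complex.exp (-s * t) * Complex.exp (-Complex.I * y * t) ∂timeMeasure
      = 1 / (s + Complex.I * y) := by
    intro y
    have h6 := integral_exp_mul_complex_Ioi (a := -(s + Complex.I * y)) (by simpa using hs) 0
    simp only [Complex.ofReal_zero, mul_zero, Complex.exp_zero, neg_div_neg_eq] at h6
    rw [← h6]
    refine integral_congr_ae (Eventually.of_forall fun t => ?_)
    simp only
    rw [← Complex.exp_add]
    congr 1; ring
  have hi' := hi.integral_prod_right
  simp only [h5] at hi' ⊢
  rw [← integral_const_mul, ← sub_eq_add_neg]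
  have h7 : ((spectralMeasure M₀ fhat A).real univ : ℂ)
      = ∫ _ : ℝ, (1 : ℂ) ∂spectralMeasure M₀ fhat A := by simp
  rw [h7, ← integral_sub (integrable_const _) (hi'.const_mul s)]
  refine integral_congr_ae (Eventually.of_forall fun y => ?_)
  simp only
  have h8 : s + Complex.I * y ≠ 0 := fun h0 => by
    have := hre y
    rw [h0] at this
    simp at this
  have h9 : (y : ℂ) - Complex.I * s ≠ 0 := by
    intro h0
    apply h8
    linear_combination Complex.I * h0 + s * Complex.I_sq
  have h11 : 1 - s * (1 / (s + Complex.I * y)) = Complex.I * y / (s + Complex.I * y) := by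
    field_simp; ring
  rw [h11, div_eq_div_iff h8 h9]
  linear_combination (-(y : ℂ) * s) * Complex.I_sq

/-- The map z ↦ -z commutes with the flow and preserves ℰ and the measure, so the response to A
inherits the parity σ of A, while B has the opposite parity. This decouples the cos and sin
directions. -/
theorem integral_observable_mul_response_of_parity {σ : ℝ} (h : IsMonotoneEquilibrium f₀ M₀ fhat)
    (hs : 0 < s.re) (hA : IsObservable A) (hA' : IsObservable A')
    (hd : ∀ q, HasDerivAt A (A' q) q) (hAσ : ∀ q, A (-q) = σ * A q) (hBσ : ∀ q, B (-q) = -σ * B q)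
    (hσ : σ ^ 2 = 1) :
    ∫ z, (B z.1 : ℂ) * transportResolventFun M₀ s (forceSource M₀ fhat A') z ∂phaseMeasure = 0 := by
  have h1 : ∀ z : ℝ × ℝ,
      (B (-z).1 : ℂ) * transportResolventFun M₀ s (forceSource M₀ fhat A') (-z)
      = -((B z.1 : ℂ) * transportResolventFun M₀ s (forceSource M₀ fhat A') z) := by
    intro z
    have h2 : laplaceOrbit M₀ s A (-z) = σ * laplaceOrbit M₀ s A z := by
      rw [laplaceOrbit, laplaceOrbit, ← integral_const_mul]
      refine integral_congr_ae (Eventually.of_forall fun t => ?_)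
      simp only [orbit_neg, Prod.fst_neg, hAσ]
      push_cast; ring
    rw [transportResolventFun_forceSource h.pos hs hA hA' hd,
      transportResolventFun_forceSource h.pos hs hA hA' hd, h2, profileDeriv_neg, Prod.fst_neg,
      hAσ, hBσ]
    push_cast
    have h3 : (σ : ℂ) ^ 2 = 1 := by exact_mod_cast hσ
    linear_combination (-(B z.1 : ℂ) * (profileDeriv M₀ fhat z : ℂ) *
      (-(A z.1 : ℂ) + s * laplaceOrbit M₀ s A z)) * h3
  have h4 := measurePreserving_neg_phaseMeasure.integral_comp
    (MeasurableEquiv.neg (ℝ × ℝ)).measurableEmbedding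
    (fun z : ℝ × ℝ => (B z.1 : ℂ) * transportResolventFun M₀ s (forceSource M₀ fhat A') z)
  simp only [h1, integral_neg] at h4
  exact self_eq_neg.1 h4.symm

end IsMonotoneEquilibrium

end

section

/-! ### The linearized Vlasov operator -/

variable {f₀ : ℝ × ℝ → ℝ} {M₀ : ℝ} {fhat : ℝ → ℝ} {A A' B B' : ℝ → ℝ} {s : ℂ}

theorem isObservable_neg_sin : IsObservable fun q => -Real.sin q :=
  ⟨Real.continuous_sin.neg, fun q => by simp only [Real.sin_periodic q], fun q => by
    rw [abs_neg]; exact Real.abs_sin_le_one q⟩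

theorem integrable_observable_mul_perturbation (hA : IsObservable A) {f : ℝ × ℝ → ℂ}
    (hf : Integrable f phaseMeasure) : Integrable (fun z => (A z.1 : ℂ) * f z) phaseMeasure :=
  hf.bdd_mul (c := 1) (Complex.measurable_ofReal.comp
    (hA.continuous.measurable.comp measurable_fst)).aestronglyMeasurable
    (Eventually.of_forall fun _ => norm_observable_le hA _)

/-- The mean of an observable with respect to a perturbation. -/
def mean (hA : IsObservable A) : Perturbation →L[ℂ] ℂ :=
  LinearMap.mkContinuous
    { toFun := fun f => ∫ z, (A z.1 : ℂ) * f z ∂phaseMeasure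
      map_add' := fun f g => by
        rw [← integral_add (integrable_observable_mul_perturbation hA (integrable_coeFn f))
          (integrable_observable_mul_perturbation hA (integrable_coeFn g))]
        refine integral_congr_ae ?_
        filter_upwards [Lp.coeFn_add f g] with z hz
        rw [hz, Pi.add_apply]; ring
      map_smul' := fun c f => by
        rw [RingHom.id_apply, smul_eq_mul, ← integral_const_mul]
        refine integral_congr_ae ?_
        filter_upwards [Lp.coeFn_smul c f] with z hz
        rw [hz, Pi.smul_apply, smul_eq_mul]; ring }
    1 fun f => by
      simp only [LinearMap.coe_mk, AddHom.coe_mk]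
      rw [one_mul, L1.norm_eq_integral_norm]
      refine norm_integral_le_of_norm_le (integrable_coeFn f).norm (Eventually.of_forall fun z => ?_)
      rw [norm_mul]
      exact mul_le_of_le_one_left (norm_nonneg _) (norm_observable_le hA _)

theorem mean_apply (hA : IsObservable A) (f : Perturbation) :
    mean hA f = ∫ z, (A z.1 : ℂ) * f z ∂phaseMeasure := rfl

theorem meanField_perturbation {f : ℝ × ℝ → ℂ} (hf : Integrable f phaseMeasure) (q : ℝ) :
    meanField f q = -(Real.cos q * (∫ z, (Real.cos z.1 : ℂ) * f z ∂phaseMeasure)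
      + Real.sin q * ∫ z, (Real.sin z.1 : ℂ) * f z ∂phaseMeasure) := by
  have h1 := (integrable_observable_mul_perturbation isObservable_cos hf).const_mul
    (Real.cos q : ℂ)
  have h2 := (integrable_observable_mul_perturbation isObservable_sin hf).const_mul
    (Real.sin q : ℂ)
  rw [meanField, ← integral_const_mul, ← integral_const_mul, ← integral_add h1 h2]
  congr 1
  refine integral_congr_ae (Eventually.of_forall fun z => ?_)
  simp only [Complex.real_smul, Real.cos_sub]
  push_cast; ring

namespace IsMonotoneEquilibrium

theorem effHamiltonian_eq (h : IsMonotoneEquilibrium f₀ M₀ fhat) :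
    effHamiltonian f₀ = energy M₀ := by
  ext z
  have hc : Integrable (fun z => Real.cos z.1 * f₀ z) phaseMeasure :=
    h.stationary.integrable.bdd_mul (c := 1)
      (Real.continuous_cos.measurable.comp measurable_fst).aestronglyMeasurable
      (Eventually.of_forall fun z => Real.abs_cos_le_one _)
  have hsn : Integrable (fun z => Real.sin z.1 * f₀ z) phaseMeasure :=
    h.stationary.integrable.bdd_mul (c := 1)
      (Real.continuous_sin.measurable.comp measurable_fst).aestronglyMeasurable
      (Eventually.of_forall fun z => Real.abs_sin_le_one _)
  have h1 := h.orderX_eq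
  have h2 := h.orderY_eq
  unfold orderX at h1
  unfold orderY at h2
  have h3 : ∫ w, Real.cos (z.1 - w.1) • f₀ w ∂phaseMeasure
      = Real.cos z.1 * (∫ w, Real.cos w.1 * f₀ w ∂phaseMeasure)
        + Real.sin z.1 * ∫ w, Real.sin w.1 * f₀ w ∂phaseMeasure := by
    rw [← integral_const_mul, ← integral_const_mul,
      ← integral_add (hc.const_mul _) (hsn.const_mul _)]
    refine integral_congr_ae (Eventually.of_forall fun w => ?_)
    simp only [smul_eq_mul, Real.cos_sub]; ring
  rw [effHamiltonian, meanField, h3, h1, h2, energy]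
  ring

theorem poisson_meanField (h : IsMonotoneEquilibrium f₀ M₀ fhat) {f : ℝ × ℝ → ℂ}
    (hf : Integrable f phaseMeasure) {z : ℝ × ℝ} (hz : z.2 ≠ 0) :
    poisson (fun w => meanField f w.1) (fun w => (f₀ w : ℂ)) z
      = -((∫ w, (Real.cos w.1 : ℂ) * f w ∂phaseMeasure) * forceSource M₀ fhat (fun q => -Real.sin q) z
        + (∫ w, (Real.sin w.1 : ℂ) * f w ∂phaseMeasure) * forceSource M₀ fhat Real.cos z) := by
  set a := ∫ w, (Real.cos w.1 : ℂ) * f w ∂phaseMeasure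
  set b := ∫ w, (Real.sin w.1 : ℂ) * f w ∂phaseMeasure
  have h1 : deriv (fun q : ℝ => meanField f q) z.1
      = -(((-Real.sin z.1 : ℝ) : ℂ) * a + ((Real.cos z.1 : ℝ) : ℂ) * b) := by
    have h2 : (fun q : ℝ => meanField f q) = fun q : ℝ => -((Real.cos q : ℂ) * a
        + (Real.sin q : ℂ) * b) := funext fun q => meanField_perturbation hf q
    rw [h2]
    exact ((((Real.hasDerivAt_cos z.1).ofReal_comp).mul_const a).add
      (((Real.hasDerivAt_sin z.1).ofReal_comp).mul_const b)).neg.deriv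
  have h3 : deriv (fun p : ℝ => (f₀ (z.1, p) : ℂ)) z.2
      = ((z.2 * deriv fhat (energy M₀ z) : ℝ) : ℂ) :=
    ((h.hasDerivAt_snd z.1 hz).ofReal_comp).deriv
  simp only [poisson, deriv_const, zero_mul, zero_sub]
  rw [h1, h3]
  simp only [forceSource, profileDeriv]
  push_cast; ring

/-- The linearized Vlasov equation as a transport equation with a mean-field source. -/
theorem linearizedVlasov_iff (h : IsMonotoneEquilibrium f₀ M₀ fhat) (f g : Perturbation) :
    LinearizedVlasov f₀ f (s • f - g) ↔ TransportEquation M₀ s f fun z => g z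
      + ((mean isObservable_cos f) * forceSource M₀ fhat (fun q => -Real.sin q) z
        + (mean isObservable_sin f) * forceSource M₀ fhat Real.cos z) := by
  set K : ℝ × ℝ → ℂ := fun z =>
    ((mean isObservable_cos f) * forceSource M₀ fhat (fun q => -Real.sin q) z
      + (mean isObservable_sin f) * forceSource M₀ fhat Real.cos z) with hK
  have hKi : Integrable K phaseMeasure := ((integrable_forceSource h isObservable_neg_sin).const_mul _).add
    ((integrable_forceSource h isObservable_cos).const_mul _)
  refine forall_congr' fun φ => forall_congr' fun hφ => ?_
  have hT : (fun z => f z * poisson (fun w => (effHamiltonian f₀ w : ℂ)) φ z)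
      = fun z => f z * transport M₀ φ z := by
    ext z
    rw [h.effHamiltonian_eq, poisson_energy hφ.contDiff]
  have h1 : ∫ z, poisson (fun w => meanField f w.1) (fun w => (f₀ w : ℂ)) z * φ z ∂phaseMeasure
      = -∫ z, K z * φ z ∂phaseMeasure := by
    rw [← integral_neg]
    refine integral_congr_ae ?_
    filter_upwards [ae_snd_ne_zero] with z hz
    rw [h.poisson_meanField (integrable_coeFn f) hz, hK, mean_apply, mean_apply, neg_mul]
  have h2 : ∫ z, (s • f - g : Perturbation) z * φ z ∂phaseMeasure
      = ∫ z, (s * f z - g z) * φ z ∂phaseMeasure := by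
    refine integral_congr_ae ?_
    filter_upwards [Lp.coeFn_sub (s • f) g, Lp.coeFn_smul s f] with z h3 h4
    rw [h3, Pi.sub_apply, h4, Pi.smul_apply, smul_eq_mul]
  have h3 : ∫ z, (s * f z - (g z + K z)) * φ z ∂phaseMeasure
      = ∫ z, (s * f z - g z) * φ z ∂phaseMeasure - ∫ z, K z * φ z ∂phaseMeasure := by
    have h4 := integral_sub (integrable_mul_testFunction (((integrable_coeFn f).const_mul s).sub
      (integrable_coeFn g)) hφ) (integrable_mul_testFunction hKi hφ)
    simp only [Pi.sub_apply] at h4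
    rw [← h4]
    refine integral_congr_ae (Eventually.of_forall fun z => ?_)
    simp only; ring
  rw [hT, h1, h2, h3, sub_neg_eq_add, sub_eq_iff_eq_add]

end IsMonotoneEquilibrium

/-- The source of a potential as an element of `L¹`. -/
def source (h : IsMonotoneEquilibrium f₀ M₀ fhat) (hA' : IsObservable A') : Perturbation :=
  (integrable_forceSource h hA').toL1

/-- The response of the transport operator to a potential. -/
def response (h : IsMonotoneEquilibrium f₀ M₀ fhat) (hs : 0 < s.re) (hA' : IsObservable A') :
    Perturbation := transportResolvent h.pos hs (source h hA')

/-- The L¹ class of the source and its explicit formula give the same response almost everywhere, so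
the mean can be computed from the formula. -/
theorem mean_response (h : IsMonotoneEquilibrium f₀ M₀ fhat) (hs : 0 < s.re)
    (hA' : IsObservable A') (hB : IsObservable B) :
    mean hB (response h hs hA') = ∫ z, (B z.1 : ℂ) *
      transportResolventFun M₀ s (forceSource M₀ fhat A') z ∂phaseMeasure := by
  have h1 : response h hs hA' =ᵐ[phaseMeasure]
      transportResolventFun M₀ s (forceSource M₀ fhat A') := by
    refine (coeFn_transportResolvent h.pos hs _).trans ?_
    refine TransportEquation.ae_eq h.pos hs (s := s)
      (integrable_transportResolventFun h.pos hs (measurable_coeFn _) (integrable_coeFn _))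
      (integrable_transportResolventFun h.pos hs (measurable_forceSource hA')
        (integrable_forceSource h hA')) (integrable_coeFn _) (integrable_forceSource h hA')
      (Integrable.coeFn_toL1 (integrable_forceSource h hA'))
      (transportEquation_transportResolventFun h.pos hs (measurable_coeFn _) (integrable_coeFn _))
      (transportEquation_transportResolventFun h.pos hs (measurable_forceSource hA')
        (integrable_forceSource h hA'))
  rw [mean_apply]
  refine integral_congr_ae ?_
  filter_upwards [h1] with z hz
  rw [hz]

/-- The response to the potential `cos q`. -/
abbrev responseX (h : IsMonotoneEquilibrium f₀ M₀ fhat) (hs : 0 < s.re) : Perturbation :=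
  response h hs isObservable_neg_sin

/-- The response to the potential `sin q`. -/
abbrev responseY (h : IsMonotoneEquilibrium f₀ M₀ fhat) (hs : 0 < s.re) : Perturbation :=
  response h hs isObservable_cos

/-- The response function `∫ y / (y - i s) dν(y)`, where `ν` is the spectral measure of `A`. -/
def responseFunction (M₀ : ℝ) (fhat A : ℝ → ℝ) (s : ℂ) : ℂ :=
  ∫ y : ℝ, (y : ℂ) / (y - Complex.I * s) ∂spectralMeasure M₀ fhat A

namespace IsMonotoneEquilibrium

theorem mean_cos_responseX (h : IsMonotoneEquilibrium f₀ M₀ fhat) (hs : 0 < s.re) :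
    mean isObservable_cos (responseX h hs) = responseFunction M₀ fhat Real.cos s := by
  rw [mean_response, h.integral_observable_mul_response_self hs isObservable_cos
    isObservable_neg_sin Real.hasDerivAt_cos, responseFunction]

theorem mean_sin_responseY (h : IsMonotoneEquilibrium f₀ M₀ fhat) (hs : 0 < s.re) :
    mean isObservable_sin (responseY h hs) = responseFunction M₀ fhat Real.sin s := by
  rw [mean_response, h.integral_observable_mul_response_self hs isObservable_sin
    isObservable_cos Real.hasDerivAt_sin, responseFunction]

theorem mean_sin_responseX (h : IsMonotoneEquilibrium f₀ M₀ fhat) (hs : 0 < s.re) :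
    mean isObservable_sin (responseX h hs) = 0 := by
  rw [mean_response, h.integral_observable_mul_response_of_parity (σ := 1) hs isObservable_cos
    isObservable_neg_sin Real.hasDerivAt_cos] <;> simp

theorem mean_cos_responseY (h : IsMonotoneEquilibrium f₀ M₀ fhat) (hs : 0 < s.re) :
    mean isObservable_cos (responseY h hs) = 0 := by
  rw [mean_response, h.integral_observable_mul_response_of_parity (σ := -1) hs isObservable_sin
    isObservable_cos Real.hasDerivAt_sin] <;> simp

/-- The mean-field term depends on f only through two scalars, so after applying (s - T)⁻¹ the
equation is a rank-two perturbation of the identity. -/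
theorem linearizedVlasov_iff_eq (h : IsMonotoneEquilibrium f₀ M₀ fhat) (hs : 0 < s.re)
    (f g : Perturbation) :
    LinearizedVlasov f₀ f (s • f - g) ↔ f = transportResolvent h.pos hs g
      + (mean isObservable_cos f • responseX h hs + mean isObservable_sin f • responseY h hs) := by
  rw [h.linearizedVlasov_iff, responseX, responseY, response, response, ← map_smul, ← map_smul,
    ← map_add, ← map_add, ← transportEquation_iff]
  set a := mean isObservable_cos f
  set b := mean isObservable_sin f
  have h1 : (fun z => g z + (a * forceSource M₀ fhat (fun q => -Real.sin q) z
      + b * forceSource M₀ fhat Real.cos z)) =ᵐ[phaseMeasure]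
      (g + (a • source h isObservable_neg_sin + b • source h isObservable_cos) : Perturbation) := by
    filter_upwards [Lp.coeFn_add g (a • source h isObservable_neg_sin + b • source h isObservable_cos),
      Lp.coeFn_add (a • source h isObservable_neg_sin) (b • source h isObservable_cos),
      Lp.coeFn_smul a (source h isObservable_neg_sin), Lp.coeFn_smul b (source h isObservable_cos),
      Integrable.coeFn_toL1 (integrable_forceSource h isObservable_neg_sin),
      Integrable.coeFn_toL1 (integrable_forceSource h isObservable_cos)] with z e1 e2 e3 e4 e5 e6
    rw [e1, Pi.add_apply, e2, Pi.add_apply, e3, e4, Pi.smul_apply, Pi.smul_apply, source, source,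
      e5, e6, smul_eq_mul, smul_eq_mul]
  exact ⟨fun h2 => h2.congr EventuallyEq.rfl h1, fun h2 => h2.congr EventuallyEq.rfl h1.symm⟩

/-- Taking means of the fixed-point equation gives (1 - x) mean_cos f = mean_cos (T g) and the
analogous equation for sin, without cross terms; here `T` is (s - T)⁻¹ of the free transport. -/
theorem mem_vlasovResolventSet (h : IsMonotoneEquilibrium f₀ M₀ fhat) (hs : 0 < s.re)
    (hX : responseFunction M₀ fhat Real.cos s ≠ 1) (hY : responseFunction M₀ fhat Real.sin s ≠ 1) :
    s ∈ vlasovResolventSet f₀ := by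
  set T := transportResolvent h.pos hs
  set x := responseFunction M₀ fhat Real.cos s
  set y := responseFunction M₀ fhat Real.sin s
  have hx : 1 - x ≠ 0 := sub_ne_zero.2 hX.symm
  have hy : 1 - y ≠ 0 := sub_ne_zero.2 hY.symm
  have hcx : mean isObservable_cos (responseX h hs) = x := h.mean_cos_responseX hs
  have hsy : mean isObservable_sin (responseY h hs) = y := h.mean_sin_responseY hs
  have hsx := h.mean_sin_responseX hs
  have hcy := h.mean_cos_responseY hs
  -- The inverse is obtained by inserting the solved means into the fixed-point equation.
  refine ⟨T + (((1 - x)⁻¹ • ((mean isObservable_cos).comp T)).smulRight (responseX h hs)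
    + ((1 - y)⁻¹ • ((mean isObservable_sin).comp T)).smulRight (responseY h hs)), fun f g => ?_⟩
  rw [h.linearizedVlasov_iff_eq hs]
  simp only [add_apply, ContinuousLinearMap.smulRight_apply,
    smul_apply, ContinuousLinearMap.comp_apply, smul_eq_mul]
  set R : Perturbation := T g + (((1 - x)⁻¹ * mean isObservable_cos (T g)) • responseX h hs
    + ((1 - y)⁻¹ * mean isObservable_sin (T g)) • responseY h hs) with hR
  have key : ∀ f : Perturbation, mean isObservable_cos f = (1 - x)⁻¹ * mean isObservable_cos (T g) →
      mean isObservable_sin f = (1 - y)⁻¹ * mean isObservable_sin (T g) →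
      (f = T g + (mean isObservable_cos f • responseX h hs
        + mean isObservable_sin f • responseY h hs) ↔ f = R) := by
    intro f h1 h2
    rw [h1, h2]
  constructor
  · intro h1
    refine (key f ?_ ?_).1 h1
    · have h2 := congrArg (mean isObservable_cos) h1
      simp only [map_add, map_smul, hcx, hcy, smul_eq_mul, mul_zero, add_zero] at h2
      rw [inv_mul_eq_div, eq_div_iff hx]
      linear_combination h2
    · have h2 := congrArg (mean isObservable_sin) h1
      simp only [map_add, map_smul, hsx, hsy, smul_eq_mul, mul_zero, zero_add] at h2
      rw [inv_mul_eq_div, eq_div_iff hy]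
      linear_combination h2
  · intro h1
    refine (key f ?_ ?_).2 h1
    · have h2 := congrArg (mean isObservable_cos) h1
      simp only [hR, map_add, map_smul, hcx, hcy, smul_eq_mul, mul_zero, add_zero] at h2
      rw [h2]; field_simp; ring
    · have h2 := congrArg (mean isObservable_sin) h1
      simp only [hR, map_add, map_smul, hsx, hsy, smul_eq_mul, mul_zero, zero_add] at h2
      rw [h2]; field_simp; ring

/-- The response to cos q is then an eigenfunction with eigenvalue s: its cos mean is 1 and its sin
mean 0, so it solves the equation with g = 0 and is not zero. -/
theorem mem_vlasovSpectrum (h : IsMonotoneEquilibrium f₀ M₀ fhat) (hs : 0 < s.re)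
    (hX : responseFunction M₀ fhat Real.cos s = 1) : s ∈ vlasovSpectrum f₀ := by
  rintro ⟨R, hR⟩
  have hcx := h.mean_cos_responseX hs
  have hsx := h.mean_sin_responseX hs
  have h1 : responseX h hs = R 0 := by
    rw [← hR, h.linearizedVlasov_iff_eq hs, hcx, hsx, hX]
    simp
  rw [map_zero] at h1
  rw [h1, map_zero, hX] at hcx
  exact zero_ne_one hcx

end IsMonotoneEquilibrium

end

section

/-! ### Zeros of the dispersion functions -/

variable {f₀ : ℝ × ℝ → ℝ} {M₀ : ℝ} {fhat : ℝ → ℝ} {A : ℝ → ℝ} {s : ℂ}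

theorem sq_add_sq_ne_zero (hs : 0 < s.re) (y : ℝ) : (y : ℂ) ^ 2 + s ^ 2 ≠ 0 := by
  have h1 : (y : ℂ) - Complex.I * s ≠ 0 := ofReal_sub_ne_zero y (by simpa using hs.ne')
  have h2 : (y : ℂ) + Complex.I * s ≠ 0 := by
    have := ofReal_sub_ne_zero y (ω := -(Complex.I * s)) (by simpa using hs.ne')
    rwa [sub_neg_eq_add] at this
  have h3 : (y : ℂ) ^ 2 + s ^ 2 = (y - Complex.I * s) * (y + Complex.I * s) := by
    linear_combination (s ^ 2) * Complex.I_sq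
  rw [h3]
  exact mul_ne_zero h1 h2

theorem symmetrized_div_sub (hs : 0 < s.re) (y : ℝ) :
    (y : ℂ) ^ 2 / (y ^ 2 + s ^ 2) = (1 / 2) * ((y : ℂ) / (y - Complex.I * s)
      + ((-y : ℝ) : ℂ) / ((-y : ℝ) - Complex.I * s)) := by
  have h1 : (y : ℂ) - Complex.I * s ≠ 0 := ofReal_sub_ne_zero y (by simpa using hs.ne')
  have h2 : ((-y : ℝ) : ℂ) - Complex.I * s ≠ 0 := ofReal_sub_ne_zero (-y) (by simpa using hs.ne')
  rw [div_add_div _ _ h1 h2, ← mul_div_assoc, div_eq_div_iff (sq_add_sq_ne_zero hs y)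
    (mul_ne_zero h1 h2)]
  push_cast
  linear_combination (y : ℂ) ^ 2 * s ^ 2 * Complex.I_sq

namespace IsMonotoneEquilibrium

theorem integrable_symmetrized (h : IsMonotoneEquilibrium f₀ M₀ fhat) (hA : IsObservable A)
    (hs : 0 < s.re) :
    Integrable (fun y : ℝ => (y : ℂ) ^ 2 / (y ^ 2 + s ^ 2)) (spectralMeasure M₀ fhat A) := by
  have hfin := h.isFiniteMeasure_spectralMeasure hA
  have hω : (Complex.I * s).im ≠ 0 := by simpa using hs.ne'
  have hb := norm_div_sub_le hω
  have hm : Measurable fun y : ℝ => (y : ℂ) ^ 2 / (y ^ 2 + s ^ 2) := by fun_prop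
  refine .of_bound hm.aestronglyMeasurable (1 / 2 * ((1 + ‖Complex.I * s‖ / |(Complex.I * s).im|)
    + (1 + ‖Complex.I * s‖ / |(Complex.I * s).im|))) (Eventually.of_forall fun y => ?_)
  rw [symmetrized_div_sub hs, norm_mul]
  have h2 : ‖(1 / 2 : ℂ)‖ = 1 / 2 := by simp
  rw [h2]
  gcongr
  exact (norm_add_le _ _).trans (add_le_add (hb y) (hb (-y)))

/-- Averaging over y and -y, allowed by the symmetry of the spectral measure, makes the integrand a
function of s². It is real and positive for real s > 0 and y ≠ 0. -/
theorem responseFunction_eq (h : IsMonotoneEquilibrium f₀ M₀ fhat) (hA : IsObservable A)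
    (hs : 0 < s.re) :
    responseFunction M₀ fhat A s
      = ∫ y : ℝ, (y : ℂ) ^ 2 / (y ^ 2 + s ^ 2) ∂spectralMeasure M₀ fhat A := by
  have hfin := h.isFiniteMeasure_spectralMeasure hA
  have hω : (Complex.I * s).im ≠ 0 := by simpa using hs.ne'
  have hb := norm_div_sub_le hω
  have hm := measurable_div_sub (Complex.I * s)
  have h1 := h.integral_spectralMeasure_neg hA hm hb
  have i1 : Integrable (fun y : ℝ => (y : ℂ) / (y - Complex.I * s)) (spectralMeasure M₀ fhat A) :=
    .of_bound hm.aestronglyMeasurable _ (Eventually.of_forall hb)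
  have i2 : Integrable (fun y : ℝ => ((-y : ℝ) : ℂ) / ((-y : ℝ) - Complex.I * s))
      (spectralMeasure M₀ fhat A) :=
    .of_bound (hm.comp measurable_neg).aestronglyMeasurable _ (Eventually.of_forall fun y => hb (-y))
  simp only [symmetrized_div_sub hs]
  rw [integral_const_mul, integral_add i1 i2, h1, responseFunction]
  ring

/-- If the spectral measure is carried by `{0}`, the response function vanishes. -/
theorem responseFunction_eq_zero (hae : ∀ᵐ y ∂spectralMeasure M₀ fhat A, y = 0) :
    responseFunction M₀ fhat A s = 0 := by
  rw [responseFunction]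
  refine integral_eq_zero_of_ae ?_
  filter_upwards [hae] with y hy
  simp [hy]

/-- In both cases below, the value 1 would force the spectral measure to sit at 0, where the
response function is 0. The borderline mass 1 is included, as the sin direction requires. -/
theorem responseFunction_ne_one (h : IsMonotoneEquilibrium f₀ M₀ fhat) (hA : IsObservable A)
    (hs : 0 < s.re) (hν : (spectralMeasure M₀ fhat A).real {0}ᶜ ≤ 1) :
    responseFunction M₀ fhat A s ≠ 1 := by
  have hfin := h.isFiniteMeasure_spectralMeasure hA
  intro h1
  have hi := h.integrable_symmetrized hA hs
  have hG := h.responseFunction_eq hA hs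
  rw [h1] at hG
  suffices hae : ∀ᵐ y ∂spectralMeasure M₀ fhat A, y = 0 by
    rw [responseFunction_eq_zero hae] at h1
    exact zero_ne_one h1
  by_cases him : s.im = 0
  -- Real s: y²/(y² + σ²) is below the indicator of y ≠ 0, strictly for y ≠ 0. The indicator has
  -- integral at most 1, so an integral equal to 1 leaves no mass off 0.
  · obtain ⟨σ, rfl⟩ : ∃ σ : ℝ, s = σ := ⟨s.re, Complex.ext rfl (by simpa using him)⟩
    rw [Complex.ofReal_re] at hs
    have hr : ∀ y : ℝ, (y : ℂ) ^ 2 / (y ^ 2 + (σ : ℂ) ^ 2) = ((y ^ 2 / (y ^ 2 + σ ^ 2) : ℝ) : ℂ) :=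
      fun y => by push_cast; rfl
    simp only [hr] at hG hi
    rw [integral_complex_ofReal] at hG
    have hG' : ∫ y : ℝ, y ^ 2 / (y ^ 2 + σ ^ 2) ∂spectralMeasure M₀ fhat A = 1 := by
      exact_mod_cast hG.symm
    have hi' : Integrable (fun y : ℝ => y ^ 2 / (y ^ 2 + σ ^ 2)) (spectralMeasure M₀ fhat A) :=
      hi.re
    have hind : Integrable (({0}ᶜ : Set ℝ).indicator fun _ => (1 : ℝ))
        (spectralMeasure M₀ fhat A) :=
      (integrable_const 1).indicator (measurableSet_singleton 0).compl
    have h0 : 0 ≤ fun y : ℝ => ({0}ᶜ : Set ℝ).indicator (fun _ => (1 : ℝ)) y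
        - y ^ 2 / (y ^ 2 + σ ^ 2) := by
      intro y
      simp only [Pi.zero_apply, sub_nonneg]
      by_cases hy : y = 0
      · simp [hy]
      · rw [indicator_of_mem (show y ∈ ({0}ᶜ : Set ℝ) from hy)]
        exact div_le_one_of_le₀ (by nlinarith) (by positivity)
    have h2 : ∫ y : ℝ, (({0}ᶜ : Set ℝ).indicator (fun _ => (1 : ℝ)) y
        - y ^ 2 / (y ^ 2 + σ ^ 2)) ∂spectralMeasure M₀ fhat A = 0 := by
      refine le_antisymm ?_ (integral_nonneg h0)
      rw [integral_sub hind hi', hG', integral_indicator_const _ (measurableSet_singleton 0).compl,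
        smul_eq_mul, mul_one]
      linarith
    filter_upwards [(integral_eq_zero_iff_of_nonneg h0 (hind.sub hi')).1 h2] with y hy
    by_contra hne
    rw [indicator_of_mem (show y ∈ ({0}ᶜ : Set ℝ) from hne), Pi.zero_apply, sub_eq_zero,
      eq_div_iff (by positivity)] at hy
    nlinarith [pow_pos hs 2]
  -- Non-real s: the imaginary part of the integrand has one sign for all y ≠ 0, and its integral
  -- must be Im 1 = 0.
  · have hF : ∀ y : ℝ, ((y : ℂ) ^ 2 / (y ^ 2 + s ^ 2)).im
        = -(2 * s.re * s.im) * (y ^ 2 / Complex.normSq (y ^ 2 + s ^ 2)) := by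
      intro y
      have e1 : ((y : ℂ) ^ 2).re = y ^ 2 := by rw [← Complex.ofReal_pow, Complex.ofReal_re]
      have e2 : ((y : ℂ) ^ 2).im = 0 := by rw [← Complex.ofReal_pow, Complex.ofReal_im]
      rw [Complex.div_im, Complex.add_im, e1, e2]
      have e3 : (s ^ 2).im = 2 * s.re * s.im := by rw [sq, Complex.mul_im]; ring
      rw [e3]; ring
    have hi' := hi.im
    have h2 : ∫ y : ℝ, ((y : ℂ) ^ 2 / (y ^ 2 + s ^ 2)).im ∂spectralMeasure M₀ fhat A = 0 := by
      have h3 := integral_im hi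
      simp only [RCLike.im_to_complex] at h3
      rw [h3, ← hG, Complex.one_im]
    simp only [hF, RCLike.im_to_complex] at h2 hi'
    rw [integral_const_mul] at h2
    have hc : -(2 * s.re * s.im) ≠ 0 := neg_ne_zero.2 (mul_ne_zero (by linarith) him)
    have h4 := (mul_eq_zero.1 h2).resolve_left hc
    have hi'' : Integrable (fun y : ℝ => y ^ 2 / Complex.normSq (y ^ 2 + s ^ 2))
        (spectralMeasure M₀ fhat A) := by
      refine (hi'.const_mul (-(2 * s.re * s.im))⁻¹).congr (Eventually.of_forall fun y => ?_)
      simp only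
      rw [← mul_assoc, inv_mul_cancel₀ hc, one_mul]
    have h0 : 0 ≤ fun y : ℝ => y ^ 2 / Complex.normSq (y ^ 2 + s ^ 2) := fun y =>
      div_nonneg (sq_nonneg _) (Complex.normSq_nonneg _)
    filter_upwards [(integral_eq_zero_iff_of_nonneg h0 hi'').1 h4] with y hy
    rw [Pi.zero_apply, div_eq_zero_iff] at hy
    rcases hy with hy | hy
    · exact pow_eq_zero_iff two_ne_zero |>.1 hy
    · exact absurd (Complex.normSq_eq_zero.1 hy) (sq_add_sq_ne_zero hs y)

theorem responseFunction_ofReal (h : IsMonotoneEquilibrium f₀ M₀ fhat) (hA : IsObservable A)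
    {σ : ℝ} (hσ : 0 < σ) :
    responseFunction M₀ fhat A σ
      = ((∫ y : ℝ, y ^ 2 / (y ^ 2 + σ ^ 2) ∂spectralMeasure M₀ fhat A : ℝ) : ℂ) := by
  rw [h.responseFunction_eq hA (by simpa using hσ), ← integral_complex_ofReal]
  refine integral_congr_ae (Eventually.of_forall fun y => ?_)
  simp only; push_cast; rfl

theorem tendsto_integral_symmetrized (h : IsMonotoneEquilibrium f₀ M₀ fhat) (hA : IsObservable A)
    {l : Filter ℝ} [l.IsCountablyGenerated] {g : ℝ → ℝ}
    (hg : ∀ y : ℝ, Tendsto (fun σ : ℝ => y ^ 2 / (y ^ 2 + σ ^ 2)) l (𝓝 (g y))) :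
    Tendsto (fun σ : ℝ => ∫ y : ℝ, y ^ 2 / (y ^ 2 + σ ^ 2) ∂spectralMeasure M₀ fhat A) l
      (𝓝 (∫ y, g y ∂spectralMeasure M₀ fhat A)) := by
  have hfin := h.isFiniteMeasure_spectralMeasure hA
  refine tendsto_integral_filter_of_dominated_convergence (fun _ => 1)
    (Eventually.of_forall fun σ => (by fun_prop :
      Measurable fun y : ℝ => y ^ 2 / (y ^ 2 + σ ^ 2)).aestronglyMeasurable)
    (Eventually.of_forall fun σ => Eventually.of_forall fun y => ?_)
    (integrable_const _) (Eventually.of_forall hg)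
  rw [Real.norm_eq_abs, abs_of_nonneg (by positivity)]
  exact div_le_one_of_le₀ (by nlinarith [sq_nonneg σ]) (by positivity)

/-- On (0, ∞) the response function is real and continuous, tends to the mass off 0 as σ → 0+ and to
0 as σ → ∞; the intermediate value theorem yields the growth rate σ. -/
theorem exists_responseFunction_eq_one (h : IsMonotoneEquilibrium f₀ M₀ fhat) (hA : IsObservable A)
    (hν : 1 < (spectralMeasure M₀ fhat A).real {0}ᶜ) :
    ∃ σ : ℝ, 0 < σ ∧ responseFunction M₀ fhat A σ = 1 := by
  set r : ℝ → ℝ := fun σ => ∫ y : ℝ, y ^ 2 / (y ^ 2 + σ ^ 2) ∂spectralMeasure M₀ fhat A with hr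
  have hcont : ContinuousOn r (Ioi 0) := by
    intro σ hσ
    refine (h.tendsto_integral_symmetrized hA (l := 𝓝[Ioi 0] σ) fun y => ?_)
    have hσ' : (0 : ℝ) < σ := hσ
    have : ContinuousAt (fun σ : ℝ => y ^ 2 / (y ^ 2 + σ ^ 2)) σ :=
      ContinuousAt.div (by fun_prop) (by fun_prop) (by positivity)
    exact this.continuousWithinAt
  have hzero : Tendsto r (𝓝[>] 0) (𝓝 ((spectralMeasure M₀ fhat A).real {0}ᶜ)) := by
    have h1 := h.tendsto_integral_symmetrized hA (l := 𝓝[>] (0 : ℝ))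
      (g := ({0}ᶜ : Set ℝ).indicator fun _ => (1 : ℝ)) fun y => by
      by_cases hy : y = 0
      · simp [hy]
      · rw [indicator_of_mem (show y ∈ ({0}ᶜ : Set ℝ) from hy)]
        have h2 : ContinuousAt (fun σ : ℝ => y ^ 2 / (y ^ 2 + σ ^ 2)) 0 :=
          ContinuousAt.div (by fun_prop) (by fun_prop) (by positivity)
        have h3 := h2.tendsto
        have h4 : y ^ 2 / (y ^ 2 + 0 ^ 2) = 1 := by field_simp; ring
        rw [h4] at h3
        exact h3.mono_left nhdsWithin_le_nhds
    rwa [integral_indicator_const _ (measurableSet_singleton 0).compl, smul_eq_mul, mul_one] at h1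
  have htop : Tendsto r atTop (𝓝 0) := by
    have h1 := h.tendsto_integral_symmetrized hA (l := atTop) (g := fun _ => 0) fun y => by
      refine Tendsto.div_atTop tendsto_const_nhds ?_
      exact tendsto_atTop_add_const_left _ _ (tendsto_pow_atTop two_ne_zero)
    simpa using h1
  obtain ⟨a, ha1, ha⟩ := ((hzero.eventually_const_lt hν).and self_mem_nhdsWithin).exists
  obtain ⟨b, hb1, hb⟩ := ((htop.eventually_lt_const one_pos).and (eventually_gt_atTop 0)).exists
  obtain ⟨σ, hσ, hσ1⟩ := isPreconnected_Ioi.intermediate_value (show b ∈ Ioi 0 from hb) ha hcont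
    ⟨hb1.le, ha1.le⟩
  refine ⟨σ, hσ, ?_⟩
  rw [h.responseFunction_ofReal hA hσ]
  exact_mod_cast hσ1

/-- Only the cos direction can destabilize: for sin the mass off 0 is exactly 1, the borderline
value that never produces a zero with Re s > 0. -/
theorem spectrallyStable_iff (h : IsMonotoneEquilibrium f₀ M₀ fhat) :
    SpectrallyStable f₀ ↔ 0 ≤ criterion M₀ fhat f₀ := by
  rw [h.criterion_eq, sub_nonneg]
  constructor
  · intro hst
    by_contra hν
    obtain ⟨σ, hσ, hσ1⟩ := h.exists_responseFunction_eq_one isObservable_cos (not_le.1 hν)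
    have hσ' : 0 < (σ : ℂ).re := by simpa using hσ
    exact hst σ (h.mem_vlasovSpectrum hσ' hσ1) hσ'
  · intro hν s hs hre
    exact hs (h.mem_vlasovResolventSet hre (h.responseFunction_ne_one isObservable_cos hre hν)
      (h.responseFunction_ne_one isObservable_sin hre h.spectralMeasure_sin_real_compl_zero.le))

end IsMonotoneEquilibrium

end

end HMF

end

theorem proposition2 (f₀ : ℝ × ℝ → ℝ) (M₀ : ℝ) (fhat : ℝ → ℝ)
    (hstat : HMF.IsStationarySolution f₀)
    (hMx : HMF.orderX f₀ = M₀) (hMy : HMF.orderY f₀ = 0) (hM₀ : 0 < M₀)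
    (hf₀ : ∀ z, f₀ z = fhat (HMF.energy M₀ z))
    (hanti : StrictAntiOn fhat (Ici (-M₀)))
    (hC1 : ContDiffOn ℝ 1 fhat (Ici (-M₀))) :
    HMF.CriterionConverges M₀ fhat f₀ ∧
    (∀ ω : ℂ, 0 < ω.im →
      HMF.DispersionConverges M₀ fhat (HMF.cosCoeff M₀) ω ∧
      HMF.DispersionConverges M₀ fhat (HMF.sinCoeff M₀) ω) ∧
    (HMF.SpectrallyStable f₀ ↔ 0 ≤ HMF.criterion M₀ fhat f₀) ∧
    Tendsto (fun ε : ℝ => HMF.dispersionX M₀ fhat (ε * Complex.I)) (𝓝[>] 0)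
      (𝓝 (HMF.criterion M₀ fhat f₀ : ℂ)) ∧
    Tendsto (fun ε : ℝ => HMF.dispersionY M₀ fhat (ε * Complex.I)) (𝓝[>] 0) (𝓝 0) := by
  have h : HMF.IsMonotoneEquilibrium f₀ M₀ fhat := ⟨hstat, hMx, hMy, hM₀, hf₀, hanti, hC1⟩
  have hx := HMF.isModeFamily_cosCoeff hM₀
  have hy := HMF.isModeFamily_sinCoeff hM₀
  refine ⟨h.criterionConverges, fun ω hω =>
    ⟨h.dispersionConverges HMF.isObservable_cos hx hω.ne',
      h.dispersionConverges HMF.isObservable_sin hy hω.ne'⟩, h.spectrallyStable_iff, ?_, ?_⟩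
  · have := h.tendsto_dispersion HMF.isObservable_cos hx
    rwa [← h.criterion_eq] at this
  · have := h.tendsto_dispersion HMF.isObservable_sin hy
    rwa [h.spectralMeasure_sin_real_compl_zero, sub_self, Complex.ofReal_zero] at this
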